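/- Let $\mathbb{K}$ be $\mathbb{R}$ or $\mathbb{C}$ (manifolds and Lie groups are smooth over $\mathbb{R}$, respectively holomorphic over $\mathbb{C}$). Let $D$ be a simply connected finite-dimensional Lie group over $\mathbb{K}$ with Lie algebra $\mathfrak{d}$, and let $\mathcal{M}=((\mathfrak{d},\langle\cdot,\cdot\rangle),\mathfrak{g}_1,\mathfrak{g}_2)$ be a Manin triple: $\langle\cdot,\cdot\rangle$ is a nondegenerate symmetric invariant bilinear form on $\mathfrak{d}$, and $\mathfrak{d}=\mathfrak{g}_1\oplus\mathfrak{g}_2$ is a direct sum of isotropic Lie subalgebras. For $k\ge 1$ the $k$-uble $\mathcal{M}^k$ is the Manin triple on the Lie algebra $\mathfrak{d}^k$ with form $\sum_{j=1}^k(-1)^{j-1}\langle a_j,b_j\rangle$ and with the splitting $\mathfrak{d}^k=\mathfrak{h}_k\oplus\mathfrak{h}'_k$ given, with $\mathfrak{d}_\Delta=\{(a,a):a\in\mathfrak{d}\}$, by $$\mathfrak{h}_k=\mathfrak{d}_\Delta^{\oplus k/2},\quad \mathfrak{h}'_k=\mathfrak{g}_2\oplus\mathfrak{d}_\Delta^{\oplus(k/2-1)}\oplus\mathfrak{g}_1\quad(k\text{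 even}),$$ $$\mathfrak{h}_k=\mathfrak{d}_\Delta^{\oplus(k-1)/2}\oplus\mathfrak{g}_1,\quad \mathfrak{h}'_k=\mathfrak{g}_2\oplus\mathfrak{d}_\Delta^{\oplus(k-1)/2}\quad(k\text{ odd}).$$ To a Manin triple $((\mathfrak{a},\langle\cdot,\cdot\rangle),\mathfrak{a}_1,\mathfrak{a}_2)$ one attaches $\Lambda\in\wedge^2\mathfrak{a}$, the skew-symmetric part of $\sum_i\xi_i\otimes x_i$, where $(\xi_i)$ is a basis of $\mathfrak{a}_2$ and $(x_i)$ is the dual basis of $\mathfrak{a}_1$ with respect to the form. If $\mathfrak{a}$ is the Lie algebra of a Lie group $A$, put $\pi_A=\Lambda^L-\Lambda^R$ on $A$ (left- minus right-invariant bivector field with value $\Lambda$ at the identity); on a manifold $P$ on which $A$ acts, with infinitesimal action $\sigma$, put $\pi_P=-\sigma(\Lambda)$. Let $m,n\ge1$. Numbering the entries of an $n\times m$ array along a snake that runs down the first column, up the second, down the third, and so on, gives an isomorphism of Lie groups $I=I^{mn}_n:D^{mn}\to(D^m)^n$ (row $i$ of the array is the $i$-th factor $D^m$) and an isomorphism of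 Lie algebras $i^{mn}_n:\mathfrak{d}^{mn}\to(\mathfrak{d}^m)^n$. Let $Q$ be a closed Lie subgroup of $D^{mn}$ whose Lie algebra $\mathfrak{q}\subset\mathfrak{d}^{mn}$ satisfies $[\mathfrak{q}^\perp,\mathfrak{q}^\perp]\subset\mathfrak{q}$, where $\perp$ refers to the form of $\mathcal{M}^{mn}$. Let $D^{mn}/Q$ and $(D^m)^n/I(Q)$ carry the manifold structures for which the projections from the groups are submersions, and let $\Pi^{mn}$ and $\Pi^{m,n}$ be the bivector fields $-\sigma(\Lambda)$ on them given by $\mathcal{M}^{mn}$, respectively by the $n$-uble $(\mathcal{M}^m)^n$ of the $m$-uble $\mathcal{M}^m$, and by the actions of $D^{mn}$ and $(D^m)^n$ by left translation. Then: 1. $i^{mn}_n$ is an isomorphism of Manin triples $\mathcal{M}^{mn}\to(\mathcal{M}^m)^n$, and it is the derivative of $I$ at the identity. 2. $(D^{mn}/Q,\Pi^{mn})$ and $((D^m)^n/I(Q),\Pi^{m,n})$ are Poisson homogeneous spaces of the Poisson Lie groups $(D^{mn},\Lambda^L-\Lambda^R)$ and $((D^m)^n,\Lambda^L-\Lambda^R)$,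 where $\Lambda$ comes from $\mathcal{M}^{mn}$ and from $(\mathcal{M}^m)^n$ respectively; that is, the bivector fields on both groups and on both quotients are Poisson, multiplication in the groups is a Poisson map, and the actions are transitive and are Poisson maps. 3. The map $[g]\mapsto[I(g)]$ from $D^{mn}/Q$ to $(D^m)^n/I(Q)$ is a well-defined isomorphism of Poisson homogeneous spaces: $I$ is an isomorphism of Poisson Lie groups, the map is equivariant along $I$, and it is a diffeomorphism that carries $\Pi^{mn}$ to $\Pi^{m,n}$. -/

import Mathlib

open scoped Manifold ContDiff TensorProduct

noncomputable section

/-! ### Manin triples and their polyubles -/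

section Algebra

/-- The direct product `𝔡 ⊕ ⋯ ⊕ 𝔡` (`n` summands) with the componentwise Lie bracket. -/
instance powLieRing (n : ℕ) (𝔡 : Type*) [LieRing 𝔡] : LieRing (Fin n → 𝔡) where
  bracket a b := fun i => ⁅a i, b i⁆
  add_lie a b c := funext fun i => add_lie (a i) (b i) (c i)
  lie_add a b c := funext fun i => lie_add (a i) (b i) (c i)
  lie_self a := funext fun i => lie_self (a i)
  leibniz_lie a b c := funext fun i => leibniz_lie (a i) (b i) (c i)

theorem pow_lie_apply {n : ℕ} {𝔡 : Type*} [LieRing 𝔡] (a b : Fin n → 𝔡) (i : Fin n) :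
    ⁅a, b⁆ i = ⁅a i, b i⁆ := rfl

instance powLieAlgebra (n : ℕ) (𝕜 𝔡 : Type*) [Field 𝕜] [LieRing 𝔡] [LieAlgebra 𝕜 𝔡] :
    LieAlgebra 𝕜 (Fin n → 𝔡) where
  lie_smul c a b := funext fun i => lie_smul c (a i) (b i)

/-- A Manin triple `((𝔡, ⟨ , ⟩), 𝔤₁, 𝔤₂)`: a nondegenerate symmetric invariant bilinear form on the
Lie algebra `𝔡`, and two isotropic Lie subalgebras of which `𝔡` is the direct sum as a vector
space (in finite dimension these are then automatically Lagrangian). -/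
structure ManinTriple (𝕜 𝔡 : Type*) [Field 𝕜] [LieRing 𝔡] [LieAlgebra 𝕜 𝔡] where
  form : LinearMap.BilinForm 𝕜 𝔡
  form_symm : ∀ a b, form a b = form b a
  form_nondegenerate : ∀ a, (∀ b, form a b = 0) → a = 0
  form_invariant : ∀ a b c, form ⁅a, b⁆ c = form a ⁅b, c⁆
  g₁ : LieSubalgebra 𝕜 𝔡
  g₂ : LieSubalgebra 𝕜 𝔡
  isotropic₁ : ∀ a ∈ g₁, ∀ b ∈ g₁, form a b = 0
  isotropic₂ : ∀ a ∈ g₂, ∀ b ∈ g₂, form a b = 0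
  isCompl : IsCompl g₁.toSubmodule g₂.toSubmodule

/-- An alternating sum of terms that agree on the pairs of positions `(0,1), (2,3), …`. -/
theorem alternating_sum_pairs {𝕜 : Type*} [Field 𝕜] (f : ℕ → 𝕜)
    (h : ∀ k, Even k → f (k + 1) = f k) (N : ℕ) :
    ∑ i ∈ Finset.range N, (-1) ^ i * f i = if Even N then 0 else f (N - 1) := by
  induction N with
  | zero => simp
  | succ N ih =>
    rw [Finset.sum_range_succ, ih]
    by_cases hN : Even N
    · simp [hN, Nat.even_add_one, hN.neg_one_pow]
    · have ho : Odd N := Nat.not_even_iff_odd.mp hN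
      have h1 : Even (N - 1) := by
        obtain ⟨k, rfl⟩ := ho; simp
      have h2 : f N = f (N - 1) := by
        have := h (N - 1) h1
        rwa [Nat.sub_add_cancel ho.pos] at this
      simp [hN, Nat.even_add_one, ho.neg_one_pow, h2]

/-- An alternating sum of terms that agree on the pairs of positions `(1,2), (3,4), …`. -/
theorem alternating_sum_pairs' {𝕜 : Type*} [Field 𝕜] (f : ℕ → 𝕜) (h0 : f 0 = 0)
    (h : ∀ k, Odd k → f (k + 1) = f k) (N : ℕ) :
    ∑ i ∈ Finset.range N, (-1) ^ i * f i = if Odd N then 0 else - f (N - 1) := by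
  induction N with
  | zero => simp [h0]
  | succ N ih =>
    rw [Finset.sum_range_succ, ih]
    by_cases hN : Odd N
    · simp [hN, Nat.odd_add_one, hN.neg_one_pow]
    · have he : Even N := Nat.not_odd_iff_even.mp hN
      rcases Nat.eq_zero_or_pos N with rfl | hpos
      · simp [h0]
      have h1 : Odd (N - 1) := by
        obtain ⟨k, rfl⟩ := he; exact ⟨k - 1, by omega⟩
      have h2 : f N = f (N - 1) := by
        have := h (N - 1) h1
        rwa [Nat.sub_add_cancel hpos] at this
      simp [hN, Nat.odd_add_one, he.neg_one_pow, h2]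

namespace ManinTriple

variable {𝕜 𝔡 : Type*} [Field 𝕜] [LieRing 𝔡] [LieAlgebra 𝕜 𝔡] (M : ManinTriple 𝕜 𝔡)

/-- The form `∑ i, (-1) ^ (i - 1) ⟨a i, b i⟩` (for `i = 1, …, n`) on `𝔡 ^ n`. -/
def polyForm (n : ℕ) : LinearMap.BilinForm 𝕜 (Fin n → 𝔡) :=
  LinearMap.mk₂ 𝕜 (fun a b => ∑ i : Fin n, (-1) ^ (i : ℕ) * M.form (a i) (b i))
    (fun a a' b => by simp [mul_add, Finset.sum_add_distrib])
    (fun c a b => by simp [Finset.mul_sum, mul_left_comm])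
    (fun a b b' => by simp [mul_add, Finset.sum_add_distrib])
    (fun c a b => by simp [Finset.mul_sum, mul_left_comm])

theorem polyForm_apply (n : ℕ) (a b : Fin n → 𝔡) :
    M.polyForm n a b = ∑ i : Fin n, (-1) ^ (i : ℕ) * M.form (a i) (b i) := rfl

/-- With positions counted from `0`: the positions `(0,1), (2,3), …` carry diagonals `𝔡_Δ`, and for
odd `n` the last position carries `𝔤₁`. -/
def polyG₁ (n : ℕ) : LieSubalgebra 𝕜 (Fin n → 𝔡) where
  carrier := {a | (∀ i j : Fin n, Even (i : ℕ) → (j : ℕ) = i + 1 → a j = a i) ∧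
    ∀ i : Fin n, Even (i : ℕ) → (i : ℕ) + 1 = n → a i ∈ M.g₁}
  add_mem' := by
    rintro a b ⟨ha, ha'⟩ ⟨hb, hb'⟩
    exact ⟨fun i j hi hj => by simp [ha i j hi hj, hb i j hi hj],
      fun i hi hn => add_mem (ha' i hi hn) (hb' i hi hn)⟩
  zero_mem' := ⟨fun _ _ _ _ => rfl, fun _ _ _ => zero_mem _⟩
  smul_mem' := by
    rintro c a ⟨ha, ha'⟩
    exact ⟨fun i j hi hj => by simp [ha i j hi hj],
      fun i hi hn => M.g₁.smul_mem c (ha' i hi hn)⟩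
  lie_mem' := by
    rintro a b ⟨ha, ha'⟩ ⟨hb, hb'⟩
    exact ⟨fun i j hi hj => by simp only [pow_lie_apply, ha i j hi hj, hb i j hi hj],
      fun i hi hn => M.g₁.lie_mem (ha' i hi hn) (hb' i hi hn)⟩

/-- With positions counted from `0`: position `0` carries `𝔤₂`, the positions `(1,2), (3,4), …`
carry diagonals `𝔡_Δ`, and for even `n` the last position carries `𝔤₁`. -/
def polyG₂ (n : ℕ) : LieSubalgebra 𝕜 (Fin n → 𝔡) where
  carrier := {a | (∀ i : Fin n, (i : ℕ) = 0 → a i ∈ M.g₂) ∧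
    (∀ i j : Fin n, Odd (i : ℕ) → (j : ℕ) = i + 1 → a j = a i) ∧
    ∀ i : Fin n, Odd (i : ℕ) → (i : ℕ) + 1 = n → a i ∈ M.g₁}
  add_mem' := by
    rintro a b ⟨ha'', ha, ha'⟩ ⟨hb'', hb, hb'⟩
    exact ⟨fun i hi => add_mem (ha'' i hi) (hb'' i hi),
      fun i j hi hj => by simp [ha i j hi hj, hb i j hi hj],
      fun i hi hn => add_mem (ha' i hi hn) (hb' i hi hn)⟩
  zero_mem' := ⟨fun _ _ => zero_mem _, fun _ _ _ _ => rfl, fun _ _ _ => zero_mem _⟩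
  smul_mem' := by
    rintro c a ⟨ha'', ha, ha'⟩
    exact ⟨fun i hi => M.g₂.smul_mem c (ha'' i hi), fun i j hi hj => by simp [ha i j hi hj],
      fun i hi hn => M.g₁.smul_mem c (ha' i hi hn)⟩
  lie_mem' := by
    rintro a b ⟨ha'', ha, ha'⟩ ⟨hb'', hb, hb'⟩
    exact ⟨fun i hi => M.g₂.lie_mem (ha'' i hi) (hb'' i hi),
      fun i j hi hj => by simp only [pow_lie_apply, ha i j hi hj, hb i j hi hj],
      fun i hi hn => M.g₁.lie_mem (ha' i hi hn) (hb' i hi hn)⟩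

theorem polyG₁_isotropic (n : ℕ) (a : Fin n → 𝔡) (ha : a ∈ M.polyG₁ n) (b : Fin n → 𝔡)
    (hb : b ∈ M.polyG₁ n) : M.polyForm n a b = 0 := by
  obtain ⟨ha, ha'⟩ := ha
  obtain ⟨hb, hb'⟩ := hb
  let f : ℕ → 𝕜 := fun k => if h : k < n then M.form (a ⟨k, h⟩) (b ⟨k, h⟩) else 0
  have hlast : ∀ k, Even k → k + 1 = n → f k = 0 := by
    intro k hk hkn
    have hlt : k < n := by omega
    simp only [f, hlt, dif_pos]
    exact M.isotropic₁ _ (ha' ⟨k, hlt⟩ hk hkn) _ (hb' ⟨k, hlt⟩ hk hkn)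
  have hf : ∀ k, Even k → f (k + 1) = f k := by
    intro k hk
    by_cases h1 : k + 1 < n
    · have h0 : k < n := by omega
      simp only [f, h0, h1, dif_pos]
      rw [ha ⟨k, h0⟩ ⟨k + 1, h1⟩ hk rfl, hb ⟨k, h0⟩ ⟨k + 1, h1⟩ hk rfl]
    · by_cases h2 : k + 1 = n
      · rw [hlast k hk h2]; simp [f, h1]
      · have h0 : ¬ k < n := by omega
        simp [f, h0, h1]
  have hsum : M.polyForm n a b = ∑ i ∈ Finset.range n, (-1) ^ i * f i := by
    rw [polyForm_apply, Finset.sum_range]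
    exact Finset.sum_congr rfl fun i _ => by simp [f]
  rw [hsum, alternating_sum_pairs f hf]
  split_ifs with hn
  · rfl
  · have ho : Odd n := Nat.not_even_iff_odd.mp hn
    exact hlast _ (by obtain ⟨k, rfl⟩ := ho; simp) (Nat.sub_add_cancel ho.pos)

theorem polyG₂_isotropic (n : ℕ) (a : Fin n → 𝔡) (ha : a ∈ M.polyG₂ n) (b : Fin n → 𝔡)
    (hb : b ∈ M.polyG₂ n) : M.polyForm n a b = 0 := by
  obtain ⟨ha0, ha, ha'⟩ := ha
  obtain ⟨hb0, hb, hb'⟩ := hb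
  let f : ℕ → 𝕜 := fun k => if h : k < n then M.form (a ⟨k, h⟩) (b ⟨k, h⟩) else 0
  have hlast : ∀ k, Odd k → k + 1 = n → f k = 0 := by
    intro k hk hkn
    have hlt : k < n := by omega
    simp only [f, hlt, dif_pos]
    exact M.isotropic₁ _ (ha' ⟨k, hlt⟩ hk hkn) _ (hb' ⟨k, hlt⟩ hk hkn)
  have hzero : f 0 = 0 := by
    by_cases h : 0 < n
    · simp only [f, h, dif_pos]
      exact M.isotropic₂ _ (ha0 ⟨0, h⟩ rfl) _ (hb0 ⟨0, h⟩ rfl)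
    · simp [f, h]
  have hf : ∀ k, Odd k → f (k + 1) = f k := by
    intro k hk
    by_cases h1 : k + 1 < n
    · have h0 : k < n := by omega
      simp only [f, h0, h1, dif_pos]
      rw [ha ⟨k, h0⟩ ⟨k + 1, h1⟩ hk rfl, hb ⟨k, h0⟩ ⟨k + 1, h1⟩ hk rfl]
    · by_cases h2 : k + 1 = n
      · rw [hlast k hk h2]; simp [f, h1]
      · have h0 : ¬ k < n := by omega
        simp [f, h0, h1]
  have hsum : M.polyForm n a b = ∑ i ∈ Finset.range n, (-1) ^ i * f i := by
    rw [polyForm_apply, Finset.sum_range]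
    exact Finset.sum_congr rfl fun i _ => by simp [f]
  rw [hsum, alternating_sum_pairs' f hzero hf]
  split_ifs with hn
  · rfl
  · have he : Even n := Nat.not_odd_iff_even.mp hn
    rcases Nat.eq_zero_or_pos n with rfl | hpos
    · simp [hzero]
    · rw [hlast _ (by obtain ⟨k, rfl⟩ := he; exact ⟨k - 1, by omega⟩) (Nat.sub_add_cancel hpos),
        neg_zero]

/-- The partial alternating sums `a k - a (k - 1) + ⋯` that solve the chain of equations expressing
a vector of `𝔡 ^ n` through the two subalgebras. -/
def chain {n : ℕ} (a : Fin n → 𝔡) : ℕ → 𝔡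
  | 0 => 0
  | k + 1 => (if h : k < n then a ⟨k, h⟩ else 0) - chain a k

theorem poly_isCompl (n : ℕ) :
    IsCompl (M.polyG₁ n).toSubmodule (M.polyG₂ n).toSubmodule := by
  constructor
  · rw [Submodule.disjoint_def]
    rintro a ⟨h1, h1'⟩ ⟨h2, h2', h2''⟩
    have key : ∀ k (hk : k < n) (h0 : 0 < n), a ⟨k, hk⟩ = a ⟨0, h0⟩ := by
      intro k
      induction k with
      | zero => intros; rfl
      | succ k ih =>
        intro hk h0
        have hk' : k < n := by omega
        rw [← ih hk' h0]
        rcases Nat.even_or_odd k with he | ho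
        · exact h1 ⟨k, hk'⟩ ⟨k + 1, hk⟩ he rfl
        · exact h2' ⟨k, hk'⟩ ⟨k + 1, hk⟩ ho rfl
    funext i
    have h0 : 0 < n := i.pos
    have hl : n - 1 < n := by omega
    have hm1 : a ⟨0, h0⟩ ∈ M.g₁ := by
      rw [← key (n - 1) hl h0]
      rcases Nat.even_or_odd (n - 1) with he | ho
      · exact h1' ⟨n - 1, hl⟩ he (by simp; omega)
      · exact h2'' ⟨n - 1, hl⟩ ho (by simp; omega)
    have := Submodule.disjoint_def.mp M.isCompl.disjoint _ hm1 (h2 ⟨0, h0⟩ rfl)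
    rw [Pi.zero_apply, ← this]
    exact key i i.2 h0
  · rw [codisjoint_iff, eq_top_iff]
    intro a _
    obtain ⟨u, hu, v, hv, huv⟩ : ∃ u ∈ M.g₁, ∃ v ∈ M.g₂, u + v = chain a n := by
      have : chain a n ∈ M.g₁.toSubmodule ⊔ M.g₂.toSubmodule := by
        rw [M.isCompl.sup_eq_top]; trivial
      exact Submodule.mem_sup.mp this
    -- `c` is the entry of the second component at position `0`
    obtain ⟨c, hc, hodd, heven⟩ : ∃ c ∈ M.g₂, (Odd n → chain a n - c ∈ M.g₁) ∧
        (Even n → chain a n + c ∈ M.g₁) := by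
      by_cases ho : Odd n
      · refine ⟨v, hv, fun _ => ?_, fun he => absurd he (Nat.not_even_iff_odd.mpr ho)⟩
        rwa [← huv, add_sub_cancel_right]
      · refine ⟨-v, neg_mem hv, fun h => absurd h ho, fun _ => ?_⟩
        rwa [← huv, add_neg_cancel_right]
    have hchain : ∀ i : Fin n, chain a (i + 1) = a i - chain a i := by
      intro i; simp [chain]
    let b : Fin n → 𝔡 := fun i => if Even (i : ℕ) then chain a (i + 1) - c else chain a i - c
    let d : Fin n → 𝔡 := fun i => if Even (i : ℕ) then chain a i + c else chain a (i + 1) + c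
    have hbd : b + d = a := by
      funext i
      simp only [Pi.add_apply, b, d]
      split_ifs <;> rw [hchain] <;> abel
    rw [← hbd]
    refine Submodule.add_mem_sup ⟨?_, ?_⟩ ⟨?_, ?_, ?_⟩
    · intro i j hi hj
      have hj' : ¬ Even (j : ℕ) := by rw [hj]; simpa [Nat.even_add_one] using hi
      simp only [b, if_pos hi, if_neg hj', hj]
    · intro i hi hn
      simp only [b, if_pos hi, hn]
      exact hodd (hn ▸ hi.add_one)
    · intro i hi
      simp only [d, hi]
      simpa [chain] using hc
    · intro i j hi hj
      have hi' : ¬ Even (i : ℕ) := Nat.not_even_iff_odd.mpr hi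
      have hj' : Even (j : ℕ) := by rw [hj]; exact hi.add_one
      simp only [d, if_neg hi', if_pos hj', hj]
    · intro i hi hn
      simp only [d, if_neg (Nat.not_even_iff_odd.mpr hi), hn]
      exact heven (hn ▸ hi.add_one)

/-- The `n`-uble of a Manin triple. -/
def polyuble (n : ℕ) : ManinTriple 𝕜 (Fin n → 𝔡) where
  form := M.polyForm n
  form_symm a b := by
    simp only [polyForm_apply]
    exact Finset.sum_congr rfl fun i _ => by rw [M.form_symm]
  form_nondegenerate a h := by
    funext i
    refine M.form_nondegenerate _ fun x => ?_
    have := h (Pi.single i x)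
    rw [polyForm_apply, Finset.sum_eq_single i] at this
    · simpa using this
    · intro j _ hj
      simp [Pi.single_eq_of_ne hj]
    · simp
  form_invariant a b c := by
    simp only [polyForm_apply, pow_lie_apply, M.form_invariant]
  g₁ := M.polyG₁ n
  g₂ := M.polyG₂ n
  isotropic₁ := M.polyG₁_isotropic n
  isotropic₂ := M.polyG₂_isotropic n
  isCompl := M.poly_isCompl n

/-- The condition `[𝔮^⊥, 𝔮^⊥] ⊂ 𝔮`, where `𝔮^⊥` is the orthogonal of `𝔮` for the form of the Manin
triple. -/
def IsAdmissible (q : Set 𝔡) : Prop :=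
  ∀ a b, (∀ x ∈ q, M.form a x = 0) → (∀ x ∈ q, M.form b x = 0) → ⁅a, b⁆ ∈ q

/-- A Lie algebra isomorphism that is an isomorphism of Manin triples: it preserves the forms and
both terms of the Lagrangian splittings. -/
structure IsIso {𝔡' : Type*} [LieRing 𝔡'] [LieAlgebra 𝕜 𝔡'] (M' : ManinTriple 𝕜 𝔡')
    (f : 𝔡 ≃ₗ⁅𝕜⁆ 𝔡') : Prop where
  form_eq : ∀ a b, M'.form (f a) (f b) = M.form a b
  map_g₁ : ∀ a, f a ∈ M'.g₁ ↔ a ∈ M.g₁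
  map_g₂ : ∀ a, f a ∈ M'.g₂ ↔ a ∈ M.g₂

theorem eq_zero_of_orthogonal (a : 𝔡) (h₁ : ∀ x ∈ M.g₁, M.form a x = 0)
    (h₂ : ∀ x ∈ M.g₂, M.form a x = 0) : a = 0 := by
  refine M.form_nondegenerate a fun b => ?_
  have hb : b ∈ M.g₁.toSubmodule ⊔ M.g₂.toSubmodule := by
    rw [M.isCompl.sup_eq_top]; trivial
  obtain ⟨u, hu, v, hv, rfl⟩ := Submodule.mem_sup.mp hb
  rw [map_add, h₁ u hu, h₂ v hv, add_zero]

/-- The pairing `x ↦ ⟨x, ·⟩` of `𝔤₁` with `𝔤₂`. -/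
def pairingMap : M.g₁.toSubmodule →ₗ[𝕜] Module.Dual 𝕜 M.g₂.toSubmodule :=
  M.form.domRestrict₁₂ M.g₁.toSubmodule M.g₂.toSubmodule

theorem pairingMap_bijective [FiniteDimensional 𝕜 𝔡] : Function.Bijective M.pairingMap := by
  have h1 : Function.Injective M.pairingMap := by
    rw [injective_iff_map_eq_zero]
    intro x hx
    refine Subtype.ext (M.eq_zero_of_orthogonal _ (fun y hy => M.isotropic₁ _ x.2 _ hy) ?_)
    intro y hy
    exact LinearMap.congr_fun hx ⟨y, hy⟩
  have h2 : Function.Injective M.pairingMap.flip := by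
    rw [injective_iff_map_eq_zero]
    intro y hy
    refine Subtype.ext (M.eq_zero_of_orthogonal _ ?_ (fun x hx => M.isotropic₂ _ y.2 _ hx))
    intro x hx
    rw [M.form_symm]
    exact LinearMap.congr_fun hy ⟨x, hx⟩
  have e1 := LinearMap.finrank_le_finrank_of_injective h1
  have e2 := LinearMap.finrank_le_finrank_of_injective h2
  rw [Subspace.dual_finrank_eq] at e1 e2
  refine ⟨h1, (LinearMap.injective_iff_surjective_of_finrank_eq_finrank ?_).mp h1⟩
  rw [Subspace.dual_finrank_eq]
  omega

/-- The form identifies `𝔤₁` with the dual of `𝔤₂`. -/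
def pairing [FiniteDimensional 𝕜 𝔡] :
    M.g₁.toSubmodule ≃ₗ[𝕜] Module.Dual 𝕜 M.g₂.toSubmodule :=
  LinearEquiv.ofBijective M.pairingMap M.pairingMap_bijective

/-- The element `r = ∑ i, ξ i ⊗ x i`, where `ξ` is a basis of `𝔤₂` and `x` is the dual basis of `𝔤₁`
with respect to the form (`r` does not depend on the basis). -/
def rMatrix [FiniteDimensional 𝕜 𝔡] : 𝔡 ⊗[𝕜] 𝔡 :=
  ∑ i, ((Module.finBasis 𝕜 M.g₂.toSubmodule i : M.g₂.toSubmodule) : 𝔡) ⊗ₜ[𝕜]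
    (M.pairing.symm ((Module.finBasis 𝕜 M.g₂.toSubmodule).coord i) : 𝔡)

/-- The skew-symmetric part of `r`. -/
def Lam [FiniteDimensional 𝕜 𝔡] : 𝔡 ⊗[𝕜] 𝔡 :=
  (2 : 𝕜)⁻¹ • (M.rMatrix - TensorProduct.comm 𝕜 𝔡 𝔡 M.rMatrix)

end ManinTriple

end Algebra

/-! ### The snake isomorphism -/

section Snake

/-- With rows and columns counted from `0`, the entry in row `i` and column `j` of an `n × m` array
is numbered by a snake that runs down the even columns and up the odd ones. -/
def snake (m n : ℕ) : Fin n × Fin m ≃ Fin (m * n) :=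
  ((Equiv.prodComm (Fin n) (Fin m)).trans
    (Equiv.prodShear (Equiv.refl (Fin m))
      (fun j => if Even (j : ℕ) then Equiv.refl (Fin n) else Fin.revPerm))).trans finProdFinEquiv

theorem snake_val (m n : ℕ) (i : Fin n) (j : Fin m) :
    (snake m n (i, j) : ℕ) = if Even (j : ℕ) then j * n + i else j * n + (n - 1 - i) := by
  by_cases h : Even (j : ℕ)
  · simp [snake, h, finProdFinEquiv]
    ring
  · have h1 : n - ((i : ℕ) + 1) = n - 1 - i := by omega
    simp [snake, h, finProdFinEquiv, h1]
    ring

/-- The Lie algebra isomorphism `𝔡 ^ (m n) ≃ (𝔡 ^ m) ^ n` given by the snake. -/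
def snakeLie (𝕜 𝔡 : Type*) [Field 𝕜] [LieRing 𝔡] [LieAlgebra 𝕜 𝔡] (m n : ℕ) :
    (Fin (m * n) → 𝔡) ≃ₗ⁅𝕜⁆ (Fin n → Fin m → 𝔡) where
  toFun a := fun i j => a (snake m n (i, j))
  invFun b := fun k => b ((snake m n).symm k).1 ((snake m n).symm k).2
  map_add' _ _ := rfl
  map_smul' _ _ := rfl
  map_lie' := rfl
  left_inv a := by funext k; simp
  right_inv b := by funext i j; simp

/-- The group isomorphism `D ^ (m n) ≃ (D ^ m) ^ n` given by the snake. -/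
def snakeGroup (D : Type*) [Group D] (m n : ℕ) :
    (Fin (m * n) → D) ≃* (Fin n → Fin m → D) where
  toFun a := fun i j => a (snake m n (i, j))
  invFun b := fun k => b ((snake m n).symm k).1 ((snake m n).symm k).2
  map_mul' _ _ := rfl
  left_inv a := by funext k; simp
  right_inv b := by funext i j; simp

/-- The bijection `[g] ↦ [e g]` from `G ⧸ Q` to `G' ⧸ e(Q)` induced by a group isomorphism `e`. -/
def cosetEquiv {G G' : Type*} [Group G] [Group G'] (e : G ≃* G') (Q : Subgroup G) :
    G ⧸ Q ≃ G' ⧸ Q.map e.toMonoidHom :=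
  Quotient.congr e.toEquiv fun a b => by
    change QuotientGroup.leftRel Q a b ↔
      QuotientGroup.leftRel (Q.map e.toMonoidHom) (e a) (e b)
    rw [QuotientGroup.leftRel_apply, QuotientGroup.leftRel_apply, ← map_inv, ← map_mul]
    exact (Subgroup.mem_map_iff_mem (f := e.toMonoidHom) e.injective).symm

theorem cosetEquiv_mk {G G' : Type*} [Group G] [Group G'] (e : G ≃* G') (Q : Subgroup G) (g : G) :
    cosetEquiv e Q (g : G ⧸ Q) = ((e g : G') : G' ⧸ Q.map e.toMonoidHom) := rfl

end Snake

/-! ### Poisson structures -/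

section Poisson

variable {𝕜 : Type*} [NontriviallyNormedField 𝕜]
  {E : Type*} [NormedAddCommGroup E] [NormedSpace 𝕜 E] {H : Type*} [TopologicalSpace H]
  (I : ModelWithCorners 𝕜 E H)
  {E' : Type*} [NormedAddCommGroup E'] [NormedSpace 𝕜 E'] {H' : Type*} [TopologicalSpace H']
  (J : ModelWithCorners 𝕜 E' H')

/-- A contravariant `2`-tensor field, not necessarily smooth or skew-symmetric. -/
abbrev TwoTensorField (X : Type*) [TopologicalSpace X] [ChartedSpace H X] :=
  ∀ x : X, TangentSpace I x ⊗[𝕜] TangentSpace I x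

variable {X : Type*} [TopologicalSpace X] [ChartedSpace H X]
  {Y : Type*} [TopologicalSpace Y] [ChartedSpace H' Y]

/-- The differential of a scalar function at a point, as a linear form. -/
def differential (f : X → 𝕜) (x : X) : TangentSpace I x →ₗ[𝕜] 𝕜 :=
  (NormedSpace.fromTangentSpace (𝕜 := 𝕜) (f x)).toLinearMap ∘ₗ
    (mfderiv I 𝓘(𝕜, 𝕜) f x).toLinearMap

/-- The bracket `{f, g} = π(df, dg)`. -/
def poissonBracket (π : TwoTensorField I X) (f g : X → 𝕜) (x : X) : 𝕜 :=
  LinearMap.mul' 𝕜 𝕜 (TensorProduct.map (differential I f x) (differential I g x) (π x))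

/-- `π` is a Poisson structure: a smooth bivector field such that `{f, g} = π(df, dg)` satisfies the
Jacobi identity. All functions are allowed to be defined on open subsets only (over `ℂ` there may be
too few global functions); smoothness of `π` says that its contraction with the differentials of
any two local smooth functions, for instance coordinates, is smooth. -/
structure IsPoissonStructure (π : TwoTensorField I X) : Prop where
  skew : ∀ x, TensorProduct.comm 𝕜 _ _ (π x) = - π x
  smooth : ∀ (U : Set X) (f g : X → 𝕜), IsOpen U → ContMDiffOn I 𝓘(𝕜, 𝕜) ∞ f U →
    ContMDiffOn I 𝓘(𝕜, 𝕜) ∞ g U → ContMDiffOn I 𝓘(𝕜, 𝕜) ∞ (poissonBracket I π f g) U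
  jacobi : ∀ (U : Set X) (f g h : X → 𝕜), IsOpen U → ContMDiffOn I 𝓘(𝕜, 𝕜) ∞ f U →
    ContMDiffOn I 𝓘(𝕜, 𝕜) ∞ g U → ContMDiffOn I 𝓘(𝕜, 𝕜) ∞ h U → ∀ x ∈ U,
    poissonBracket I π f (poissonBracket I π g h) x +
      poissonBracket I π g (poissonBracket I π h f) x +
      poissonBracket I π h (poissonBracket I π f g) x = 0

/-- A Poisson map: a smooth map that carries `π` to `π'`. -/
structure IsPoissonMap (π : TwoTensorField I X) (π' : TwoTensorField J Y) (φ : X → Y) : Prop where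
  contMDiff : ContMDiff I J ∞ φ
  map_eq : ∀ x, TensorProduct.map (mfderiv I J φ x).toLinearMap (mfderiv I J φ x).toLinearMap (π x)
    = π' (φ x)

/-- A Poisson isomorphism: a diffeomorphism that is Poisson in both directions. -/
structure IsPoissonIso (π : TwoTensorField I X) (π' : TwoTensorField J Y) (φ : X ≃ Y) : Prop where
  toFun : IsPoissonMap I J π π' φ
  invFun : IsPoissonMap J I π' π φ.symm

/-- The product `π × π'` on `X × Y`. -/
def prodTensorField (π : TwoTensorField I X) (π' : TwoTensorField J Y) :
    TwoTensorField (I.prod J) (X × Y) := fun p =>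
  TensorProduct.map (mfderiv I (I.prod J) (fun x : X => (x, p.2)) p.1).toLinearMap
      (mfderiv I (I.prod J) (fun x : X => (x, p.2)) p.1).toLinearMap (π p.1) +
    TensorProduct.map (mfderiv J (I.prod J) (fun y : Y => (p.1, y)) p.2).toLinearMap
      (mfderiv J (I.prod J) (fun y : Y => (p.1, y)) p.2).toLinearMap (π' p.2)

variable {G : Type*} [Group G] [TopologicalSpace G] [ChartedSpace H G]

/-- A Poisson Lie group: the multiplication is a Poisson map. -/
structure IsPoissonLieGroup (π : TwoTensorField I G) : Prop where
  poisson : IsPoissonStructure I π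
  mul : IsPoissonMap (I.prod I) I (prodTensorField I I π π) π (fun p : G × G => p.1 * p.2)

/-- `(Y, π')` is a Poisson homogeneous space of the Poisson Lie group `(G, π)`: the action of `G` on
`Y` is transitive, and the action map `G × Y → Y` is a Poisson map (in particular smooth). -/
structure IsPoissonHomogeneousSpace [MulAction G Y] (π : TwoTensorField I G)
    (π' : TwoTensorField J Y) : Prop where
  poissonLieGroup : IsPoissonLieGroup I π
  poisson : IsPoissonStructure J π'
  transitive : MulAction.IsPretransitive G Y
  action : IsPoissonMap (I.prod J) J (prodTensorField I J π π') π' (fun p : G × Y => p.1 • p.2)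

/-- The derivative at `1` of the left translation by `g`. -/
def leftTranslation (g : G) : GroupLieAlgebra I G →ₗ[𝕜] TangentSpace I g where
  toFun v := mfderiv I I (fun h : G => g * h) 1 v
  map_add' v w := (mfderiv I I (fun h : G => g * h) 1).map_add v w
  map_smul' c v := (mfderiv I I (fun h : G => g * h) 1).map_smul c v

/-- The derivative at `1` of the right translation by `g`. -/
def rightTranslation (g : G) : GroupLieAlgebra I G →ₗ[𝕜] TangentSpace I g where
  toFun v := mfderiv I I (fun h : G => h * g) 1 v
  map_add' v w := (mfderiv I I (fun h : G => h * g) 1).map_add v w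
  map_smul' c v := (mfderiv I I (fun h : G => h * g) 1).map_smul c v

/-- The vector field `σ(v)` on `Y` generated by `v` in the Lie algebra of `G`, at the point `y`: the
derivative at `1` of the orbit map `g ↦ g • y` applied to `v`. -/
def infinitesimalAction [MulAction G Y] (y : Y) : GroupLieAlgebra I G →ₗ[𝕜] TangentSpace J y where
  toFun v := mfderiv I J (fun g : G => g • y) 1 v
  map_add' v w := (mfderiv I J (fun g : G => g • y) 1).map_add v w
  map_smul' c v := (mfderiv I J (fun g : G => g • y) 1).map_smul c v

/-- The tensor field `Λ^L - Λ^R` on the group. -/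
def groupTensorField (L : GroupLieAlgebra I G ⊗[𝕜] GroupLieAlgebra I G) : TwoTensorField I G :=
  fun g => TensorProduct.map (leftTranslation I g) (leftTranslation I g) L -
    TensorProduct.map (rightTranslation I g) (rightTranslation I g) L

/-- The tensor field `-σ(Λ)` on a space with an action of the group. -/
def actionTensorField (Y : Type*) [TopologicalSpace Y] [ChartedSpace H' Y] [MulAction G Y]
    (L : GroupLieAlgebra I G ⊗[𝕜] GroupLieAlgebra I G) : TwoTensorField J Y :=
  fun y => - TensorProduct.map (infinitesimalAction I J y) (infinitesimalAction I J y) L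

section Induced

variable {𝔡 : Type*} [LieRing 𝔡] [LieAlgebra 𝕜 𝔡] [FiniteDimensional 𝕜 𝔡] (M : ManinTriple 𝕜 𝔡)
  {I} (φ : 𝔡 ≃ₗ[𝕜] GroupLieAlgebra I G)

/-- The tensor field `Λ^L - Λ^R` on a Lie group `G` whose Lie algebra is identified with `𝔡` by `φ`,
for the element `Λ` given by the Manin triple. -/
def ManinTriple.groupStructure : TwoTensorField I G :=
  groupTensorField I (TensorProduct.map φ.toLinearMap φ.toLinearMap M.Lam)

/-- The tensor field `-σ(Λ)` on a space on which `G` acts, for the element `Λ` given by the Manin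
triple. -/
def ManinTriple.spaceStructure (Y : Type*) [TopologicalSpace Y] [ChartedSpace H' Y]
    [MulAction G Y] : TwoTensorField J Y :=
  actionTensorField I J Y (TensorProduct.map φ.toLinearMap φ.toLinearMap M.Lam)

end Induced

/-- The Lie algebra of a closed subgroup `Q`: the velocities at `1` of the smooth one-parameter
subgroups contained in `Q`. -/
def lieAlgebraOfSubgroup (Q : Subgroup G) : Set (GroupLieAlgebra I G) :=
  {v | ∃ γ : 𝕜 → G, ContMDiff 𝓘(𝕜, 𝕜) I ∞ γ ∧ (∀ s t, γ (s + t) = γ s * γ t) ∧ (∀ t, γ t ∈ Q) ∧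
    mfderiv 𝓘(𝕜, 𝕜) I γ 0 ((NormedSpace.fromTangentSpace (𝕜 := 𝕜) (0 : 𝕜)).symm 1) = v}

end Poisson

/-! ### Powers of a Lie group -/

section Powers

/-- The model with corners of the `n`-th power of a manifold. -/
abbrev powModel {𝕜 : Type*} [NontriviallyNormedField 𝕜]
    {E : Type*} [NormedAddCommGroup E] [NormedSpace 𝕜 E] {H : Type*} [TopologicalSpace H]
    (I : ModelWithCorners 𝕜 E H) (n : ℕ) :
    ModelWithCorners 𝕜 (Fin n → E) (ModelPi fun _ : Fin n => H) :=
  ModelWithCorners.pi fun _ => I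

/-- The identification of `𝔡 ^ n` with the Lie algebra of `D ^ n`. It is the identity map, as charts
of `D ^ n` are products of charts of `D`. -/
def powTangent {𝕜 : Type*} [NontriviallyNormedField 𝕜]
    {E : Type*} [NormedAddCommGroup E] [NormedSpace 𝕜 E] {H : Type*} [TopologicalSpace H]
    (I : ModelWithCorners 𝕜 E H) (D : Type*) [Group D] [TopologicalSpace D] [ChartedSpace H D]
    (n : ℕ) :
    (Fin n → GroupLieAlgebra I D) ≃ₗ[𝕜] GroupLieAlgebra (powModel I n) (Fin n → D) where
  toFun v := v
  invFun v := v
  map_add' _ _ := rfl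
  map_smul' _ _ := rfl
  left_inv _ := rfl
  right_inv _ := rfl

/-- The identification of `(𝔡 ^ m) ^ n` with the Lie algebra of `(D ^ m) ^ n`. -/
def powPowTangent {𝕜 : Type*} [NontriviallyNormedField 𝕜]
    {E : Type*} [NormedAddCommGroup E] [NormedSpace 𝕜 E] {H : Type*} [TopologicalSpace H]
    (I : ModelWithCorners 𝕜 E H) (D : Type*) [Group D] [TopologicalSpace D] [ChartedSpace H D]
    (m n : ℕ) :
    (Fin n → Fin m → GroupLieAlgebra I D) ≃ₗ[𝕜]
      GroupLieAlgebra (powModel (powModel I m) n) (Fin n → Fin m → D) :=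
  (LinearEquiv.piCongrRight fun _ : Fin n => powTangent I D m).trans
    (powTangent (powModel I m) (Fin m → D) n)

instance lieGroup_minSmoothness {𝕜 : Type*} [RCLike 𝕜]
    {E : Type*} [NormedAddCommGroup E] [NormedSpace 𝕜 E] {H : Type*} [TopologicalSpace H]
    (I : ModelWithCorners 𝕜 E H) (D : Type*) [Group D] [TopologicalSpace D] [ChartedSpace H D]
    [LieGroup I ∞ D] : LieGroup I (minSmoothness 𝕜 3) D := by
  rw [minSmoothness_of_isRCLikeNormedField]
  infer_instance

instance finiteDimensional_tangentSpace {𝕜 : Type*} [NontriviallyNormedField 𝕜]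
    {E : Type*} [NormedAddCommGroup E] [NormedSpace 𝕜 E] [h : FiniteDimensional 𝕜 E]
    {H : Type*} [TopologicalSpace H]
    (I : ModelWithCorners 𝕜 E H) {X : Type*} [TopologicalSpace X] [ChartedSpace H X] (x : X) :
    FiniteDimensional 𝕜 (TangentSpace I x) := h

end Powers

end

/-! For a Manin triple let `p₁`, `p₂` be the projections onto `𝔤₁`, `𝔤₂`. Through the form, `Λ`
becomes the skew operator `r = (p₂ - p₁)/2` (`ManinTriple.tensorEval_Lam`). Because `𝔤₁` and `𝔤₂`
are subalgebras, `r` solves the modified classical Yang-Baxter equation; equivalently, the cyclic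
sum of `⟨c, [r a, r b]⟩` is `-⟨c, [a, b]⟩/4` (`ManinTriple.rOp_cyclic`), an invariant trilinear
form.

Groups and quotients are treated by one family of brackets, `κ Λ^L - Λ^R` on a group. Left-invariant
derivatives represent the Lie algebra, right-invariant ones its opposite, and the two kinds commute;
so the Jacobiator is `κ²` times the cubic expression in the left gradients minus the same expression
in the right gradients (`biBracket_jacobi`). The two gradients differ by `Ad`, which on a connected
group preserves the form. Hence the Jacobiator is `(1 - κ²)⟨c, [a, b]⟩/4`, where `a`, `b`, `c`
represent the left gradients (`ManinTriple.biBracket_jacobi`).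

For `κ = 1` it vanishes, and the group is Poisson. For `κ = 0` the bracket is that of `-σ(Λ)` on
functions lifted from the quotient. Such functions are constant on cosets of `Q`, so `a`, `b`, `c`
lie in `𝔮^⊥`; then `[a, b] ∈ 𝔮` by admissibility, and its pairing with `c` is zero. That
multiplication and action are compatible with the bivector fields is the chain rule, for any `Λ`.

The comparison of the two polyubles is combinatorial. The snake number of `(i, j)` has the parity of
`i + j`, so the signs of the forms agree; consecutive numbers belong to vertical neighbours, or to
horizontal neighbours at a turn, and these are the pairs that the iterated splitting puts on
diagonals (`snakeLie_isIso`). An isomorphism of Manin triples carries `Λ` to `Λ`, and the snake is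
the derivative of the group isomorphism, so the latter and the induced map of quotients are Poisson.
Smoothness on the quotients is tested on the groups, through local sections of the projections. -/

noncomputable section

set_option linter.unusedSectionVars false

/-! ### The operator of a Manin triple and the modified Yang-Baxter equation. -/

section AlgebraLemmas

namespace ManinTriple

variable {𝕜 𝔡 : Type*} [Field 𝕜] [LieRing 𝔡] [LieAlgebra 𝕜 𝔡] (M : ManinTriple 𝕜 𝔡)
  {𝔡' : Type*} [LieRing 𝔡'] [LieAlgebra 𝕜 𝔡']

/-- The projection of `𝔡` onto `𝔤₂` along `𝔤₁`. -/
def proj₂ : 𝔡 →ₗ[𝕜] 𝔡 :=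
  M.g₂.toSubmodule.subtype ∘ₗ Submodule.projectionOnto _ _ M.isCompl.symm

theorem proj₂_add {a b : 𝔡} (ha : a ∈ M.g₁) (hb : b ∈ M.g₂) : M.proj₂ (a + b) = b := by
  have h1 := Submodule.projectionOnto_apply_right M.isCompl.symm ⟨a, ha⟩
  have h2 := Submodule.projectionOnto_apply_left M.isCompl.symm ⟨b, hb⟩
  simp only [proj₂, map_add, LinearMap.comp_apply]
  erw [h1, h2]
  simp

theorem exists_add (a : 𝔡) : ∃ u ∈ M.g₁, ∃ v ∈ M.g₂, u + v = a := by
  have ha : a ∈ M.g₁.toSubmodule ⊔ M.g₂.toSubmodule := by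
    rw [M.isCompl.sup_eq_top]; trivial
  exact Submodule.mem_sup.mp ha

/-- The skew-symmetric operator corresponding to `Λ` through the form: half the difference of the
projections onto `𝔤₂` and `𝔤₁`. -/
def rOp : 𝔡 →ₗ[𝕜] 𝔡 := M.proj₂ - (2 : 𝕜)⁻¹ • LinearMap.id

/-- The operator is `-1/2` on `𝔤₁` and `1/2` on `𝔤₂`; all its properties are read off from this
splitting. -/
theorem rOp_add [NeZero (2 : 𝕜)] {a b : 𝔡} (ha : a ∈ M.g₁) (hb : b ∈ M.g₂) :
    M.rOp (a + b) = (2 : 𝕜)⁻¹ • (b - a) := by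
  -- The relation `2⁻¹ + 2⁻¹ = 1` depends on the characteristic, so it is supplied by hand before
  -- the additive bookkeeping.
  have h : b = (2 : 𝕜)⁻¹ • b + (2 : 𝕜)⁻¹ • b := by
    rw [← add_smul, ← two_mul, mul_inv_cancel₀ two_ne_zero, one_smul]
  simp only [rOp, LinearMap.sub_apply, M.proj₂_add ha hb, LinearMap.smul_apply, LinearMap.id_apply,
    smul_add, smul_sub]
  nth_rw 1 [h]
  abel

/-- By isotropy only the pairings of `𝔤₁` with `𝔤₂` survive, and there the operator has opposite
signs on the two arguments. -/
theorem rOp_skew [NeZero (2 : 𝕜)] (a b : 𝔡) : M.form a (M.rOp b) = - M.form (M.rOp a) b := by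
  obtain ⟨a₁, ha₁, a₂, ha₂, rfl⟩ := M.exists_add a
  obtain ⟨b₁, hb₁, b₂, hb₂, rfl⟩ := M.exists_add b
  rw [M.rOp_add ha₁ ha₂, M.rOp_add hb₁ hb₂]
  simp only [map_smul, map_add, map_sub, LinearMap.add_apply, LinearMap.smul_apply,
    LinearMap.sub_apply, M.isotropic₁ _ ha₁ _ hb₁, M.isotropic₂ _ ha₂ _ hb₂, smul_eq_mul]
  ring

/-- The modified classical Yang-Baxter equation. -/
theorem rOp_yangBaxter [NeZero (2 : 𝕜)] (a b : 𝔡) :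
    ⁅M.rOp a, M.rOp b⁆ - M.rOp (⁅M.rOp a, b⁆ + ⁅a, M.rOp b⁆) =
      - ((2 : 𝕜)⁻¹ * (2 : 𝕜)⁻¹) • ⁅a, b⁆ := by
  obtain ⟨a₁, ha₁, a₂, ha₂, rfl⟩ := M.exists_add a
  obtain ⟨b₁, hb₁, b₂, hb₂, rfl⟩ := M.exists_add b
  have h₁ := M.g₁.lie_mem ha₁ hb₁
  have h₂ := M.g₂.lie_mem ha₂ hb₂
  -- The mixed brackets `[a₁, b₂]` and `[a₂, b₁]`, whose components are unknown, cancel. What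
  -- remains is already split, since both summands are closed under the bracket.
  have e : ⁅M.rOp (a₁ + a₂), b₁ + b₂⁆ + ⁅a₁ + a₂, M.rOp (b₁ + b₂)⁆ =
      - ⁅a₁, b₁⁆ + ⁅a₂, b₂⁆ := by
    rw [M.rOp_add ha₁ ha₂, M.rOp_add hb₁ hb₂]
    have h : ∀ x : 𝔡, (2 : 𝕜)⁻¹ • x + (2 : 𝕜)⁻¹ • x = x := fun x => by
      rw [← add_smul, ← two_mul, mul_inv_cancel₀ two_ne_zero, one_smul]
    simp only [smul_lie, lie_smul, sub_lie, lie_sub, add_lie, lie_add]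
    rw [← h (- ⁅a₁, b₁⁆ + ⁅a₂, b₂⁆)]
    module
  rw [e, M.rOp_add (neg_mem h₁) h₂, M.rOp_add ha₁ ha₂, M.rOp_add hb₁ hb₂]
  have h : ∀ x : 𝔡, (2 : 𝕜)⁻¹ • x = ((2 : 𝕜)⁻¹ * (2 : 𝕜)⁻¹) • x + ((2 : 𝕜)⁻¹ * (2 : 𝕜)⁻¹) • x := by
    intro x
    rw [← add_smul, ← two_mul, ← mul_assoc, mul_inv_cancel₀ two_ne_zero, one_mul]
  simp only [smul_lie, lie_smul, sub_lie, lie_sub, add_lie, lie_add]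
  rw [h (⁅a₂, b₂⁆ - -⁅a₁, b₁⁆)]
  module

/-- Invariance and skewness move all three terms into a pairing with `c`, where they form the left
side of the Yang-Baxter equation. This is the shape in which the Jacobiator needs it. -/
theorem rOp_cyclic [NeZero (2 : 𝕜)] (a b c : 𝔡) :
    M.form c ⁅M.rOp a, M.rOp b⁆ + M.form a ⁅M.rOp b, M.rOp c⁆ + M.form b ⁅M.rOp c, M.rOp a⁆ =
      - ((2 : 𝕜)⁻¹ * (2 : 𝕜)⁻¹) * M.form c ⁅a, b⁆ := by
  have h1 : M.form a ⁅M.rOp b, M.rOp c⁆ = - M.form c (M.rOp ⁅a, M.rOp b⁆) := by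
    rw [← M.form_invariant, M.rOp_skew, M.form_symm]
  have h2 : M.form b ⁅M.rOp c, M.rOp a⁆ = - M.form c (M.rOp ⁅M.rOp a, b⁆) := by
    rw [M.form_symm, M.form_invariant, M.rOp_skew, neg_neg]
  rw [h1, h2, ← smul_eq_mul, ← map_smul, ← M.rOp_yangBaxter, map_sub, map_add, map_add]
  ring

theorem exists_form_eq [FiniteDimensional 𝕜 𝔡] (α : 𝔡 →ₗ[𝕜] 𝕜) : ∃ a, M.form a = α := by
  have h1 : Function.Injective M.form := by
    rw [injective_iff_map_eq_zero]
    exact fun a ha => M.form_nondegenerate a fun b => by rw [ha]; rfl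
  exact (LinearMap.injective_iff_surjective_of_finrank_eq_finrank
    (Subspace.dual_finrank_eq (K := 𝕜) (V := 𝔡)).symm).mp h1 α

end ManinTriple

/-- The value of a `2`-tensor on a pair of linear forms. -/
def tensorEval {𝕜 V : Type*} [Field 𝕜] [AddCommGroup V] [Module 𝕜 V] (t : V ⊗[𝕜] V)
    (α β : V →ₗ[𝕜] 𝕜) : 𝕜 :=
  LinearMap.mul' 𝕜 𝕜 (TensorProduct.map α β t)

/-! ### Two-tensors as bilinear forms on covectors. -/

section tensorEval

variable {𝕜 V W : Type*} [Field 𝕜] [AddCommGroup V] [Module 𝕜 V] [AddCommGroup W] [Module 𝕜 W]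

@[simp]
theorem tensorEval_tmul (v w : V) (α β : V →ₗ[𝕜] 𝕜) :
    tensorEval (v ⊗ₜ[𝕜] w) α β = α v * β w := by simp [tensorEval]

@[simp]
theorem tensorEval_add (s t : V ⊗[𝕜] V) (α β : V →ₗ[𝕜] 𝕜) :
    tensorEval (s + t) α β = tensorEval s α β + tensorEval t α β := by simp [tensorEval]

@[simp]
theorem tensorEval_sub (s t : V ⊗[𝕜] V) (α β : V →ₗ[𝕜] 𝕜) :
    tensorEval (s - t) α β = tensorEval s α β - tensorEval t α β := by simp [tensorEval]

@[simp]
theorem tensorEval_neg (t : V ⊗[𝕜] V) (α β : V →ₗ[𝕜] 𝕜) :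
    tensorEval (-t) α β = - tensorEval t α β := by simp [tensorEval]

@[simp]
theorem tensorEval_smul (c : 𝕜) (t : V ⊗[𝕜] V) (α β : V →ₗ[𝕜] 𝕜) :
    tensorEval (c • t) α β = c * tensorEval t α β := by simp [tensorEval]

@[simp]
theorem tensorEval_zero (α β : V →ₗ[𝕜] 𝕜) : tensorEval 0 α β = 0 := by simp [tensorEval]

theorem tensorEval_sum {ι : Type*} (s : Finset ι) (t : ι → V ⊗[𝕜] V) (α β : V →ₗ[𝕜] 𝕜) :
    tensorEval (∑ i ∈ s, t i) α β = ∑ i ∈ s, tensorEval (t i) α β := by simp [tensorEval]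

theorem tensorEval_map (f : V →ₗ[𝕜] W) (t : V ⊗[𝕜] V) (α β : W →ₗ[𝕜] 𝕜) :
    tensorEval (TensorProduct.map f f t) α β = tensorEval t (α ∘ₗ f) (β ∘ₗ f) := by
  simp only [tensorEval, TensorProduct.map_comp, LinearMap.comp_apply]

theorem tensorEval_comm (t : V ⊗[𝕜] V) (α β : V →ₗ[𝕜] 𝕜) :
    tensorEval (TensorProduct.comm 𝕜 V V t) α β = tensorEval t β α := by
  induction t with
  | zero => simp
  | add s t hs ht => simp [hs, ht]
  | tmul v w => simp [mul_comm]

theorem tensor_ext [FiniteDimensional 𝕜 V] {s t : V ⊗[𝕜] V}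
    (h : ∀ α β, tensorEval s α β = tensorEval t α β) : s = t := by
  let b := Module.finBasis 𝕜 V
  have key : ∀ (t : V ⊗[𝕜] V) i j,
      (b.tensorProduct b).repr t (i, j) = tensorEval t (b.coord i) (b.coord j) := by
    intro t i j
    induction t with
    | zero => simp
    | add s t hs ht => simp [hs, ht]
    | tmul v w => simp [mul_comm]
  refine (b.tensorProduct b).ext_elem fun ⟨i, j⟩ => ?_
  rw [key, key, h]

/-- Contraction of the first factor gives the map from covectors to vectors along which Hamiltonian
derivatives are taken. -/
theorem exists_tensorEval_eq [FiniteDimensional 𝕜 V] (t : V ⊗[𝕜] V) :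
    ∃ T : (V →ₗ[𝕜] 𝕜) →ₗ[𝕜] V, ∀ α β, tensorEval t α β = β (T α) := by
  induction t with
  | zero => exact ⟨0, fun α β => by simp⟩
  | add s t hs ht =>
    obtain ⟨S, hS⟩ := hs
    obtain ⟨T, hT⟩ := ht
    exact ⟨S + T, fun α β => by simp [hS, hT]⟩
  | tmul v w => exact ⟨(LinearMap.applyₗ v).smulRight w, fun α β => by simp⟩

end tensorEval

/-! ### The element `Λ` and isomorphisms of Manin triples. -/

namespace ManinTriple

variable {𝕜 𝔡 : Type*} [Field 𝕜] [LieRing 𝔡] [LieAlgebra 𝕜 𝔡] (M : ManinTriple 𝕜 𝔡)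
  {𝔡' : Type*} [LieRing 𝔡'] [LieAlgebra 𝕜 𝔡']

/-- The coefficient of the `𝔤₂`-part of `b` at `ξ i` is `⟨b, x i⟩`, since the `𝔤₁`-part of `b` is
orthogonal to `x i`. The result no longer mentions the basis. -/
theorem tensorEval_rMatrix [FiniteDimensional 𝕜 𝔡] (a b : 𝔡) :
    tensorEval M.rMatrix (M.form a) (M.form b) = M.form a (M.proj₂ b) := by
  obtain ⟨b₁, hb₁, b₂, hb₂, rfl⟩ := M.exists_add b
  rw [M.proj₂_add hb₁ hb₂, rMatrix, tensorEval_sum]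
  let ξ := Module.finBasis 𝕜 M.g₂.toSubmodule
  let x : Fin (Module.finrank 𝕜 M.g₂.toSubmodule) → M.g₁.toSubmodule :=
    fun i => M.pairing.symm (ξ.coord i)
  have hx : ∀ i, M.form (b₁ + b₂) (x i) = ξ.coord i ⟨b₂, hb₂⟩ := by
    intro i
    rw [map_add, LinearMap.add_apply, M.isotropic₁ _ hb₁ _ (x i).2, zero_add, M.form_symm]
    exact LinearMap.congr_fun (M.pairing.apply_symm_apply (ξ.coord i)) ⟨b₂, hb₂⟩
  have hb : (b₂ : 𝔡) = ∑ i, ξ.coord i ⟨b₂, hb₂⟩ • (ξ i : 𝔡) := by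
    have := congrArg M.g₂.toSubmodule.subtype (ξ.sum_repr ⟨b₂, hb₂⟩)
    rw [map_sum] at this
    exact this.symm
  conv_rhs => rw [hb, map_sum]
  refine Finset.sum_congr rfl fun i _ => ?_
  rw [tensorEval_tmul, map_smul, smul_eq_mul, ← hx i, mul_comm]

/-- The matrix gives `⟨a₁, b₂⟩`, its flip gives `⟨a₂, b₁⟩`, and half the difference is the pairing
of `a` with `(b₂ - b₁)/2`. -/
theorem tensorEval_Lam [FiniteDimensional 𝕜 𝔡] [NeZero (2 : 𝕜)] (a b : 𝔡) :
    tensorEval M.Lam (M.form a) (M.form b) = M.form a (M.rOp b) := by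
  rw [Lam, tensorEval_smul, tensorEval_sub, tensorEval_comm, tensorEval_rMatrix,
    tensorEval_rMatrix]
  obtain ⟨a₁, ha₁, a₂, ha₂, rfl⟩ := M.exists_add a
  obtain ⟨b₁, hb₁, b₂, hb₂, rfl⟩ := M.exists_add b
  rw [M.proj₂_add ha₁ ha₂, M.proj₂_add hb₁ hb₂, M.rOp_add hb₁ hb₂, M.form_symm (b₁ + b₂)]
  simp only [map_smul, map_add, map_sub, LinearMap.add_apply, M.isotropic₁ _ ha₁ _ hb₁,
    M.isotropic₂ _ ha₂ _ hb₂, smul_eq_mul]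
  ring

theorem comm_Lam [FiniteDimensional 𝕜 𝔡] : TensorProduct.comm 𝕜 𝔡 𝔡 M.Lam = - M.Lam := by
  have h : ∀ t : 𝔡 ⊗[𝕜] 𝔡, TensorProduct.comm 𝕜 𝔡 𝔡 (TensorProduct.comm 𝕜 𝔡 𝔡 t) = t :=
    fun t => by induction t <;> simp_all
  rw [Lam, map_smul, map_sub, h, ← smul_neg, neg_sub]

/-- By `tensorEval_Lam`, `Λ` depends only on the form and the splitting, and the isomorphism
respects both. The linear map `g` is a separate argument so that it may be any presentation of `f`.
-/
theorem IsIso.map_Lam {M : ManinTriple 𝕜 𝔡} [FiniteDimensional 𝕜 𝔡] [FiniteDimensional 𝕜 𝔡']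
    [NeZero (2 : 𝕜)]
    {M' : ManinTriple 𝕜 𝔡'} {f : 𝔡 ≃ₗ⁅𝕜⁆ 𝔡'} (hf : M.IsIso M' f) {g : 𝔡 →ₗ[𝕜] 𝔡'}
    (hg : ∀ v, g v = f v) :
    TensorProduct.map g g M.Lam = M'.Lam := by
  refine tensor_ext fun α β => ?_
  obtain ⟨a, rfl⟩ := M'.exists_form_eq α
  obtain ⟨b, rfl⟩ := M'.exists_form_eq β
  obtain ⟨a, rfl⟩ : ∃ a', f a' = a := ⟨f.symm a, f.apply_symm_apply a⟩
  obtain ⟨b, rfl⟩ : ∃ b', f b' = b := ⟨f.symm b, f.apply_symm_apply b⟩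
  have h : ∀ a, (M'.form (f a)) ∘ₗ g = M.form a := fun a =>
    LinearMap.ext fun x => by simp [hg, hf.form_eq]
  rw [tensorEval_map, h, h, tensorEval_Lam, tensorEval_Lam, ← hf.form_eq]
  congr 1
  obtain ⟨b₁, hb₁, b₂, hb₂, rfl⟩ := M.exists_add b
  rw [M.rOp_add hb₁ hb₂, map_add,
    M'.rOp_add ((hf.map_g₁ _).2 hb₁) ((hf.map_g₂ _).2 hb₂), map_smul, map_sub]

/-- The transport of a Manin triple along an isomorphism of Lie algebras. -/
def map (f : 𝔡 ≃ₗ⁅𝕜⁆ 𝔡') : ManinTriple 𝕜 𝔡' where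
  form := M.form.compl₁₂ f.symm.toLinearEquiv.toLinearMap f.symm.toLinearEquiv.toLinearMap
  form_symm a b := M.form_symm _ _
  form_nondegenerate a h := by
    have : f.symm a = 0 := M.form_nondegenerate _ fun b => by simpa using h (f b)
    simpa using this
  form_invariant a b c := by
    have h : ∀ a b, f.symm ⁅a, b⁆ = ⁅f.symm a, f.symm b⁆ := fun a b => f.symm.toLieHom.map_lie a b
    simpa [h] using M.form_invariant (f.symm a) (f.symm b) (f.symm c)
  g₁ := M.g₁.comap f.symm.toLieHom
  g₂ := M.g₂.comap f.symm.toLieHom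
  isotropic₁ a ha b hb := M.isotropic₁ _ ha _ hb
  isotropic₂ a ha b hb := M.isotropic₂ _ ha _ hb
  isCompl := by
    constructor
    · rw [Submodule.disjoint_def]
      intro x h1 h2
      have := Submodule.disjoint_def.mp M.isCompl.disjoint (f.symm x) h1 h2
      simpa using this
    · rw [codisjoint_iff, eq_top_iff]
      intro a _
      obtain ⟨u, hu, v, hv, h⟩ := M.exists_add (f.symm a)
      have ha : a = f u + f v := by rw [← map_add, h]; simp
      rw [ha]
      refine Submodule.add_mem_sup (?_ : f.symm (f u) ∈ M.g₁) (?_ : f.symm (f v) ∈ M.g₂)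
      · simpa using hu
      · simpa using hv

theorem map_form (f : 𝔡 ≃ₗ⁅𝕜⁆ 𝔡') (a b : 𝔡') :
    (M.map f).form a b = M.form (f.symm a) (f.symm b) := rfl

theorem isIso_map (f : 𝔡 ≃ₗ⁅𝕜⁆ 𝔡') : M.IsIso (M.map f) f where
  form_eq a b := by simp [map_form]
  map_g₁ a := by change f.symm (f a) ∈ M.g₁ ↔ _; simp
  map_g₂ a := by change f.symm (f a) ∈ M.g₂ ↔ _; simp

/-- Inclusions suffice because both splittings are direct: a component landing in the wrong
subalgebra lies in both, hence is zero. -/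
theorem IsIso.of_forall_mem {M : ManinTriple 𝕜 𝔡} {M' : ManinTriple 𝕜 𝔡'} {f : 𝔡 ≃ₗ⁅𝕜⁆ 𝔡'}
    (hf : ∀ a b, M'.form (f a) (f b) = M.form a b) (h₁ : ∀ a ∈ M.g₁, f a ∈ M'.g₁)
    (h₂ : ∀ a ∈ M.g₂, f a ∈ M'.g₂) : M.IsIso M' f where
  form_eq := hf
  map_g₁ a := by
    refine ⟨fun h => ?_, h₁ a⟩
    obtain ⟨u, hu, v, hv, rfl⟩ := M.exists_add a
    rw [map_add] at h
    have hv' : f v ∈ M'.g₁ := by simpa using sub_mem h (h₁ u hu)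
    have := Submodule.disjoint_def.mp M'.isCompl.disjoint _ hv' (h₂ v hv)
    rw [(map_eq_zero_iff f f.injective).mp this]
    simpa using hu
  map_g₂ a := by
    refine ⟨fun h => ?_, h₂ a⟩
    obtain ⟨u, hu, v, hv, rfl⟩ := M.exists_add a
    rw [map_add] at h
    have hu' : f u ∈ M'.g₂ := by simpa using sub_mem h (h₂ v hv)
    have := Submodule.disjoint_def.mp M'.isCompl.disjoint _ (h₁ u hu) hu'
    rw [(map_eq_zero_iff f f.injective).mp this]
    simpa using hv

end ManinTriple

end AlgebraLemmas

/-! ### Combinatorics of the snake. -/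

section SnakeLemmas

variable {m n : ℕ}

/-- This parity controls both the signs of the forms and which pairs of consecutive positions carry
a diagonal. -/
theorem even_snake (i : Fin n) (j : Fin m) :
    Even (snake m n (i, j) : ℕ) ↔ Even ((i : ℕ) + j) := by
  have hi := i.2
  rw [snake_val]
  split_ifs with h
  · simp [Nat.even_add, h]
  -- In an odd column the number and `1 + i` add up to `(j + 1) * n`, which is even because `j + 1`
  -- is.
  · have e : (j : ℕ) * n + (n - 1 - i) + (1 + i) = (j + 1) * n := by
      rw [Nat.succ_mul]; omega
    have h1 : Even ((j : ℕ) * n + (n - 1 - i) + (1 + i)) := by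
      rw [e]; exact (Nat.even_add_one.2 h).mul_right n
    simp only [Nat.even_add, Nat.not_even_one, false_iff] at h1 ⊢
    tauto

theorem odd_snake (i : Fin n) (j : Fin m) : Odd (snake m n (i, j) : ℕ) ↔ Odd ((i : ℕ) + j) := by
  rw [← Nat.not_even_iff_odd, ← Nat.not_even_iff_odd, even_snake]

/-- This lemma and the next five list the steps of the snake: down an even column, up an odd one,
the turn at the bottom after an even column, the turn at the top after an odd column, and the two
possible ends. -/
theorem snake_succ_of_even {i i' : Fin n} (h : (i' : ℕ) = i + 1) {j : Fin m} (hj : Even (j : ℕ)) :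
    (snake m n (i', j) : ℕ) = snake m n (i, j) + 1 := by
  simp only [snake_val, hj, if_true]; omega

theorem snake_succ_of_odd {i i' : Fin n} (h : (i' : ℕ) = i + 1) {j : Fin m} (hj : Odd (j : ℕ)) :
    (snake m n (i, j) : ℕ) = snake m n (i', j) + 1 := by
  have := i'.2
  simp only [snake_val, Nat.not_even_iff_odd.2 hj, if_false]; omega

theorem snake_last_succ {i : Fin n} (hi : (i : ℕ) + 1 = n) {j j' : Fin m} (h : (j' : ℕ) = j + 1)
    (hj : Even (j : ℕ)) : (snake m n (i, j') : ℕ) = snake m n (i, j) + 1 := by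
  have hj' : ¬ Even (j' : ℕ) := by rw [h]; simpa [Nat.even_add_one] using hj
  rw [snake_val m n i j, snake_val m n i j', if_pos hj, if_neg hj', h, Nat.succ_mul]; omega

theorem snake_first_succ {i : Fin n} (hi : (i : ℕ) = 0) {j j' : Fin m} (h : (j' : ℕ) = j + 1)
    (hj : Odd (j : ℕ)) : (snake m n (i, j') : ℕ) = snake m n (i, j) + 1 := by
  have hj' : Even (j' : ℕ) := by rw [h]; exact hj.add_one
  have := i.2
  rw [snake_val m n i j, snake_val m n i j', if_neg (Nat.not_even_iff_odd.2 hj), if_pos hj', h,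
    Nat.succ_mul]
  omega

theorem snake_end_of_even {i : Fin n} (hi : (i : ℕ) + 1 = n) {j : Fin m} (h : (j : ℕ) + 1 = m)
    (hj : Even (j : ℕ)) : (snake m n (i, j) : ℕ) + 1 = m * n := by
  have e : m * n = j * n + n := by rw [← Nat.succ_mul, Nat.succ_eq_add_one, h]
  simp only [snake_val, hj, if_true]; omega

theorem snake_end_of_odd {i : Fin n} (hi : (i : ℕ) = 0) {j : Fin m} (h : (j : ℕ) + 1 = m)
    (hj : Odd (j : ℕ)) : (snake m n (i, j) : ℕ) + 1 = m * n := by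
  have e : m * n = j * n + n := by rw [← Nat.succ_mul, Nat.succ_eq_add_one, h]
  have := i.2
  simp only [snake_val, Nat.not_even_iff_odd.2 hj, if_false]; omega

/-- Each condition defining a Lagrangian of the iterated polyuble concerns the snake's start, one of
its steps, or its end. The parity of `i + j` at the earlier entry decides which of the two
Lagrangians imposes it. -/
theorem snakeLie_isIso {𝕜 𝔡 : Type*} [Field 𝕜] [LieRing 𝔡] [LieAlgebra 𝕜 𝔡]
    (M : ManinTriple 𝕜 𝔡) (m n : ℕ) :
    (M.polyuble (m * n)).IsIso ((M.polyuble m).polyuble n) (snakeLie 𝕜 𝔡 m n) := by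
  refine ManinTriple.IsIso.of_forall_mem ?_ ?_ ?_
  · intro a b
    change ∑ i : Fin n, (-1) ^ (i : ℕ) * (∑ j : Fin m, (-1) ^ (j : ℕ) *
      M.form (a (snake m n (i, j))) (b (snake m n (i, j)))) =
      ∑ k : Fin (m * n), (-1) ^ (k : ℕ) * M.form (a k) (b k)
    rw [← (snake m n).sum_comp, Fintype.sum_prod_type]
    refine Finset.sum_congr rfl fun i _ => ?_
    rw [Finset.mul_sum]
    refine Finset.sum_congr rfl fun j _ => ?_
    rw [← mul_assoc, ← pow_add, neg_one_pow_congr (even_snake i j)]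
  · rintro a ⟨h, h'⟩
    refine ⟨fun i i' hi hii => funext fun j => ?_, fun i hi hin => ⟨fun j j' hj hjj => ?_,
      fun j hj hjm => ?_⟩⟩
    -- Rows `i` and `i + 1` with `i` even: an even column is passed downwards from row `i`, an odd
    -- one upwards from row `i + 1`; either way the earlier number is even.
    · rcases Nat.even_or_odd (j : ℕ) with hj | hj
      · exact h _ _ ((even_snake i j).2 (hi.add hj)) (snake_succ_of_even hii hj)
      · refine (h _ _ ((even_snake i' j).2 ?_) (snake_succ_of_odd hii hj)).symm
        rw [hii]; exact hi.add_one.add_odd hj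
    · exact h _ _ ((even_snake i j).2 (hi.add hj)) (snake_last_succ hin hjj hj)
    · exact h' _ ((even_snake i j).2 (hi.add hj)) (snake_end_of_even hin hjm hj)
  · rintro a ⟨h0, h, h'⟩
    refine ⟨fun i hi => ⟨fun j hj => ?_, fun j j' hj hjj => ?_, fun j hj hjm => ?_⟩,
      fun i i' hi hii => funext fun j => ?_, fun i hi hin => ⟨fun j j' hj hjj => ?_,
      fun j hj hjm => ?_⟩⟩
    -- The first three cases treat row `0`, which lies in the second Lagrangian of the `m`-uble: the
    -- start, the turns at the top, and an end at the top. The last three treat row pairs from odd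
    -- `i`, and the bottom row when `n` is even.
    · exact h0 _ (by simp [snake_val, hi, hj])
    · exact h _ _ ((odd_snake i j).2 (by simpa [hi] using hj)) (snake_first_succ hi hjj hj)
    · exact h' _ ((odd_snake i j).2 (by simpa [hi] using hj)) (snake_end_of_odd hi hjm hj)
    · rcases Nat.even_or_odd (j : ℕ) with hj | hj
      · exact h _ _ ((odd_snake i j).2 (hi.add_even hj)) (snake_succ_of_even hii hj)
      · refine (h _ _ ((odd_snake i' j).2 ?_) (snake_succ_of_odd hii hj)).symm
        rw [hii]; exact hi.add_one.add_odd hj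
    · exact h _ _ ((odd_snake i j).2 (hi.add_even hj)) (snake_last_succ hin hjj hj)
    · exact h' _ ((odd_snake i j).2 (hi.add_even hj)) (snake_end_of_even hin hjm hj)

end SnakeLemmas

/-! ### Finite powers of manifolds and Lie groups. -/

section PiManifold

open Set

variable {𝕜 : Type*} [NontriviallyNormedField 𝕜] {ι : Type*} [Fintype ι]
  {E : Type*} [NormedAddCommGroup E] [NormedSpace 𝕜 E] {H : Type*} [TopologicalSpace H]
  {I : ModelWithCorners 𝕜 E H} {M : Type*} [TopologicalSpace M] [ChartedSpace H M]
  {E' : Type*} [NormedAddCommGroup E'] [NormedSpace 𝕜 E'] {H' : Type*} [TopologicalSpace H']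
  {J : ModelWithCorners 𝕜 E' H'} {N : Type*} [TopologicalSpace N] [ChartedSpace H' N]
  {k : ℕ∞ω}

instance pi_boundaryless [I.Boundaryless] :
    (ModelWithCorners.pi fun _ : ι => I).Boundaryless where
  range_eq_univ := by
    change range (Pi.map fun _ : ι => (I : H → E)) = univ
    rw [Set.range_piMap]
    simp [I.range_eq_univ]

instance pi_isManifold [IsManifold I k M] :
    IsManifold (ModelWithCorners.pi fun _ : ι => I) k (ι → M) := by
  apply isManifold_of_contDiffOn
  rintro _ _ ⟨e, he, rfl⟩ ⟨e', he', rfl⟩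
  rw [contDiffOn_pi]
  intro i
  have h : ContDiffOn 𝕜 k (I ∘ (e i).symm ≫ₕ e' i ∘ I.symm)
      (I.symm ⁻¹' ((e i).symm ≫ₕ e' i).source ∩ range I) :=
    ((contDiffGroupoid k I).compatible (he i trivial) (he' i trivial)).1
  refine h.comp (contDiff_apply 𝕜 E i).contDiffOn ?_
  rintro x ⟨hx, y, rfl⟩
  exact ⟨⟨hx.1 i trivial, hx.2 i trivial⟩, y i, rfl⟩

/-- Charts of the power are products of charts, so the coordinate expression splits into those of
the components. -/
theorem contMDiffAt_pi {f : N → ι → M} {x : N} :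
    ContMDiffAt J (ModelWithCorners.pi fun _ : ι => I) k f x ↔
      ∀ i, ContMDiffAt J I k (fun y => f y i) x := by
  simp only [contMDiffAt_iff]
  rw [continuousAt_pi, contDiffWithinAt_pi, forall_and]
  rfl

theorem contMDiff_pi {f : N → ι → M} :
    ContMDiff J (ModelWithCorners.pi fun _ : ι => I) k f ↔
      ∀ i, ContMDiff J I k (fun y => f y i) :=
  ⟨fun h i x => contMDiffAt_pi.1 (h x) i, fun h x => contMDiffAt_pi.2 fun i => h i x⟩

theorem contMDiff_apply (i : ι) :
    ContMDiff (ModelWithCorners.pi fun _ : ι => I) I k (fun x : ι → M => x i) :=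
  contMDiff_pi.1 contMDiff_id i

instance pi_lieGroup {G : Type*} [Group G] [TopologicalSpace G] [ChartedSpace H G]
    [LieGroup I k G] : LieGroup (ModelWithCorners.pi fun _ : ι => I) k (ι → G) where
  contMDiff_mul := contMDiff_pi.2 fun i => ContMDiff.mul
    ((contMDiff_apply i).comp contMDiff_fst) ((contMDiff_apply i).comp contMDiff_snd)
  contMDiff_inv := contMDiff_pi.2 fun i => (contMDiff_apply i).inv

theorem mfderiv_pi {f : N → ι → M} {x : N} (hf : ContMDiffAt J (.pi fun _ : ι => I) 1 f x)
    (v : E') (i : ι) :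
    (mfderiv J (.pi fun _ : ι => I) f x v : ι → E) i = (mfderiv J I (fun y => f y i) x v : E) := by
  have h1 := hf.mdifferentiableAt one_ne_zero
  have h2 : HasMFDerivAt J I (fun y => f y i) x
      ((ContinuousLinearMap.proj i : (ι → E) →L[𝕜] E).comp
        (mfderiv J (.pi fun _ : ι => I) f x : E' →L[𝕜] (ι → E))) :=
    ⟨(contMDiffAt_pi.1 hf i).continuousAt, hasFDerivWithinAt_pi'.1 h1.hasMFDerivAt.2 i⟩
  exact (DFunLike.congr_fun h2.mfderiv v).symm

theorem mfderiv_apply (i : ι) (x : ι → M) (v : ι → E) [IsManifold I 1 M] :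
    (mfderiv (.pi fun _ : ι => I) I (fun y : ι → M => y i) x v : E) = v i := by
  rw [← mfderiv_pi (f := fun y : ι → M => y) contMDiffAt_id]
  change (mfderiv (.pi fun _ : ι => I) (.pi fun _ : ι => I) id x v : ι → E) i = v i
  rw [mfderiv_id]
  rfl

end PiManifold

/-! ### Symmetry of mixed partial derivatives. -/

section MixedDerivatives

open Filter Topology

variable {𝕜 : Type*} [RCLike 𝕜] {E : Type*} [NormedAddCommGroup E] [NormedSpace 𝕜 E]
  {E' : Type*} [NormedAddCommGroup E'] [NormedSpace 𝕜 E']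
  {W : Type*} [NormedAddCommGroup W] [NormedSpace 𝕜 W]

/-- The second derivative of `Φ` is symmetric on `(v, 0)` and `(0, w)`. Applied to products of group
elements, this makes left and right derivatives commute. -/
theorem fderiv_fderiv_swap {Φ : E × E' → W} {x : E} {y : E'} (h : ContDiffAt 𝕜 2 Φ (x, y))
    (v : E) (w : E') :
    fderiv 𝕜 (fun x' => fderiv 𝕜 (fun y' => Φ (x', y')) y w) x v =
      fderiv 𝕜 (fun y' => fderiv 𝕜 (fun x' => Φ (x', y')) x v) y w := by
  have hl : ∀ x y, HasFDerivAt (fun x' => (x', y)) (ContinuousLinearMap.inl 𝕜 E E') x :=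
    hasFDerivAt_prodMk_left
  have hr : ∀ x y, HasFDerivAt (fun y' => (x, y')) (ContinuousLinearMap.inr 𝕜 E E') y :=
    hasFDerivAt_prodMk_right
  have hd : ∀ᶠ p in 𝓝 (x, y), DifferentiableAt 𝕜 Φ p :=
    (h.eventually (by simp)).mono fun p hp => hp.differentiableAt two_ne_zero
  -- Partial derivatives are restrictions of the total derivative only near the point, where `Φ` is
  -- differentiable; a germ is enough for differentiating once more.
  have h1 : (fun x' => fderiv 𝕜 (fun y' => Φ (x', y')) y w) =ᶠ[𝓝 x]
      fun x' => fderiv 𝕜 Φ (x', y) (0, w) := by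
    have : Tendsto (fun x' => (x', y)) (𝓝 x) (𝓝 (x, y)) :=
      (Continuous.prodMk_left y).tendsto x
    filter_upwards [this.eventually hd] with x' hx'
    have := hx'.hasFDerivAt.comp y (hr x' y)
    exact congrArg (fun A : E' →L[𝕜] W => A w) this.fderiv |>.trans (by simp)
  have h2 : (fun y' => fderiv 𝕜 (fun x' => Φ (x', y')) x v) =ᶠ[𝓝 y]
      fun y' => fderiv 𝕜 Φ (x, y') (v, 0) := by
    have : Tendsto (fun y' => (x, y')) (𝓝 y) (𝓝 (x, y)) :=
      (Continuous.prodMk_right x).tendsto y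
    filter_upwards [this.eventually hd] with y' hy'
    have := hy'.hasFDerivAt.comp x (hl x y')
    exact congrArg (fun A : E →L[𝕜] W => A v) this.fderiv |>.trans (by simp)
  rw [h1.fderiv_eq, h2.fderiv_eq]
  have h3 : DifferentiableAt 𝕜 (fderiv 𝕜 Φ) (x, y) :=
    (h.fderiv_right (m := 1) (by norm_num)).differentiableAt one_ne_zero
  have h4 := (h3.hasFDerivAt.comp x (hl x y)).clm_apply
    (hasFDerivAt_const ((0, w) : E × E') x)
  have h5 := (h3.hasFDerivAt.comp y (hr x y)).clm_apply
    (hasFDerivAt_const ((v, 0) : E × E') y)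
  have e4 := congrArg (fun A : E →L[𝕜] W => A v) h4.fderiv
  have e5 := congrArg (fun A : E' →L[𝕜] W => A w) h5.fderiv
  simp only [Function.comp_def] at e4 e5
  rw [e4, e5]
  simpa using (h.isSymmSndFDerivAt (by simp)) (v, 0) (0, w)

end MixedDerivatives

/-! ### Left- and right-invariant derivatives in the chart at the identity. -/

section LieGroupCalculus

open Filter Topology Set

variable {𝕜 : Type*} [RCLike 𝕜] {E : Type*} [NormedAddCommGroup E] [NormedSpace 𝕜 E]
  {H : Type*} [TopologicalSpace H] (I : ModelWithCorners 𝕜 E H)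
  {G : Type*} [Group G] [TopologicalSpace G] [ChartedSpace H G]
  {W : Type*} [NormedAddCommGroup W] [NormedSpace 𝕜 W]
  {E' : Type*} [NormedAddCommGroup E'] [NormedSpace 𝕜 E'] {H' : Type*} [TopologicalSpace H']
  {J : ModelWithCorners 𝕜 E' H'} {N : Type*} [TopologicalSpace N] [ChartedSpace H' N]

variable (G) in
/-- The inverse of the preferred chart at the identity. -/
def idChart : E → G := (extChartAt I (1 : G)).symm

variable (G) in
/-- The coordinates of the identity. -/
def idPt : E := extChartAt I (1 : G) 1

/-- The left-invariant derivative of a function, in coordinates at the identity. -/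
def lgrad (f : G → W) (a : G) : E →L[𝕜] W := fderiv 𝕜 (fun x => f (a * idChart I G x)) (idPt I G)

/-- The right-invariant derivative of a function, in coordinates at the identity. -/
def rgrad (f : G → W) (a : G) : E →L[𝕜] W := fderiv 𝕜 (fun x => f (idChart I G x * a)) (idPt I G)

@[simp]
theorem idChart_idPt : idChart I G (idPt I G) = 1 := extChartAt_to_inv (I := I) (1 : G)

/-- The source of the smoothness of `lgrad`, `rgrad` and `coordAd` in the group element: each is the
derivative at one fixed point of a map depending smoothly on a parameter. -/
theorem contMDiffAt_fderiv_param [IsManifold J 1 N] {F : N → E → W} {y : N} {x : E}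
    (h : ContMDiffAt (J.prod 𝓘(𝕜, E)) 𝓘(𝕜, W) ∞ (Function.uncurry F) (y, x)) :
    ContMDiffAt J 𝓘(𝕜, E →L[𝕜] W) ∞ (fun y => fderiv 𝕜 (F y) x) y := by
  have := ContMDiffAt.mfderiv (m := ∞) F (fun _ => x) h contMDiffAt_const le_rfl
  have e := inTangentCoordinates_model_space (I := 𝓘(𝕜, E)) (I' := 𝓘(𝕜, W)) (fun _ : N => x)
    (fun y => F y x) (fun y => mfderiv 𝓘(𝕜, E) 𝓘(𝕜, W) (F y) x) y
  have h' := (congrArg (fun k => ContMDiffAt J 𝓘(𝕜, E →L[𝕜] W) ∞ k y) e).mp this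
  simpa only [mfderiv_eq_fderiv] using h'

variable [I.Boundaryless]

theorem idChart_target_mem_nhds : (extChartAt I (1 : G)).target ∈ 𝓝 (idPt I G) :=
  extChartAt_target_mem_nhds 1

variable [LieGroup I ∞ G]

theorem contMDiffAt_idChart {x : E} (hx : x ∈ (extChartAt I (1 : G)).target) :
    ContMDiffAt 𝓘(𝕜, E) I ∞ (idChart I G) x :=
  (contMDiffOn_extChartAt_symm (1 : G)).contMDiffAt ((isOpen_extChartAt_target (1 : G)).mem_nhds hx)

theorem contMDiffAt_idChart_idPt : ContMDiffAt 𝓘(𝕜, E) I ∞ (idChart I G) (idPt I G) :=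
  contMDiffAt_idChart I (mem_extChartAt_target 1)

variable {I} in
theorem ContMDiffAt.lgrad {f : G → W} {a : G} (hf : ContMDiffAt I 𝓘(𝕜, W) ∞ f a) :
    ContMDiffAt I 𝓘(𝕜, E →L[𝕜] W) ∞ (lgrad I f) a := by
  have : IsManifold I 1 G := IsManifold.of_le (n := ∞) (by simp)
  refine contMDiffAt_fderiv_param ?_
  have h : ContMDiffAt (I.prod 𝓘(𝕜, E)) I ∞ (fun p : G × E => p.1 * idChart I G p.2)
      (a, idPt I G) :=
    contMDiffAt_fst.mul ((contMDiffAt_idChart_idPt I).comp (a, idPt I G) contMDiffAt_snd)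
  exact ContMDiffAt.comp_of_eq (g := f) (f := fun p : G × E => p.1 * idChart I G p.2)
    hf h (by simp)

variable {I} in
theorem ContMDiffAt.rgrad {f : G → W} {a : G} (hf : ContMDiffAt I 𝓘(𝕜, W) ∞ f a) :
    ContMDiffAt I 𝓘(𝕜, E →L[𝕜] W) ∞ (rgrad I f) a := by
  have : IsManifold I 1 G := IsManifold.of_le (n := ∞) (by simp)
  refine contMDiffAt_fderiv_param ?_
  have h : ContMDiffAt (I.prod 𝓘(𝕜, E)) I ∞ (fun p : G × E => idChart I G p.2 * p.1)
      (a, idPt I G) :=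
    ((contMDiffAt_idChart_idPt I).comp (a, idPt I G) contMDiffAt_snd).mul contMDiffAt_fst
  exact ContMDiffAt.comp_of_eq (g := f) (f := fun p : G × E => idChart I G p.2 * p.1)
    hf h (by simp)

/-- With suitable fixed factors this product covers every second-order invariant derivative to be
compared. -/
theorem contMDiffAt_two_sided (a b c : G) :
    ContMDiffAt 𝓘(𝕜, E × E) I ∞
      (fun p : E × E => a * idChart I G p.1 * b * idChart I G p.2 * c) (idPt I G, idPt I G) := by
  have h1 : ContMDiffAt 𝓘(𝕜, E × E) I ∞ (fun p : E × E => idChart I G p.1)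
      (idPt I G, idPt I G) :=
    ContMDiffAt.comp (I' := 𝓘(𝕜, E)) (g := idChart I G) (idPt I G, idPt I G)
      (contMDiffAt_idChart_idPt I) contDiff_fst.contMDiff.contMDiffAt
  have h2 : ContMDiffAt 𝓘(𝕜, E × E) I ∞ (fun p : E × E => idChart I G p.2)
      (idPt I G, idPt I G) :=
    ContMDiffAt.comp (I' := 𝓘(𝕜, E)) (g := idChart I G) (idPt I G, idPt I G)
      (contMDiffAt_idChart_idPt I) contDiff_snd.contMDiff.contMDiffAt
  exact (((contMDiffAt_const.mul h1).mul contMDiffAt_const).mul h2).mul contMDiffAt_const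

variable {I} in
theorem contDiffAt_two_sided {f : G → W} {a b c d : G} (hf : ContMDiffAt I 𝓘(𝕜, W) ∞ f d)
    (hd : a * b * c = d) :
    ContDiffAt 𝕜 2 (fun p : E × E => f (a * idChart I G p.1 * b * idChart I G p.2 * c))
      (idPt I G, idPt I G) := by
  refine ContDiffAt.of_le (n := ∞) (contMDiffAt_iff_contDiffAt.1 ?_)
    (WithTop.coe_le_coe.2 (le_top : (2 : ℕ∞) ≤ ⊤))
  exact ContMDiffAt.comp_of_eq (g := f) hf (contMDiffAt_two_sided I a b c) (by simp [hd])

variable {I} in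
-- Both sides are mixed partials of `f (ψ x * a * ψ y)`, where `ψ` is the inverse chart.
theorem rgrad_lgrad_comm {f : G → W} {a : G} (hf : ContMDiffAt I 𝓘(𝕜, W) ∞ f a) (v w : E) :
    rgrad I (fun b => lgrad I f b w) a v = lgrad I (fun b => rgrad I f b v) a w := by
  have h := fderiv_fderiv_swap (contDiffAt_two_sided (a := 1) (b := a) (c := 1) hf (by simp)) v w
  simpa only [one_mul, mul_one, mul_assoc, lgrad, rgrad] using h

variable {I} in
-- Both sides are mixed partials of `f (ψ x * ψ y)`, with `w` in the left factor and `v` in the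
-- right one. The reversed order produces the sign in the commutator of right-invariant derivatives.
theorem rgrad_rgrad_one {f : G → W} (hf : ContMDiffAt I 𝓘(𝕜, W) ∞ f 1) (v w : E) :
    rgrad I (fun b => rgrad I f b w) 1 v = lgrad I (fun b => lgrad I f b v) 1 w := by
  have h := fderiv_fderiv_swap (contDiffAt_two_sided (a := 1) (b := 1) (c := 1) hf (by simp)) w v
  simpa only [one_mul, mul_one, lgrad, rgrad] using h.symm

/-- The tangent space at `1` is trivialised by this very chart; so vectors of the Lie algebra may be
used as coordinate vectors without conversion. -/
theorem mfderiv_idChart : HasMFDerivAt 𝓘(𝕜, E) I (idChart I G) (idPt I G)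
    (ContinuousLinearMap.id 𝕜 E) := by
  have : IsManifold I 1 G := IsManifold.of_le (n := ∞) (by simp)
  have h := mfderivWithin_range_extChartAt_symm (I := I) (x := (1 : G))
  rw [I.range_eq_univ, mfderivWithin_univ] at h
  have h2 := ((contMDiffAt_idChart_idPt (G := G) I).mdifferentiableAt (by simp)).hasMFDerivAt
  have e : mfderiv 𝓘(𝕜, E) I (idChart I G) (idPt I G) = ContinuousLinearMap.id 𝕜 E := h
  rwa [e] at h2

end LieGroupCalculus

/-! ### The Lie bracket as a commutator of invariant derivatives. -/

section LieGroupBracket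

open Filter Topology Set VectorField

variable {𝕜 : Type*} [RCLike 𝕜] {E : Type*} [NormedAddCommGroup E] [NormedSpace 𝕜 E]
  {H : Type*} [TopologicalSpace H] {I : ModelWithCorners 𝕜 E H}
  {G : Type*} [Group G] [TopologicalSpace G] [ChartedSpace H G]
  {W : Type*} [NormedAddCommGroup W] [NormedSpace 𝕜 W]
  [I.Boundaryless] [LieGroup I ∞ G]

theorem eventually_idChart_extChartAt {X : Type*} [TopologicalSpace X] {f : X → G} {x : X}
    (hf : ContinuousAt f x) (hx : f x ∈ (extChartAt I (1 : G)).source) :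
    ∀ᶠ y in 𝓝 x, idChart I G (extChartAt I (1 : G) (f y)) = f y :=
  (hf.eventually ((isOpen_extChartAt_source (1 : G)).mem_nhds hx)).mono fun _ h =>
    (extChartAt I (1 : G)).left_inv h

variable (I) in
theorem idChart_mem_source {x : E} (hx : x ∈ (extChartAt I (1 : G)).target) :
    idChart I G x ∈ (extChartAt I (1 : G)).source :=
  (extChartAt I (1 : G)).map_target hx

variable (I) in
theorem contMDiffAt_mul_idChart (a : G) :
    ContMDiffAt 𝓘(𝕜, E) I ∞ (fun y => a * idChart I G y) (idPt I G) :=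
  contMDiffAt_const.mul (contMDiffAt_idChart_idPt I)

variable (I) in
theorem contMDiffAt_idChart_mul (a : G) :
    ContMDiffAt 𝓘(𝕜, E) I ∞ (fun y => idChart I G y * a) (idPt I G) :=
  (contMDiffAt_idChart_idPt I).mul contMDiffAt_const

theorem contMDiffAt_extChartAt_one {a : G} (ha : a ∈ (extChartAt I (1 : G)).source) :
    ContMDiffAt I 𝓘(𝕜, E) ∞ (extChartAt I (1 : G)) a :=
  contMDiffAt_extChartAt' (by rwa [← extChartAt_source I])

/-- Chain rule for a map from a vector space that factors through the chart at the identity. -/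
theorem fderiv_comp_idChart {V : Type*} [NormedAddCommGroup V] [NormedSpace 𝕜 V] {h : V → G}
    {x : V} (hh : MDifferentiableAt 𝓘(𝕜, V) I h x) (hx : h x ∈ (extChartAt I (1 : G)).source)
    {f : G → W} (hf : MDifferentiableAt I 𝓘(𝕜, W) f (h x)) :
    fderiv 𝕜 (fun y => f (h y)) x =
      (fderiv 𝕜 (fun y => f (idChart I G y)) (extChartAt I (1 : G) (h x))).comp
        (fderiv 𝕜 (fun y => extChartAt I (1 : G) (h y)) x) := by
  have e : (fun y => f (h y)) =ᶠ[𝓝 x]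
      (fun y => f (idChart I G y)) ∘ fun y => extChartAt I (1 : G) (h y) :=
    (eventually_idChart_extChartAt hh.continuousAt hx).mono fun y hy => by
      simp only [Function.comp_apply, hy]
  have hleft : idChart I G (extChartAt I (1 : G) (h x)) = h x := (extChartAt I (1 : G)).left_inv hx
  rw [e.fderiv_eq, fderiv_comp]
  · have h2 := (contMDiffAt_idChart I ((extChartAt I (1 : G)).map_source hx)).mdifferentiableAt
      (by simp)
    rw [← mdifferentiableAt_iff_differentiableAt]
    exact MDifferentiableAt.comp (I' := I) (g := f) _ (by rwa [hleft]) h2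
  · rw [← mdifferentiableAt_iff_differentiableAt]
    exact MDifferentiableAt.comp (I' := I) (g := extChartAt I (1 : G)) _
      ((contMDiffAt_extChartAt_one hx).mdifferentiableAt (by simp)) hh

variable (I) in
/-- The left-invariant vector fields in the chart at the identity. -/
theorem lgrad_extChartAt_one : lgrad I (extChartAt I (1 : G)) 1 = ContinuousLinearMap.id 𝕜 E := by
  have e : (fun x => extChartAt I (1 : G) (1 * idChart I G x)) =ᶠ[𝓝 (idPt I G)] id := by
    filter_upwards [idChart_target_mem_nhds (G := G) I] with x hx
    rw [one_mul]
    exact (extChartAt I (1 : G)).right_inv hx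
  rw [lgrad, e.fderiv_eq, fderiv_id]

theorem lgrad_one_eq_rgrad_one (f : G → W) : lgrad I f 1 = rgrad I f 1 := by
  simp only [lgrad, rgrad, one_mul, mul_one]

/-- The `lgrad` of the chart itself is the coordinate expression of the left-invariant fields, and
`lgrad f` is the derivative of `f` along them. -/
theorem lgrad_idChart {f : G → W} {x : E} (hx : x ∈ (extChartAt I (1 : G)).target)
    (hf : MDifferentiableAt I 𝓘(𝕜, W) f (idChart I G x)) :
    lgrad I f (idChart I G x) = (fderiv 𝕜 (fun y => f (idChart I G y)) x).comp
      (lgrad I (extChartAt I (1 : G)) (idChart I G x)) := by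
  have h := fderiv_comp_idChart (f := f)
    ((contMDiffAt_mul_idChart I (idChart I G x)).mdifferentiableAt (by simp))
    (by simpa using idChart_mem_source I hx) (by simpa using hf)
  simp only [idChart_idPt, mul_one] at h
  rw [lgrad, h]
  congr 2
  exact (extChartAt I (1 : G)).right_inv hx

/-- The bracket of `GroupLieAlgebra` is defined by pulling invariant vector fields back to the
chart; this identifies the pullbacks with the fields of `lgrad_idChart`. -/
theorem mpullback_mulInvariantVectorField_idChart {x : E}
    (hx : x ∈ (extChartAt I (1 : G)).target) (w : GroupLieAlgebra I G) :
    (mpullbackWithin 𝓘(𝕜, E) I (extChartAt I (1 : G)).symm (mulInvariantVectorField w) (range I) x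
      : E) = lgrad I (extChartAt I (1 : G)) (idChart I G x) w := by
  have : IsManifold I 1 G := IsManifold.of_le (n := ∞) (by simp)
  have hinv := isInvertible_mfderivWithin_extChartAt_symm (I := I) hx
  refine (ContinuousLinearMap.IsInvertible.inverse_apply_eq hinv).2 ?_
  have hψ : HasMFDerivAt 𝓘(𝕜, E) I (idChart I G) x
      (mfderivWithin 𝓘(𝕜, E) I (extChartAt I (1 : G)).symm (range I) x) := by
    rw [I.range_eq_univ, mfderivWithin_univ]
    exact ((contMDiffAt_idChart I hx).mdifferentiableAt (by simp)).hasMFDerivAt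
  have hm : MDifferentiableAt 𝓘(𝕜, E) I (fun y => idChart I G x * idChart I G y) (idPt I G) :=
    (contMDiffAt_mul_idChart I (idChart I G x)).mdifferentiableAt (by simp)
  have hsrc : idChart I G x * idChart I G (idPt I G) ∈ (extChartAt I (1 : G)).source := by
    simpa using idChart_mem_source I hx
  have hφ : DifferentiableAt 𝕜
      (fun y => extChartAt I (1 : G) (idChart I G x * idChart I G y)) (idPt I G) := by
    rw [← mdifferentiableAt_iff_differentiableAt]
    exact MDifferentiableAt.comp (I' := I) (g := extChartAt I (1 : G)) _
      ((contMDiffAt_extChartAt_one hsrc).mdifferentiableAt (by simp)) hm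
  have hpt : extChartAt I (1 : G) (idChart I G x * idChart I G (idPt I G)) = x := by
    rw [idChart_idPt, mul_one]
    exact (extChartAt I (1 : G)).right_inv hx
  -- the derivative of `y ↦ ψ x * ψ y` at the origin, in two ways
  have h1 : HasMFDerivAt 𝓘(𝕜, E) I (fun y => idChart I G x * idChart I G y) (idPt I G)
      ((mfderiv I I (fun h => idChart I G x * h) 1 : E →L[𝕜] E).comp
        (ContinuousLinearMap.id 𝕜 E)) := by
    refine HasMFDerivAt.comp (g := fun h => idChart I G x * h) _ ?_ (mfderiv_idChart I)
    rw [idChart_idPt]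
    exact ((contMDiff_mul_left (I := I) (n := ∞)).mdifferentiable (by simp) _).hasMFDerivAt
  have h2 : HasMFDerivAt 𝓘(𝕜, E) I
      (idChart I G ∘ fun y => extChartAt I (1 : G) (idChart I G x * idChart I G y)) (idPt I G)
      ((mfderivWithin 𝓘(𝕜, E) I (extChartAt I (1 : G)).symm (range I) x : E →L[𝕜] E).comp
        (lgrad (W := E) I (extChartAt I (1 : G)) (idChart I G x))) := by
    refine HasMFDerivAt.comp (g := idChart I G) _ ?_ hφ.hasFDerivAt.hasMFDerivAt
    rw [hpt]
    exact hψ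
  have h3 := h2.congr_of_eventuallyEq
    ((eventually_idChart_extChartAt hm.continuousAt hsrc).mono fun y hy => hy.symm)
  exact congrArg (fun A : E →L[𝕜] E => A w) (hasMFDerivAt_unique h1 h3)

variable (I G) in
/-- The bracket of the Lie algebra of `G`, as an operation on the model space. -/
def coordBracket (v w : E) : E :=
  (⁅(show GroupLieAlgebra I G from v), (show GroupLieAlgebra I G from w)⁆ : GroupLieAlgebra I G)

theorem two_le_infty : (2 : ℕ∞ω) ≤ ∞ := WithTop.coe_le_coe.2 (le_top : (2 : ℕ∞) ≤ ⊤)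

variable [CompleteSpace E]

theorem coordBracket_eq_lieBracket (v w : E) :
    coordBracket I G v w =
      lieBracket 𝕜 (fun x => lgrad I (extChartAt I (1 : G)) (idChart I G x) v)
        (fun x => lgrad I (extChartAt I (1 : G)) (idChart I G x) w) (idPt I G) := by
  have : IsManifold I 1 G := IsManifold.of_le (n := ∞) (by simp)
  have key : ∀ w : GroupLieAlgebra I G,
      (mpullbackWithin 𝓘(𝕜, E) I (extChartAt I (1 : G)).symm (mulInvariantVectorField w) (range I)
        : E → E) =ᶠ[𝓝 (idPt I G)]
      fun x => lgrad I (extChartAt I (1 : G)) (idChart I G x) w := by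
    intro w
    filter_upwards [idChart_target_mem_nhds (G := G) I] with x hx
    exact mpullback_mulInvariantVectorField_idChart hx w
  rw [coordBracket, GroupLieAlgebra.bracket_def, ← mlieBracketWithin_univ, mlieBracketWithin_apply,
    mfderiv_extChartAt_self]
  have hid : (ContinuousLinearMap.id 𝕜 E).inverse = ContinuousLinearMap.id 𝕜 E :=
    ContinuousLinearMap.inverse_id
  refine (DFunLike.congr_fun hid _).trans ?_
  refine ((key v).lieBracketWithin_vectorField_eq_nhds (key w)).trans ?_
  rw [I.range_eq_univ, preimage_univ, univ_inter, lieBracketWithin_univ]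

/-- In coordinates these are derivatives along two vector fields, whose commutator is the derivative
along their Lie bracket; at `1` the fields take the values `v` and `w`. -/
theorem lgrad_lgrad_sub_one {f : G → W} (hf : ContMDiffAt I 𝓘(𝕜, W) ∞ f 1)
    (v w : E) :
    lgrad I (fun b => lgrad I f b w) 1 v - lgrad I (fun b => lgrad I f b v) 1 w =
      lgrad I f 1 (coordBracket I G v w) := by
  have hf1 : lgrad I f 1 = fderiv 𝕜 (fun x => f (idChart I G x)) (idPt I G) := by
    simp only [lgrad, one_mul]
  have hsmooth : ContDiffAt 𝕜 ∞ (fun x => f (idChart I G x)) (idPt I G) :=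
    contMDiffAt_iff_contDiffAt.1
      (ContMDiffAt.comp_of_eq (g := f) hf (contMDiffAt_idChart_idPt I) (by simp))
  have hφ1 : ContMDiffAt I 𝓘(𝕜, E) ∞ (extChartAt I (1 : G)) 1 :=
    contMDiffAt_extChartAt_one (mem_extChartAt_source 1)
  have hV : ∀ v : E, DifferentiableAt 𝕜
      (fun x => lgrad I (extChartAt I (1 : G)) (idChart I G x) v) (idPt I G) := by
    intro v
    have h := ContMDiffAt.comp_of_eq (g := lgrad I (extChartAt I (1 : G))) hφ1.lgrad
      (contMDiffAt_idChart_idPt I) (by simp)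
    exact ((contMDiffAt_iff_contDiffAt.1 h).differentiableAt (by simp)).clm_apply
      (differentiableAt_const v)
  have hdiff : ∀ᶠ x in 𝓝 (idPt I G), MDifferentiableAt I 𝓘(𝕜, W) f (idChart I G x) := by
    have : IsManifold I 1 G := IsManifold.of_le (n := ∞) (by simp)
    have h1 : ∀ᶠ a in 𝓝 (1 : G), MDifferentiableAt I 𝓘(𝕜, W) f a :=
      ((contMDiffAt_iff_contMDiffAt_nhds (by simp)).1 (hf.of_le (m := 1) (by simp))).mono
        fun a ha => ha.mdifferentiableAt one_ne_zero
    have hc := (contMDiffAt_idChart_idPt (G := G) I).continuousAt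
    rw [ContinuousAt, idChart_idPt] at hc
    exact hc.eventually h1
  have key : ∀ w : E, (fun x => lgrad I f (1 * idChart I G x) w) =ᶠ[𝓝 (idPt I G)] fun x =>
      fderiv 𝕜 (fun y => f (idChart I G y)) x
        (lgrad I (extChartAt I (1 : G)) (idChart I G x) w) := by
    intro w
    filter_upwards [idChart_target_mem_nhds (G := G) I, hdiff] with x hx hx'
    rw [one_mul, lgrad_idChart hx hx']
    rfl
  have hone : ∀ v : E, lgrad I (extChartAt I (1 : G)) (idChart I G (idPt I G)) v = v := by
    intro v
    rw [idChart_idPt, lgrad_extChartAt_one]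
    rfl
  have h := fderiv_apply_lieBracket hsmooth (by simpa using two_le_infty) (hV w) (hV v)
  rw [hone, hone] at h
  rw [coordBracket_eq_lieBracket, hf1]
  refine Eq.trans ?_ h.symm
  congr 1
  · exact congrArg (fun A : E →L[𝕜] W => A v) (key w).fderiv_eq
  · exact congrArg (fun A : E →L[𝕜] W => A w) (key v).fderiv_eq

theorem lgrad_comp_mul_left (f : G → W) (a b : G) :
    lgrad I (fun c => f (a * c)) b = lgrad I f (a * b) := by
  simp only [lgrad, mul_assoc]

theorem rgrad_comp_mul_right (f : G → W) (a b : G) :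
    rgrad I (fun c => f (c * a)) b = rgrad I f (b * a) := by
  simp only [rgrad, mul_assoc]

/-- Left-invariant derivatives represent the Lie algebra. -/
theorem lgrad_lgrad_sub {f : G → W} {a : G} (hf : ContMDiffAt I 𝓘(𝕜, W) ∞ f a)
    (v w : E) :
    lgrad I (fun b => lgrad I f b w) a v - lgrad I (fun b => lgrad I f b v) a w =
      lgrad I f a (coordBracket I G v w) := by
  -- Left-invariant derivatives commute with left translation, so the identity at `1` for the
  -- translated function is the identity at `a`.
  have h := lgrad_lgrad_sub_one (f := fun c => f (a * c))
    (ContMDiffAt.comp_of_eq (g := f) hf contMDiffAt_mul_left (by simp)) v w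
  simp only [lgrad_comp_mul_left] at h
  have e : ∀ v w : E, lgrad I (fun b => lgrad I f (a * b) w) 1 v =
      lgrad I (fun b => lgrad I f b w) a v := fun v w => by
    rw [lgrad_comp_mul_left (fun b => lgrad I f b w), mul_one]
  rw [e, e, mul_one] at h
  exact h

/-- Right-invariant derivatives represent the opposite of the Lie algebra. -/
theorem rgrad_rgrad_sub {f : G → W} {a : G} (hf : ContMDiffAt I 𝓘(𝕜, W) ∞ f a)
    (v w : E) :
    rgrad I (fun b => rgrad I f b w) a v - rgrad I (fun b => rgrad I f b v) a w =
      - rgrad I f a (coordBracket I G v w) := by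
  have hf' : ContMDiffAt I 𝓘(𝕜, W) ∞ (fun c => f (c * a)) 1 :=
    ContMDiffAt.comp_of_eq (g := f) hf contMDiffAt_mul_right (by simp)
  have h := lgrad_lgrad_sub_one hf' v w
  -- At `1`, second right derivatives are second left derivatives in the other order, whence the
  -- minus sign; right translation moves the identity to `a`.
  rw [← rgrad_rgrad_one hf', ← rgrad_rgrad_one hf', lgrad_one_eq_rgrad_one] at h
  simp only [rgrad_comp_mul_right] at h
  have e : ∀ v w : E, rgrad I (fun b => rgrad I f (b * a) w) 1 v =
      rgrad I (fun b => rgrad I f b w) a v := fun v w => by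
    rw [rgrad_comp_mul_right (fun b => rgrad I f b w), one_mul]
  rw [e, e, one_mul] at h
  rw [← h, neg_sub]

end LieGroupBracket

/-! ### Homomorphisms and their derivatives. -/

section Homomorphisms

open Filter Topology Set

variable {𝕜 : Type*} [RCLike 𝕜] {E : Type*} [NormedAddCommGroup E] [NormedSpace 𝕜 E]
  {H : Type*} [TopologicalSpace H] {I : ModelWithCorners 𝕜 E H}
  {G : Type*} [Group G] [TopologicalSpace G] [ChartedSpace H G]
  {W : Type*} [NormedAddCommGroup W] [NormedSpace 𝕜 W]
  [I.Boundaryless] [LieGroup I ∞ G]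
  {E' : Type*} [NormedAddCommGroup E'] [NormedSpace 𝕜 E'] {H' : Type*} [TopologicalSpace H']
  {J : ModelWithCorners 𝕜 E' H'} {G' : Type*} [Group G'] [TopologicalSpace G']
  [ChartedSpace H' G'] [J.Boundaryless] [LieGroup J ∞ G']

variable (I J) in
/-- The derivative at the identity of a homomorphism, in coordinates. -/
def homDeriv (K : G →* G') : E →L[𝕜] E' :=
  fderiv 𝕜 (fun x => extChartAt J (1 : G') (K (idChart I G x))) (idPt I G)

theorem lgrad_congr {f g : G → W} {a : G} (h : f =ᶠ[𝓝 a] g) : lgrad I f a = lgrad I g a := by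
  have hc := (contMDiffAt_mul_idChart I a).continuousAt
  rw [ContinuousAt, idChart_idPt, mul_one] at hc
  have e : (fun x => f (a * idChart I G x)) =ᶠ[𝓝 (idPt I G)] fun x => g (a * idChart I G x) :=
    hc.eventually h
  exact e.fderiv_eq

theorem rgrad_congr {f g : G → W} {a : G} (h : f =ᶠ[𝓝 a] g) : rgrad I f a = rgrad I g a := by
  have hc := (contMDiffAt_idChart_mul I a).continuousAt
  rw [ContinuousAt, idChart_idPt, one_mul] at hc
  have e : (fun x => f (idChart I G x * a)) =ᶠ[𝓝 (idPt I G)] fun x => g (idChart I G x * a) :=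
    hc.eventually h
  exact e.fderiv_eq

/-- The chain rule for `K (b * ψ x) = K b * K (ψ x)`. -/
theorem lgrad_comp_hom {K : G →* G'} (hK : ContMDiffAt I J ∞ K 1) {f : G' → W} {b : G}
    (hf : MDifferentiableAt J 𝓘(𝕜, W) f (K b)) :
    lgrad I (fun c => f (K c)) b = (lgrad J f (K b)).comp (homDeriv I J K) := by
  have h1 : MDifferentiableAt 𝓘(𝕜, E) J (fun x => K (idChart I G x)) (idPt I G) :=
    (ContMDiffAt.comp_of_eq (g := K) hK (contMDiffAt_idChart_idPt I) (by simp)).mdifferentiableAt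
      (by simp)
  have h2 : MDifferentiableAt J 𝓘(𝕜, W) (fun c => f (K b * c)) 1 := by
    have := (contMDiff_mul_left (I := J) (n := ∞) (a := K b)).mdifferentiable (by simp) 1
    exact MDifferentiableAt.comp_of_eq (g := f) (hy := by simp) (hf := this) (hg := hf)
  have h := fderiv_comp_idChart (f := fun c => f (K b * c)) h1 (by simp) (by simpa using h2)
  simp only [idChart_idPt, map_one] at h
  simp only [lgrad, map_mul]
  exact h

theorem eventually_mdifferentiableAt {f : G → W} {a : G} (hf : ContMDiffAt I 𝓘(𝕜, W) ∞ f a) :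
    ∀ᶠ b in 𝓝 a, MDifferentiableAt I 𝓘(𝕜, W) f b := by
  have : IsManifold I 1 G := IsManifold.of_le (n := ∞) (by simp)
  exact ((contMDiffAt_iff_contMDiffAt_nhds (by simp)).1 (hf.of_le (m := 1) (by simp))).mono
    fun a ha => ha.mdifferentiableAt one_ne_zero

theorem contMDiffAt_extChartAt_one_one : ContMDiffAt I 𝓘(𝕜, E) ∞ (extChartAt I (1 : G)) 1 :=
  contMDiffAt_extChartAt_one (mem_extChartAt_source 1)

/-- The chart of `G'` serves as test function: the commutator of left derivatives of its pullback is
computed once in `G` and once in `G'`. -/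
theorem homDeriv_coordBracket [CompleteSpace E] [CompleteSpace E'] {K : G →* G'}
    (hK : ContMDiffAt I J ∞ K 1) (v w : E) :
    homDeriv I J K (coordBracket I G v w) =
      coordBracket J G' (homDeriv I J K v) (homDeriv I J K w) := by
  have hφ : ContMDiffAt J 𝓘(𝕜, E') ∞ (extChartAt J (1 : G')) (K 1) :=
    contMDiffAt_extChartAt_one (by simp)
  have hd : ∀ᶠ b in 𝓝 (1 : G), MDifferentiableAt J 𝓘(𝕜, E') (extChartAt J (1 : G')) (K b) :=
    hK.continuousAt.eventually (eventually_mdifferentiableAt hφ)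
  have h1 : ∀ w, (fun b => lgrad I (fun c => extChartAt J (1 : G') (K c)) b w) =ᶠ[𝓝 1] fun b =>
      lgrad J (extChartAt J (1 : G')) (K b) (homDeriv I J K w) := fun w => by
    filter_upwards [hd] with b hb
    rw [lgrad_comp_hom hK hb]
    rfl
  have h2 : ∀ v w, lgrad I (fun b => lgrad I (fun c => extChartAt J (1 : G') (K c)) b w) 1 v =
      lgrad J (fun b => lgrad J (extChartAt J (1 : G')) b (homDeriv I J K w)) 1
        (homDeriv I J K v) := fun v w => by
    have hs : ContMDiffAt J 𝓘(𝕜, E') ∞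
        (fun b => lgrad J (extChartAt J (1 : G')) b (homDeriv I J K w)) (K 1) :=
      hφ.lgrad.clm_apply contMDiffAt_const
    rw [lgrad_congr (h1 w), lgrad_comp_hom hK
      (f := fun b => lgrad J (extChartAt J (1 : G')) b (homDeriv I J K w))
      (hs.mdifferentiableAt (by simp)), map_one]
    rfl
  have h3 := lgrad_lgrad_sub_one (ContMDiffAt.comp (g := extChartAt J (1 : G')) 1 hφ hK) v w
  simp only [Function.comp_def] at h3
  rw [h2, h2, lgrad_lgrad_sub_one contMDiffAt_extChartAt_one_one, lgrad_extChartAt_one,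
    lgrad_comp_hom hK (hφ.mdifferentiableAt (by simp)), map_one, lgrad_extChartAt_one] at h3
  exact h3.symm

/-! ### The adjoint representation -/

variable (I) in
/-- The adjoint representation, in coordinates. -/
def coordAd (a : G) : E →L[𝕜] E :=
  fderiv 𝕜 (fun x => extChartAt I (1 : G) (a * idChart I G x * a⁻¹)) (idPt I G)

variable (I) in
theorem contMDiffAt_conj_idChart (a : G) :
    ContMDiffAt 𝓘(𝕜, E) I ∞ (fun x => a * idChart I G x * a⁻¹) (idPt I G) :=
  (contMDiffAt_mul_idChart I a).mul contMDiffAt_const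

variable (I) in
theorem coordAd_eq_homDeriv (a : G) :
    coordAd I a = homDeriv I I (MulAut.conj a).toMonoidHom := rfl

variable (I) in
theorem coordAd_coordBracket [CompleteSpace E] (a : G) (v w : E) :
    coordAd I a (coordBracket I G v w) =
      coordBracket I G (coordAd I a v) (coordAd I a w) := by
  rw [coordAd_eq_homDeriv]
  exact homDeriv_coordBracket
    ((contMDiff_mul_left (a := a)).mul contMDiff_const).contMDiffAt v w

/-- The chain rule for `a * ψ x = (a * ψ x * a⁻¹) * a`. -/
theorem lgrad_eq_rgrad_comp_coordAd {f : G → W} {a : G} (hf : MDifferentiableAt I 𝓘(𝕜, W) f a) :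
    lgrad I f a = (rgrad I f a).comp (coordAd I a) := by
  have h2 : MDifferentiableAt I 𝓘(𝕜, W) (fun c => f (c * a)) 1 :=
    MDifferentiableAt.comp_of_eq (g := f) (hy := by simp) (hg := hf)
      (hf := (contMDiff_mul_right (I := I) (n := ∞) (a := a)).mdifferentiable (by simp) 1)
  have h := fderiv_comp_idChart (f := fun c => f (c * a))
    ((contMDiffAt_conj_idChart I a).mdifferentiableAt (by simp)) (by simp) (by simpa using h2)
  simp only [idChart_idPt, mul_one, mul_inv_cancel, inv_mul_cancel_right] at h
  exact h

variable (I) in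
theorem coordAd_mul (a b : G) : coordAd I (a * b) = (coordAd I a).comp (coordAd I b) := by
  have h2 : MDifferentiableAt I 𝓘(𝕜, E) (fun c => extChartAt I (1 : G) (a * c * a⁻¹)) 1 :=
    (ContMDiffAt.comp_of_eq (g := extChartAt I (1 : G)) (f := fun c => a * c * a⁻¹)
      contMDiffAt_extChartAt_one_one
      ((contMDiff_mul_left (a := a)).mul contMDiff_const).contMDiffAt
      (by simp)).mdifferentiableAt (by simp)
  have h := fderiv_comp_idChart (f := fun c => extChartAt I (1 : G) (a * c * a⁻¹))
    ((contMDiffAt_conj_idChart I b).mdifferentiableAt (by simp)) (by simp) (by simpa using h2)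
  simp only [idChart_idPt, mul_one, mul_inv_cancel] at h
  simp only [coordAd, mul_inv_rev]
  refine Eq.trans ?_ h
  simp only [mul_assoc]

variable (I G) in
theorem coordAd_one : coordAd I (1 : G) = ContinuousLinearMap.id 𝕜 E := by
  rw [← lgrad_extChartAt_one (I := I) (G := G)]
  simp only [coordAd, lgrad, inv_one, mul_one]

variable (I) in
theorem contMDiffAt_coordAd (a : G) : ContMDiffAt I 𝓘(𝕜, E →L[𝕜] E) ∞ (coordAd I) a := by
  have : IsManifold I 1 G := IsManifold.of_le (n := ∞) (by simp)
  refine contMDiffAt_fderiv_param ?_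
  have h : ContMDiffAt (I.prod 𝓘(𝕜, E)) I ∞
      (fun p : G × E => p.1 * idChart I G p.2 * p.1⁻¹) (a, idPt I G) :=
    (contMDiffAt_fst.mul ((contMDiffAt_idChart_idPt I).comp (a, idPt I G) contMDiffAt_snd)).mul
      contMDiffAt_fst.inv
  exact ContMDiffAt.comp_of_eq (g := extChartAt I (1 : G))
    (f := fun p : G × E => p.1 * idChart I G p.2 * p.1⁻¹) contMDiffAt_extChartAt_one_one h
    (by simp)

theorem differentiableAt_comp_idChart {f : G → W} (hf : MDifferentiableAt I 𝓘(𝕜, W) f 1) :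
    DifferentiableAt 𝕜 (fun x => f (idChart I G x)) (idPt I G) := by
  rw [← mdifferentiableAt_iff_differentiableAt]
  exact MDifferentiableAt.comp_of_eq (g := f) (hy := by simp) (hg := hf)
    (hf := (contMDiffAt_idChart_idPt I).mdifferentiableAt (by simp))

/-- The derivative of the adjoint representation is the bracket. -/
theorem lgrad_coordAd_one [CompleteSpace E] (u v : E) :
    lgrad I (coordAd I) (1 : G) u v = coordBracket I G u v := by
  have hφ := contMDiffAt_extChartAt_one_one (I := I) (G := G)
  -- The relation between left and right gradients of the chart is differentiated at `1` along `u`.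
  -- The product rule gives the derivative of `Ad` plus a mixed derivative, which equals the second
  -- left derivative in the opposite order; so the derivative of `Ad` is a commutator.
  have h1 : (fun b => lgrad I (extChartAt I (1 : G)) b v) =ᶠ[𝓝 1] fun b =>
      rgrad I (extChartAt I (1 : G)) b (coordAd I b v) := by
    filter_upwards [eventually_mdifferentiableAt hφ] with b hb
    rw [lgrad_eq_rgrad_comp_coordAd hb]
    rfl
  have hr := differentiableAt_comp_idChart (hφ.rgrad.mdifferentiableAt (by simp))
  have hA := differentiableAt_comp_idChart
    ((contMDiffAt_coordAd I (1 : G)).mdifferentiableAt (by simp))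
  have h2 := hr.hasFDerivAt.clm_apply (hA.hasFDerivAt.clm_apply
    (hasFDerivAt_const v (idPt I G)))
  have h3 := congrArg (fun A : E →L[𝕜] E => A u) h2.fderiv
  have h4 : lgrad I (fun b => lgrad I (extChartAt I (1 : G)) b v) 1 u =
      fderiv 𝕜 (fun x => rgrad I (extChartAt I (1 : G)) (idChart I G x)
        (coordAd I (idChart I G x) v)) (idPt I G) u := by
    rw [lgrad_congr h1]
    simp only [lgrad, one_mul]
  have h5 : lgrad I (fun b => rgrad I (extChartAt I (1 : G)) b v) 1 u =
      fderiv 𝕜 (fun x => rgrad I (extChartAt I (1 : G)) (idChart I G x)) (idPt I G) u v := by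
    have h := hr.hasFDerivAt.clm_apply (hasFDerivAt_const v (idPt I G))
    have := congrArg (fun A : E →L[𝕜] E => A u) h.fderiv
    simp only [lgrad, one_mul]
    refine this.trans ?_
    simp
  have h6 : lgrad I (fun b => rgrad I (extChartAt I (1 : G)) b v) 1 u =
      lgrad I (fun b => lgrad I (extChartAt I (1 : G)) b u) 1 v := by
    rw [← rgrad_lgrad_comm hφ, ← lgrad_one_eq_rgrad_one]
  have h7 := lgrad_lgrad_sub_one hφ u v
  rw [lgrad_extChartAt_one] at h7
  have h8 : lgrad I (coordAd I) (1 : G) u v =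
      fderiv 𝕜 (fun x => coordAd I (idChart I G x)) (idPt I G) u v := by
    simp only [lgrad, one_mul]
  rw [h4, ← h6, h5] at h7
  rw [h8]
  refine Eq.trans ?_ h7
  rw [eq_sub_iff_add_eq]
  refine Eq.trans ?_ h3.symm
  simp only [idChart_idPt, coordAd_one, ← lgrad_one_eq_rgrad_one, lgrad_extChartAt_one]
  simp

/-- A function on a connected Lie group whose right-invariant derivatives vanish is constant. -/
theorem eq_of_rgrad_eq_zero [PreconnectedSpace G] {f : G → W}
    (hf : ∀ a, HasFDerivAt (𝕜 := 𝕜) (fun x => f (idChart I G x * a)) 0 (idPt I G)) (a b : G) :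
    f a = f b := by
  have hloc : IsLocallyConstant f := by
    rw [IsLocallyConstant.iff_eventually_eq]
    intro a
    obtain ⟨r, hr, hball⟩ := Metric.mem_nhds_iff.1 (idChart_target_mem_nhds (G := G) I)
    have hder : ∀ x ∈ Metric.ball (idPt I G) r,
        HasFDerivAt (𝕜 := 𝕜) (fun y => f (idChart I G y * a)) 0 x := by
      intro x hx
      have hx' := hball hx
      have hm : MDifferentiableAt 𝓘(𝕜, E) I (fun y => idChart I G y * (idChart I G x)⁻¹) x :=
        ((contMDiffAt_idChart I hx').mul contMDiffAt_const).mdifferentiableAt (by simp)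
      have h1 : DifferentiableAt 𝕜
          (fun y => extChartAt I (1 : G) (idChart I G y * (idChart I G x)⁻¹)) x := by
        rw [← mdifferentiableAt_iff_differentiableAt]
        exact MDifferentiableAt.comp_of_eq (g := extChartAt I (1 : G)) (hy := by simp) (hf := hm)
          (hg := contMDiffAt_extChartAt_one_one.mdifferentiableAt (by simp))
      have h2 := hf (idChart I G x * a)
      -- The hypothesis speaks of the chart centre only. Writing `ψ y * a` as `(ψ y * (ψ x)⁻¹) * (ψ
      -- x * a)` moves the centre to `x`.
      have e : idPt I G = extChartAt I (1 : G) (idChart I G x * (idChart I G x)⁻¹) := by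
        rw [mul_inv_cancel]; rfl
      rw [e] at h2
      have h3 := h2.comp x h1.hasFDerivAt
      rw [ContinuousLinearMap.zero_comp] at h3
      refine h3.congr_of_eventuallyEq ?_
      filter_upwards [eventually_idChart_extChartAt (I := I) hm.continuousAt (by simp)] with y hy
      simp only [Function.comp_apply, hy]
      group
    -- Convexity of the ball is a real notion, also when `𝕜` is `ℂ`.
    let := NormedSpace.restrictScalars ℝ 𝕜 E
    have hconst : ∀ x ∈ Metric.ball (idPt I G) r, f (idChart I G x * a) = f a := by
      intro x hx
      have := Metric.isOpen_ball.is_const_of_fderiv_eq_zero (𝕜 := 𝕜)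
        (convex_ball (idPt I G) r).isPreconnected
        (fun y hy => (hder y hy).differentiableAt.differentiableWithinAt)
        (fun y hy => (hder y hy).fderiv) hx (Metric.mem_ball_self hr)
      simpa using this
    have hc : ContinuousAt (fun b : G => b * a⁻¹) a :=
      (contMDiff_mul_right (I := I) (n := ∞)).continuous.continuousAt
    have hφ : ContinuousAt (fun b : G => extChartAt I (1 : G) (b * a⁻¹)) a :=
      ContinuousAt.comp_of_eq (continuousAt_extChartAt (I := I) (1 : G)) hc (by simp)
    have hφa : extChartAt I (1 : G) (a * a⁻¹) = idPt I G := by rw [mul_inv_cancel]; rfl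
    have hmem : ∀ᶠ b in 𝓝 a, extChartAt I (1 : G) (b * a⁻¹) ∈ Metric.ball (idPt I G) r :=
      hφ.eventually (by
        change Metric.ball (idPt I G) r ∈ 𝓝 (extChartAt I (1 : G) (a * a⁻¹))
        rw [hφa]
        exact Metric.ball_mem_nhds _ hr)
    filter_upwards [hmem, eventually_idChart_extChartAt (I := I) hc (by simp)] with b hb hb'
    have := hconst _ hb
    rwa [hb', inv_mul_cancel_right] at this
  exact hloc.apply_eq_of_isPreconnected isPreconnected_univ (mem_univ a) (mem_univ b)

/-- An invariant bilinear form on the Lie algebra of a connected Lie group is invariant under the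
adjoint representation. -/
theorem coordAd_invariant [CompleteSpace E] [PreconnectedSpace G] (B : E →L[𝕜] E →L[𝕜] 𝕜)
    (hB : ∀ u v w, B (coordBracket I G u v) w + B v (coordBracket I G u w) = 0) (a : G) (v w : E) :
    B (coordAd I a v) (coordAd I a w) = B v w := by
  have h := eq_of_rgrad_eq_zero (I := I) (f := fun a : G => B (coordAd I a v) (coordAd I a w))
    (fun a => ?_) a 1
  · simpa [coordAd_one] using h
  · have hA := (differentiableAt_comp_idChart
      ((contMDiffAt_coordAd I (1 : G)).mdifferentiableAt (by simp))).hasFDerivAt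
    have h1 := hA.clm_apply (hasFDerivAt_const (coordAd I a v) (idPt I G))
    have h2 := hA.clm_apply (hasFDerivAt_const (coordAd I a w) (idPt I G))
    have h3 := B.hasFDerivAt_of_bilinear h1 h2
    -- Since `Ad (ψ x * a) = Ad (ψ x) Ad a`, the right derivative at `a` is the infinitesimal
    -- invariance at the vectors `Ad a v` and `Ad a w`.
    have e : (fun x => B (coordAd I (idChart I G x * a) v) (coordAd I (idChart I G x * a) w)) =
        fun x => B (coordAd I (idChart I G x) (coordAd I a v))
          (coordAd I (idChart I G x) (coordAd I a w)) := by
      funext x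
      simp only [coordAd_mul, ContinuousLinearMap.comp_apply]
    rw [e]
    refine h3.congr_fderiv ?_
    ext u
    have h4 : ∀ v, fderiv 𝕜 (fun x => coordAd I (idChart I G x)) (idPt I G) u v =
        coordBracket I G u v := fun v => by
      rw [← lgrad_coordAd_one]
      simp only [lgrad, one_mul]
    have h5 := hB u (coordAd I a v) (coordAd I a w)
    simp [coordAd_one, h4, add_comm] at h5 ⊢
    exact h5

end Homomorphisms

/-! ### The Jacobiator of `κ Λ^L - Λ^R`. -/

section Jacobi

open Filter Topology Set

variable {𝕜 : Type*} [RCLike 𝕜] {E : Type*} [NormedAddCommGroup E] [NormedSpace 𝕜 E]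
  {H : Type*} [TopologicalSpace H] {I : ModelWithCorners 𝕜 E H}
  {G : Type*} [Group G] [TopologicalSpace G] [ChartedSpace H G]
  {V : Type*} [NormedAddCommGroup V] [NormedSpace 𝕜 V]
  {V' : Type*} [NormedAddCommGroup V'] [NormedSpace 𝕜 V']
  {W : Type*} [NormedAddCommGroup W] [NormedSpace 𝕜 W]
  [I.Boundaryless] [LieGroup I ∞ G]

theorem differentiableAt_mul_idChart {f : G → W} {a : G} (hf : MDifferentiableAt I 𝓘(𝕜, W) f a) :
    DifferentiableAt 𝕜 (fun x => f (a * idChart I G x)) (idPt I G) := by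
  rw [← mdifferentiableAt_iff_differentiableAt]
  exact MDifferentiableAt.comp_of_eq (g := f) (hy := by simp) (hg := hf)
    (hf := (contMDiffAt_mul_idChart I a).mdifferentiableAt (by simp))

theorem differentiableAt_idChart_mul {f : G → W} {a : G} (hf : MDifferentiableAt I 𝓘(𝕜, W) f a) :
    DifferentiableAt 𝕜 (fun x => f (idChart I G x * a)) (idPt I G) := by
  rw [← mdifferentiableAt_iff_differentiableAt]
  exact MDifferentiableAt.comp_of_eq (g := f) (hy := by simp) (hg := hf)
    (hf := (contMDiffAt_idChart_mul I a).mdifferentiableAt (by simp))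

theorem lgrad_bilinear (B : V →L[𝕜] V' →L[𝕜] W) {φ : G → V} {ψ : G → V'} {a : G}
    (hφ : MDifferentiableAt I 𝓘(𝕜, V) φ a) (hψ : MDifferentiableAt I 𝓘(𝕜, V') ψ a) (v : E) :
    lgrad I (fun b => B (φ b) (ψ b)) a v =
      B (lgrad I φ a v) (ψ a) + B (φ a) (lgrad I ψ a v) := by
  have h := B.hasFDerivAt_of_bilinear (differentiableAt_mul_idChart hφ).hasFDerivAt
    (differentiableAt_mul_idChart hψ).hasFDerivAt
  refine (congrArg (fun A : E →L[𝕜] W => A v) h.fderiv).trans ?_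
  simp [lgrad, add_comm]

theorem rgrad_bilinear (B : V →L[𝕜] V' →L[𝕜] W) {φ : G → V} {ψ : G → V'} {a : G}
    (hφ : MDifferentiableAt I 𝓘(𝕜, V) φ a) (hψ : MDifferentiableAt I 𝓘(𝕜, V') ψ a) (v : E) :
    rgrad I (fun b => B (φ b) (ψ b)) a v =
      B (rgrad I φ a v) (ψ a) + B (φ a) (rgrad I ψ a v) := by
  have h := B.hasFDerivAt_of_bilinear (differentiableAt_idChart_mul hφ).hasFDerivAt
    (differentiableAt_idChart_mul hψ).hasFDerivAt
  refine (congrArg (fun A : E →L[𝕜] W => A v) h.fderiv).trans ?_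
  simp [rgrad, add_comm]

theorem lgrad_apply_const {φ : G → E →L[𝕜] W} {a : G}
    (hφ : MDifferentiableAt I 𝓘(𝕜, E →L[𝕜] W) φ a) (v w : E) :
    lgrad I (fun b => φ b w) a v = lgrad I φ a v w := by
  have h := (differentiableAt_mul_idChart hφ).hasFDerivAt.clm_apply (hasFDerivAt_const w _)
  refine (congrArg (fun A : E →L[𝕜] W => A v) h.fderiv).trans ?_
  simp [lgrad]

theorem rgrad_apply_const {φ : G → E →L[𝕜] W} {a : G}
    (hφ : MDifferentiableAt I 𝓘(𝕜, E →L[𝕜] W) φ a) (v w : E) :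
    rgrad I (fun b => φ b w) a v = rgrad I φ a v w := by
  have h := (differentiableAt_idChart_mul hφ).hasFDerivAt.clm_apply (hasFDerivAt_const w _)
  refine (congrArg (fun A : E →L[𝕜] W => A v) h.fderiv).trans ?_
  simp [rgrad]

theorem lgrad_const_mul_sub {f g : G → 𝕜} {a : G} (hf : MDifferentiableAt I 𝓘(𝕜, 𝕜) f a)
    (hg : MDifferentiableAt I 𝓘(𝕜, 𝕜) g a) (c : 𝕜) (v : E) :
    lgrad I (fun b => c * f b - g b) a v = c * lgrad I f a v - lgrad I g a v := by
  have h := ((differentiableAt_mul_idChart hf).hasFDerivAt.const_mul c).sub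
    (differentiableAt_mul_idChart hg).hasFDerivAt
  exact congrArg (fun A : E →L[𝕜] 𝕜 => A v) h.fderiv

theorem rgrad_const_mul_sub {f g : G → 𝕜} {a : G} (hf : MDifferentiableAt I 𝓘(𝕜, 𝕜) f a)
    (hg : MDifferentiableAt I 𝓘(𝕜, 𝕜) g a) (c : 𝕜) (v : E) :
    rgrad I (fun b => c * f b - g b) a v = c * rgrad I f a v - rgrad I g a v := by
  have h := ((differentiableAt_idChart_mul hf).hasFDerivAt.const_mul c).sub
    (differentiableAt_idChart_mul hg).hasFDerivAt
  exact congrArg (fun A : E →L[𝕜] 𝕜 => A v) h.fderiv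

variable (I) in
/-- The bracket of functions on `G` given by `κ Λ^L - Λ^R`, where `B` is the bilinear form on
covectors given by `Λ`. -/
def biBracket (κ : 𝕜) (B : (E →L[𝕜] 𝕜) →L[𝕜] (E →L[𝕜] 𝕜) →L[𝕜] 𝕜) (f g : G → 𝕜) (a : G) : 𝕜 :=
  κ * B (lgrad I f a) (lgrad I g a) - B (rgrad I f a) (rgrad I g a)

theorem contMDiffAt_bilinear (B : V →L[𝕜] V' →L[𝕜] W) {φ : G → V} {ψ : G → V'} {a : G}
    (hφ : ContMDiffAt I 𝓘(𝕜, V) ∞ φ a) (hψ : ContMDiffAt I 𝓘(𝕜, V') ∞ ψ a) :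
    ContMDiffAt I 𝓘(𝕜, W) ∞ (fun b => B (φ b) (ψ b)) a :=
  ((contMDiffAt_const (c := B)).clm_apply hφ).clm_apply hψ

theorem ContMDiffAt.biBracket {κ : 𝕜} {B : (E →L[𝕜] 𝕜) →L[𝕜] (E →L[𝕜] 𝕜) →L[𝕜] 𝕜} {f g : G → 𝕜}
    {a : G} (hf : ContMDiffAt I 𝓘(𝕜, 𝕜) ∞ f a) (hg : ContMDiffAt I 𝓘(𝕜, 𝕜) ∞ g a) :
    ContMDiffAt I 𝓘(𝕜, 𝕜) ∞ (biBracket I κ B f g) a :=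
  (contMDiffAt_const.mul (contMDiffAt_bilinear B hf.lgrad hg.lgrad)).sub
    (contMDiffAt_bilinear B hf.rgrad hg.rgrad)

/-- The Jacobiator of a bracket `κ Λ^L - Λ^R`. -/
theorem biBracket_jacobi [CompleteSpace E] {κ : 𝕜}
    {B : (E →L[𝕜] 𝕜) →L[𝕜] (E →L[𝕜] 𝕜) →L[𝕜] 𝕜} {T : (E →L[𝕜] 𝕜) → E}
    (hT : ∀ α β, B α β = β (T α)) (hT' : ∀ α β, B α β = - α (T β)) {f g h : G → 𝕜} {a : G}
    (hf : ContMDiffAt I 𝓘(𝕜, 𝕜) ∞ f a) (hg : ContMDiffAt I 𝓘(𝕜, 𝕜) ∞ g a)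
    (hh : ContMDiffAt I 𝓘(𝕜, 𝕜) ∞ h a) :
    biBracket I κ B f (biBracket I κ B g h) a + biBracket I κ B g (biBracket I κ B h f) a +
      biBracket I κ B h (biBracket I κ B f g) a =
    κ * κ * (lgrad I h a (coordBracket I G (T (lgrad I f a)) (T (lgrad I g a))) +
        lgrad I f a (coordBracket I G (T (lgrad I g a)) (T (lgrad I h a))) +
        lgrad I g a (coordBracket I G (T (lgrad I h a)) (T (lgrad I f a)))) -
      (rgrad I h a (coordBracket I G (T (rgrad I f a)) (T (rgrad I g a))) +
        rgrad I f a (coordBracket I G (T (rgrad I g a)) (T (rgrad I h a))) +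
        rgrad I g a (coordBracket I G (T (rgrad I h a)) (T (rgrad I f a)))) := by
  -- By the Leibniz rule each double bracket is a sum of second derivatives along vectors `T (·)`;
  -- the two forms of `hT` free whichever gradient is being differentiated.
  have key : ∀ f g h : G → 𝕜, ContMDiffAt I 𝓘(𝕜, 𝕜) ∞ f a → ContMDiffAt I 𝓘(𝕜, 𝕜) ∞ g a →
      ContMDiffAt I 𝓘(𝕜, 𝕜) ∞ h a → biBracket I κ B f (biBracket I κ B g h) a =
      κ * (κ * (lgrad I (lgrad I h) a (T (lgrad I f a)) (T (lgrad I g a)) -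
          lgrad I (lgrad I g) a (T (lgrad I f a)) (T (lgrad I h a))) -
        (lgrad I (rgrad I h) a (T (lgrad I f a)) (T (rgrad I g a)) -
          lgrad I (rgrad I g) a (T (lgrad I f a)) (T (rgrad I h a)))) -
      (κ * (rgrad I (lgrad I h) a (T (rgrad I f a)) (T (lgrad I g a)) -
          rgrad I (lgrad I g) a (T (rgrad I f a)) (T (lgrad I h a))) -
        (rgrad I (rgrad I h) a (T (rgrad I f a)) (T (rgrad I g a)) -
          rgrad I (rgrad I g) a (T (rgrad I f a)) (T (rgrad I h a)))) := by
    intro f g h hf hg hh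
    have hgl := hg.lgrad.mdifferentiableAt (by simp)
    have hgr := hg.rgrad.mdifferentiableAt (by simp)
    have hhl := hh.lgrad.mdifferentiableAt (by simp)
    have hhr := hh.rgrad.mdifferentiableAt (by simp)
    have hl := (contMDiffAt_bilinear B hg.lgrad hh.lgrad).mdifferentiableAt (by simp)
    have hr := (contMDiffAt_bilinear B hg.rgrad hh.rgrad).mdifferentiableAt (by simp)
    have e : biBracket I κ B g h = fun b =>
      κ * B (lgrad I g b) (lgrad I h b) - B (rgrad I g b) (rgrad I h b) := rfl
    rw [biBracket, hT, hT, e, lgrad_const_mul_sub hl hr, rgrad_const_mul_sub hl hr,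
      lgrad_bilinear B hgl hhl, lgrad_bilinear B hgr hhr, rgrad_bilinear B hgl hhl,
      rgrad_bilinear B hgr hhr]
    rw [hT' _ (lgrad I h a), hT' _ (rgrad I h a), hT' _ (lgrad I h a), hT' _ (rgrad I h a),
      hT (lgrad I g a), hT (rgrad I g a), hT (lgrad I g a), hT (rgrad I g a)]
    ring
  have hLL : ∀ f : G → 𝕜, ContMDiffAt I 𝓘(𝕜, 𝕜) ∞ f a → ∀ v w,
      lgrad I f a (coordBracket I G v w) =
        lgrad I (lgrad I f) a v w - lgrad I (lgrad I f) a w v := fun f hf v w => by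
    have hl := hf.lgrad.mdifferentiableAt (by simp)
    rw [← lgrad_lgrad_sub hf, lgrad_apply_const hl, lgrad_apply_const hl]
  have hRR : ∀ f : G → 𝕜, ContMDiffAt I 𝓘(𝕜, 𝕜) ∞ f a → ∀ v w,
      rgrad I f a (coordBracket I G v w) =
        - (rgrad I (rgrad I f) a v w - rgrad I (rgrad I f) a w v) := fun f hf v w => by
    have hl := hf.rgrad.mdifferentiableAt (by simp)
    rw [← rgrad_apply_const hl, ← rgrad_apply_const hl, rgrad_rgrad_sub hf, neg_neg]
  have hLR : ∀ f : G → 𝕜, ContMDiffAt I 𝓘(𝕜, 𝕜) ∞ f a → ∀ v w,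
      rgrad I (lgrad I f) a v w = lgrad I (rgrad I f) a w v := fun f hf v w => by
    rw [← rgrad_apply_const (hf.lgrad.mdifferentiableAt (by simp)),
      ← lgrad_apply_const (hf.rgrad.mdifferentiableAt (by simp)), rgrad_lgrad_comm hf]
  -- In the cyclic sum the left-left and right-right terms pair up into commutators, and the mixed
  -- terms cancel by `hLR`.
  rw [key f g h hf hg hh, key g h f hg hh hf, key h f g hh hf hg, hLL f hf, hLL g hg, hLL h hh,
    hRR f hf, hRR g hg, hRR h hh]
  simp only [hLR f hf, hLR g hg, hLR h hh]
  ring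

end Jacobi

/-! ### The bracket defined by a Manin triple. -/

section InvariantBivectors

open Filter Topology Set

variable {𝕜 : Type*} [RCLike 𝕜] {E : Type*} [NormedAddCommGroup E] [NormedSpace 𝕜 E]
  [FiniteDimensional 𝕜 E]
  {H : Type*} [TopologicalSpace H] {I : ModelWithCorners 𝕜 E H}
  {G : Type*} [Group G] [TopologicalSpace G] [ChartedSpace H G]

variable (I G) in
/-- A continuous linear form on the model space as a linear form on the Lie algebra. -/
def covec (α : E →L[𝕜] 𝕜) : GroupLieAlgebra I G →ₗ[𝕜] 𝕜 where
  toFun v := α v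
  map_add' v w := α.map_add v w
  map_smul' c v := α.map_smul c v

/-- The bilinear form on covectors given by a `2`-tensor. -/
def tensorForm (L : GroupLieAlgebra I G ⊗[𝕜] GroupLieAlgebra I G) :
    (E →L[𝕜] 𝕜) →L[𝕜] (E →L[𝕜] 𝕜) →L[𝕜] 𝕜 :=
  LinearMap.toContinuousBilinearMap (LinearMap.mk₂ 𝕜
    (fun α β => tensorEval L (covec I G α) (covec I G β))
    (fun α α' β => by
      have : covec I G (α + α') = covec I G α + covec I G α' := rfl
      simp [tensorEval, this, TensorProduct.map_add_left])
    (fun c α β => by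
      have : covec I G (c • α) = c • covec I G α := rfl
      simp [tensorEval, this, TensorProduct.map_smul_left])
    (fun α β β' => by
      have : covec I G (β + β') = covec I G β + covec I G β' := rfl
      simp [tensorEval, this, TensorProduct.map_add_right])
    (fun c α β => by
      have : covec I G (c • β) = c • covec I G β := rfl
      simp [tensorEval, this, TensorProduct.map_smul_right]))

theorem tensorForm_apply (L : GroupLieAlgebra I G ⊗[𝕜] GroupLieAlgebra I G) (α β : E →L[𝕜] 𝕜) :
    tensorForm L α β = tensorEval L (covec I G α) (covec I G β) := rfl

variable [I.Boundaryless] [LieGroup I ∞ G] [CompleteSpace E]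

variable (M : ManinTriple 𝕜 (GroupLieAlgebra I G))

/-- The form of a Manin triple, on the model space. -/
def ManinTriple.coordForm : E →L[𝕜] E →L[𝕜] 𝕜 :=
  LinearMap.toContinuousBilinearMap (LinearMap.mk₂ 𝕜
    (fun v w : E => M.form (show GroupLieAlgebra I G from v) (show GroupLieAlgebra I G from w))
    (fun v v' w => LinearMap.congr_fun (M.form.map_add v v') w)
    (fun c v w => LinearMap.congr_fun (M.form.map_smul c v) w)
    (fun v w w' => (M.form v).map_add w w')
    (fun c v w => (M.form v).map_smul c w))

theorem ManinTriple.exists_coordForm_eq (α : E →L[𝕜] 𝕜) : ∃ a, M.coordForm a = α := by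
  obtain ⟨a, ha⟩ := M.exists_form_eq (covec I G α)
  exact ⟨a, ContinuousLinearMap.ext fun v => LinearMap.congr_fun ha v⟩

theorem ManinTriple.coordForm_coordAd [PreconnectedSpace G] (a : G) (v w : E) :
    M.coordForm (coordAd I a v) (coordAd I a w) = M.coordForm v w := by
  refine coordAd_invariant M.coordForm (fun u v w => ?_) a v w
  have h : ∀ u v w : GroupLieAlgebra I G, M.form ⁅u, v⁆ w + M.form v ⁅u, w⁆ = 0 := fun u v w => by
    rw [← lie_skew, map_neg, LinearMap.neg_apply, M.form_invariant, neg_add_cancel]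
  exact h u v w

/-- The map `T` sends `⟨a, ·⟩` to `-r a`; the sign is the skewness of `r`, as `T` contracts the
first factor. In the cyclic sum the two signs inside each bracket cancel, leaving `rOp_cyclic`. -/
theorem ManinTriple.exists_sharp : ∃ T : (E →L[𝕜] 𝕜) → E,
    (∀ α β, tensorForm M.Lam α β = β (T α)) ∧ (∀ α β, tensorForm M.Lam α β = - α (T β)) ∧
    ∀ a b c, M.coordForm c (coordBracket I G (T (M.coordForm a)) (T (M.coordForm b))) +
      M.coordForm a (coordBracket I G (T (M.coordForm b)) (T (M.coordForm c))) +
      M.coordForm b (coordBracket I G (T (M.coordForm c)) (T (M.coordForm a))) =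
      - ((2 : 𝕜)⁻¹ * (2 : 𝕜)⁻¹) * M.coordForm c (coordBracket I G a b) := by
  obtain ⟨T, hT⟩ := exists_tensorEval_eq M.Lam
  have hTa : ∀ a : GroupLieAlgebra I G, T (covec I G (M.coordForm a)) = - M.rOp a := by
    intro a
    have ha : covec I G (M.coordForm a) = M.form a := rfl
    rw [ha, eq_neg_iff_add_eq_zero]
    refine M.form_nondegenerate _ fun b => ?_
    rw [M.form_symm, map_add, ← hT, M.tensorEval_Lam, M.rOp_skew, M.form_symm b, neg_add_cancel]
  let S : (E →L[𝕜] 𝕜) → E := fun α => T (covec I G α)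
  have hS : ∀ a : GroupLieAlgebra I G, S (M.coordForm a) = (- M.rOp a : GroupLieAlgebra I G) := hTa
  refine ⟨S, fun α β => hT _ _, fun α β => ?_, fun a b c => ?_⟩
  · have h := congrArg (fun t => tensorEval t (covec I G α) (covec I G β)) M.comm_Lam
    simp only [tensorEval_comm, tensorEval_neg] at h
    rw [hT] at h
    exact neg_eq_iff_eq_neg.1 h.symm
  · have h := M.rOp_cyclic (𝕜 := 𝕜) a b c
    have e : ∀ u v w : GroupLieAlgebra I G,
        M.coordForm u (coordBracket I G (S (M.coordForm v)) (S (M.coordForm w))) =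
        M.form u ⁅M.rOp v, M.rOp w⁆ := fun u v w => by
      rw [hS, hS]
      have : ⁅-M.rOp v, -M.rOp w⁆ = ⁅M.rOp v, M.rOp w⁆ := by
        rw [neg_lie, lie_neg, neg_neg]
      exact congrArg (M.form u) this
    exact (congrArg₂ (· + ·) (congrArg₂ (· + ·) (e c a b) (e a b c)) (e b c a)).trans h

/-- Since the left gradient is the right one composed with `Ad x`, invariance of the form makes `Ad
x` act on the representing vector. -/
theorem ManinTriple.rgrad_eq_coordForm [PreconnectedSpace G] {f : G → 𝕜} {x : G}
    (hf : MDifferentiableAt I 𝓘(𝕜, 𝕜) f x) {a : E} (ha : M.coordForm a = lgrad I f x) :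
    rgrad I f x = M.coordForm (coordAd I x a) := by
  have h := lgrad_eq_rgrad_comp_coordAd hf
  rw [← ha] at h
  ext v
  have hv : coordAd I x (coordAd I x⁻¹ v) = v := by
    rw [← ContinuousLinearMap.comp_apply, ← coordAd_mul, mul_inv_cancel, coordAd_one]
    rfl
  have h1 := congrArg (fun A : E →L[𝕜] 𝕜 => A (coordAd I x⁻¹ v)) h
  simp only [ContinuousLinearMap.comp_apply, hv] at h1
  rw [← h1, ← M.coordForm_coordAd x, hv]

/-- The Jacobiator of the bracket `κ Λ^L - Λ^R` for the element `Λ` given by a Manin triple. -/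
theorem ManinTriple.biBracket_jacobi [PreconnectedSpace G] (κ : 𝕜) {f g h : G → 𝕜} {x : G}
    (hf : ContMDiffAt I 𝓘(𝕜, 𝕜) ∞ f x) (hg : ContMDiffAt I 𝓘(𝕜, 𝕜) ∞ g x)
    (hh : ContMDiffAt I 𝓘(𝕜, 𝕜) ∞ h x) {a b c : E} (ha : M.coordForm a = lgrad I f x)
    (hb : M.coordForm b = lgrad I g x) (hc : M.coordForm c = lgrad I h x) :
    biBracket I κ (tensorForm M.Lam) f (biBracket I κ (tensorForm M.Lam) g h) x +
      biBracket I κ (tensorForm M.Lam) g (biBracket I κ (tensorForm M.Lam) h f) x +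
      biBracket I κ (tensorForm M.Lam) h (biBracket I κ (tensorForm M.Lam) f g) x =
    (1 - κ * κ) * ((2 : 𝕜)⁻¹ * (2 : 𝕜)⁻¹ * M.coordForm c (coordBracket I G a b)) := by
  obtain ⟨T, hT, hT', hcyc⟩ := M.exists_sharp
  -- The right cubic term is the left one with `Ad x` applied to all three vectors; as `Ad x`
  -- respects bracket and form, both equal the same invariant trilinear expression.
  rw [_root_.biBracket_jacobi hT hT' hf hg hh,
    M.rgrad_eq_coordForm (hf.mdifferentiableAt (by simp)) ha,
    M.rgrad_eq_coordForm (hg.mdifferentiableAt (by simp)) hb,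
    M.rgrad_eq_coordForm (hh.mdifferentiableAt (by simp)) hc, ← ha, ← hb, ← hc, hcyc, hcyc,
    ← coordAd_coordBracket, M.coordForm_coordAd]
  ring

end InvariantBivectors

/-! ### Local sections of submersions. -/

section Submersions

open Filter Topology Set

variable {𝕜 : Type*} [RCLike 𝕜] {E : Type*} [NormedAddCommGroup E] [NormedSpace 𝕜 E]
  {H : Type*} [TopologicalSpace H] {I : ModelWithCorners 𝕜 E H}
  {X : Type*} [TopologicalSpace X] [ChartedSpace H X]
  {F : Type*} [NormedAddCommGroup F] [NormedSpace 𝕜 F]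
  {H' : Type*} [TopologicalSpace H'] {J : ModelWithCorners 𝕜 F H'}
  {Y : Type*} [TopologicalSpace Y] [ChartedSpace H' Y] {n : ℕ∞ω}
  {F' : Type*} [NormedAddCommGroup F'] [NormedSpace 𝕜 F']
  {H'' : Type*} [TopologicalSpace H''] {K : ModelWithCorners 𝕜 F' H''}
  {Z : Type*} [TopologicalSpace Z] [ChartedSpace H'' Z]

/-- A submersion has local sections. -/
theorem Manifold.IsSubmersionAt.exists_section [I.Boundaryless] [IsManifold I n X]
    [IsManifold J n Y] {p : X → Y} {x : X} (h : Manifold.IsSubmersionAt I J n p x) :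
    ∃ s : Y → X, s (p x) = x ∧ ContMDiffAt J I n s (p x) ∧ ∀ᶠ y in 𝓝 (p x), p (s y) = y := by
  set φ := h.domChart.extend I
  set ψ := h.codChart.extend J
  have hx : x ∈ φ.source := by simpa [φ] using h.mem_domChart_source
  have hy : p x ∈ ψ.source := by simpa [ψ] using h.mem_codChart_source
  have hpx : ψ (p x) = (h.equiv (φ x)).1 := by
    have := h.writtenInCharts (φ.map_source hx)
    change ψ (p (φ.symm (φ x))) = _ at this
    rwa [φ.left_inv hx] at this
  -- In adapted charts the submersion is the projection onto the first factor; the section keeps the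
  -- second coordinate of `x`.
  let c : Y → E := fun y => h.equiv.symm (ψ y, (h.equiv (φ x)).2)
  have hc0 : c (p x) = φ x := by simp [c, hpx]
  have hc : ContMDiffAt J 𝓘(𝕜, E) n c (p x) := by
    have h1 : ContMDiffAt J 𝓘(𝕜, F) n ψ (p x) :=
      OpenPartialHomeomorph.contMDiffAt_extend h.codChart_mem_maximalAtlas h.mem_codChart_source
    exact h.equiv.symm.contDiff.contMDiff.contMDiffAt.comp (p x) (h1.prodMk_space contMDiffAt_const)
  have htarget : φ.target ∈ 𝓝 (φ x) :=
    (h.domChart.isOpen_extend_target).mem_nhds (φ.map_source hx)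
  have hφ : ContMDiffAt 𝓘(𝕜, E) I n φ.symm (φ x) := by
    have h1 := contMDiffOn_extend_symm (I := I) h.domChart_mem_maximalAtlas
    refine h1.contMDiffAt ?_
    have e : φ.target = I '' h.domChart.target := by
      simp [φ, I.range_eq_univ, I.image_eq]
    rwa [← e]
  refine ⟨fun y => φ.symm (c y), ?_, ?_, ?_⟩
  · simp only [hc0, φ.left_inv hx]
  · exact ContMDiffAt.comp_of_eq (g := φ.symm) hφ hc hc0
  · have hsrc : h.codChart.source ∈ 𝓝 (p x) :=
      h.codChart.open_source.mem_nhds h.mem_codChart_source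
    have hcont := hc.continuousAt
    rw [ContinuousAt, hc0] at hcont
    filter_upwards [hcont htarget, hsrc] with y hy1 hy2
    have h2 := h.writtenInCharts hy1
    have h3 : ψ (p (φ.symm (c y))) = ψ y := by
      change ψ (p (φ.symm (c y))) = (h.equiv (c y)).1 at h2
      simpa only [c, ContinuousLinearEquiv.apply_symm_apply] using h2
    have h4 : p (φ.symm (c y)) ∈ h.codChart.source := by
      refine h.source_subset_preimage_source ?_
      have := φ.map_target hy1
      simpa [φ] using this
    exact ψ.injOn (by simpa [ψ] using h4) (by simpa [ψ] using hy2) h3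

/-- Smoothness can be checked after composition with a submersion. -/
theorem Manifold.IsSubmersionAt.contMDiffAt_of_comp [I.Boundaryless] [IsManifold I n X]
    [IsManifold J n Y] {p : X → Y} {x : X} (h : Manifold.IsSubmersionAt I J n p x) {f : Y → Z}
    (hf : ContMDiffAt I K n (fun x => f (p x)) x) : ContMDiffAt J K n f (p x) := by
  obtain ⟨s, hsx, hs, hps⟩ := h.exists_section
  have h1 := ContMDiffAt.comp_of_eq (g := fun x => f (p x)) hf hs hsx
  exact h1.congr_of_eventuallyEq (hps.mono fun y hy => congrArg f hy.symm)

end Submersions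

/-! ### Poisson brackets on the group in terms of invariant derivatives. -/

section Brackets

open Filter Topology Set

variable {𝕜 : Type*} [RCLike 𝕜] {E : Type*} [NormedAddCommGroup E] [NormedSpace 𝕜 E]
  [FiniteDimensional 𝕜 E]
  {H : Type*} [TopologicalSpace H] {I : ModelWithCorners 𝕜 E H}
  {G : Type*} [Group G] [TopologicalSpace G] [ChartedSpace H G]
  [I.Boundaryless] [LieGroup I ∞ G]
  {F : Type*} [NormedAddCommGroup F] [NormedSpace 𝕜 F]
  {H' : Type*} [TopologicalSpace H'] {J : ModelWithCorners 𝕜 F H'}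
  {Y : Type*} [TopologicalSpace Y] [ChartedSpace H' Y]

theorem poissonBracket_eq_tensorEval (π : TwoTensorField I G) (f g : G → 𝕜) (x : G) :
    poissonBracket I π f g x = tensorEval (π x) (differential I f x) (differential I g x) := rfl

/-- The chain rule for the derivative at the identity of a map out of the group. -/
theorem differential_comp_mfderiv {c : G → Y} {f : Y → 𝕜} (hc : MDifferentiableAt I J c 1)
    (hf : MDifferentiableAt J 𝓘(𝕜, 𝕜) f (c 1)) (v : GroupLieAlgebra I G) :
    differential J f (c 1) (mfderiv I J c 1 v) =
      fderiv 𝕜 (fun x => f (c (idChart I G x))) (idPt I G) v := by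
  have h1 : HasMFDerivAt 𝓘(𝕜, E) 𝓘(𝕜, 𝕜) (fun x => f (c (idChart I G x))) (idPt I G)
      ((mfderiv J 𝓘(𝕜, 𝕜) f (c 1) : F →L[𝕜] 𝕜).comp
        ((mfderiv I J c 1 : E →L[𝕜] F).comp (ContinuousLinearMap.id 𝕜 E))) := by
    refine HasMFDerivAt.comp (g := f) (I' := J) _ ?_
      (HasMFDerivAt.comp (g := c) (I' := I) _ ?_ (mfderiv_idChart I))
    · rw [idChart_idPt]
      exact hf.hasMFDerivAt
    · rw [idChart_idPt]
      exact hc.hasMFDerivAt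
  have h2 := hasMFDerivAt_unique h1
    ((h1.mdifferentiableAt.differentiableAt).hasFDerivAt.hasMFDerivAt)
  exact congrArg (fun A : E →L[𝕜] 𝕜 => A v) h2

theorem differential_comp_leftTranslation {f : G → 𝕜} {a : G}
    (hf : MDifferentiableAt I 𝓘(𝕜, 𝕜) f a) :
    differential I f a ∘ₗ leftTranslation I a = covec I G (lgrad I f a) := by
  refine LinearMap.ext fun v => ?_
  have h := differential_comp_mfderiv (c := fun b => a * b)
    ((contMDiff_mul_left (I := I) (n := ∞)).mdifferentiable (by simp) 1)
    (by simpa using hf) v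
  rw [mul_one] at h
  exact h

theorem differential_comp_rightTranslation {f : G → 𝕜} {a : G}
    (hf : MDifferentiableAt I 𝓘(𝕜, 𝕜) f a) :
    differential I f a ∘ₗ rightTranslation I a = covec I G (rgrad I f a) := by
  refine LinearMap.ext fun v => ?_
  have h := differential_comp_mfderiv (c := fun b => b * a)
    ((contMDiff_mul_right (I := I) (n := ∞)).mdifferentiable (by simp) 1)
    (by simpa using hf) v
  rw [one_mul] at h
  exact h

theorem poissonBracket_groupTensorField (L : GroupLieAlgebra I G ⊗[𝕜] GroupLieAlgebra I G)
    {f g : G → 𝕜} {a : G} (hf : MDifferentiableAt I 𝓘(𝕜, 𝕜) f a)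
    (hg : MDifferentiableAt I 𝓘(𝕜, 𝕜) g a) :
    poissonBracket I (groupTensorField I L) f g a = biBracket I 1 (tensorForm L) f g a := by
  rw [poissonBracket_eq_tensorEval, groupTensorField, tensorEval_sub]
  have h : ∀ t : GroupLieAlgebra I G →ₗ[𝕜] TangentSpace I a,
      tensorEval (TensorProduct.map t t L) (differential I f a) (differential I g a) =
      tensorEval L (differential I f a ∘ₗ t) (differential I g a ∘ₗ t) := fun t => by
    simp only [tensorEval, TensorProduct.map_comp, LinearMap.comp_apply]
  rw [h, h]
  simp only [differential_comp_leftTranslation, differential_comp_rightTranslation, hf, hg,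
    biBracket, tensorForm_apply, one_mul]

variable [MulAction G Y] {p : G → Y} (hp : ∀ a b, p (a * b) = a • p b)

end Brackets

/-! ### Tensor fields generated by velocities. -/

section TensorFieldMaps

open Filter Topology Set

variable {𝕜 : Type*} [NontriviallyNormedField 𝕜] {E : Type*} [NormedAddCommGroup E]
  [NormedSpace 𝕜 E] {H : Type*} [TopologicalSpace H] {I : ModelWithCorners 𝕜 E H}
  {G : Type*} [Group G] [TopologicalSpace G] [ChartedSpace H G]
  {F : Type*} [NormedAddCommGroup F] [NormedSpace 𝕜 F]
  {H' : Type*} [TopologicalSpace H'] {J : ModelWithCorners 𝕜 F H'}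
  {Y : Type*} [TopologicalSpace Y] [ChartedSpace H' Y]
  {F' : Type*} [NormedAddCommGroup F'] [NormedSpace 𝕜 F']
  {H'' : Type*} [TopologicalSpace H''] {K : ModelWithCorners 𝕜 F' H''}
  {Z : Type*} [TopologicalSpace Z] [ChartedSpace H'' Z]

theorem tensor_comm_map {V W : Type*} [AddCommGroup V] [Module 𝕜 V] [AddCommGroup W] [Module 𝕜 W]
    (f : V →ₗ[𝕜] W) (t : V ⊗[𝕜] V) :
    TensorProduct.comm 𝕜 W W (TensorProduct.map f f t) =
      TensorProduct.map f f (TensorProduct.comm 𝕜 V V t) := by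
  induction t with
  | zero => simp
  | add s t hs ht => simp [hs, ht]
  | tmul v w => simp

theorem tensor_map_map {U V W : Type*} [AddCommGroup U] [Module 𝕜 U] [AddCommGroup V] [Module 𝕜 V]
    [AddCommGroup W] [Module 𝕜 W] (g : V →ₗ[𝕜] W) (f : U →ₗ[𝕜] V) (t : U ⊗[𝕜] U) :
    TensorProduct.map g g (TensorProduct.map f f t) = TensorProduct.map (g ∘ₗ f) (g ∘ₗ f) t := by
  rw [TensorProduct.map_comp, LinearMap.comp_apply]

variable (I J) in
/-- The derivative at the identity of a map out of a Lie group, with values in the tangent space at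
a given point, the value of the map. -/
def velocity (c : G → Y) (y : Y) : GroupLieAlgebra I G →ₗ[𝕜] TangentSpace J y where
  toFun v := mfderiv I J c 1 v
  map_add' v w := (mfderiv I J c 1).map_add v w
  map_smul' r v := (mfderiv I J c 1).map_smul r v

/-- The hypothesis `c 1 = y` absorbs equalities such as `g * 1 = g`, which are not definitional and
would change the tangent space. -/
theorem mfderiv_comp_velocity {c : G → Y} {y : Y} {f : Y → Z} (hc : MDifferentiableAt I J c 1)
    (hy : c 1 = y) (hf : MDifferentiableAt J K f y) :
    (mfderiv J K f y).toLinearMap ∘ₗ velocity I J c y =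
      velocity I K (fun b => f (c b)) (f y) := by
  subst hy
  refine LinearMap.ext fun v => ?_
  have h := (hf.hasMFDerivAt.comp 1 hc.hasMFDerivAt).mfderiv
  exact (congrArg (fun A : E →L[𝕜] F' => A v) h).symm

theorem map_mfderiv_map_velocity {c : G → Y} {y : Y} {f : Y → Z} (hc : MDifferentiableAt I J c 1)
    (hy : c 1 = y) (hf : MDifferentiableAt J K f y)
    (L : GroupLieAlgebra I G ⊗[𝕜] GroupLieAlgebra I G) :
    TensorProduct.map (mfderiv J K f y).toLinearMap (mfderiv J K f y).toLinearMap
      (TensorProduct.map (velocity I J c y) (velocity I J c y) L) =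
    TensorProduct.map (velocity I K (fun b => f (c b)) (f y))
      (velocity I K (fun b => f (c b)) (f y)) L := by
  rw [tensor_map_map, mfderiv_comp_velocity hc hy hf]

theorem groupTensorField_eq_velocity (L : GroupLieAlgebra I G ⊗[𝕜] GroupLieAlgebra I G) (g : G) :
    groupTensorField I L g =
      TensorProduct.map (velocity I I (fun b => g * b) g) (velocity I I (fun b => g * b) g) L -
        TensorProduct.map (velocity I I (fun b => b * g) g) (velocity I I (fun b => b * g) g) L :=
  rfl

theorem actionTensorField_eq_velocity [MulAction G Y]
    (L : GroupLieAlgebra I G ⊗[𝕜] GroupLieAlgebra I G) (y : Y) :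
    actionTensorField I J Y L y =
      - TensorProduct.map (velocity I J (fun b : G => b • y) y)
        (velocity I J (fun b : G => b • y) y) L :=
  rfl

/-- The product tensor field has no mixed component, so only the two partial maps of `Φ` enter. -/
theorem map_prodTensorField {X : Type*} [TopologicalSpace X] [ChartedSpace H X] {Φ : Y × Z → X}
    {y : Y} {z : Z}
    (hΦ : MDifferentiableAt (J.prod K) I Φ (y, z)) (π : TwoTensorField J Y)
    (π' : TwoTensorField K Z) :
    TensorProduct.map (mfderiv (J.prod K) I Φ (y, z)).toLinearMap
      (mfderiv (J.prod K) I Φ (y, z)).toLinearMap (prodTensorField J K π π' (y, z)) =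
    TensorProduct.map (mfderiv J I (fun y => Φ (y, z)) y).toLinearMap
      (mfderiv J I (fun y => Φ (y, z)) y).toLinearMap (π y) +
    TensorProduct.map (mfderiv K I (fun z => Φ (y, z)) z).toLinearMap
      (mfderiv K I (fun z => Φ (y, z)) z).toLinearMap (π' z) := by
  have h1 := (HasMFDerivAt.comp (g := Φ) y hΦ.hasMFDerivAt
    (MDifferentiableAt.prodMk (I := J) (I' := J) (I'' := K) mdifferentiableAt_id
      (mdifferentiableAt_const (c := z))).hasMFDerivAt).mfderiv
  have h2 := (HasMFDerivAt.comp (g := Φ) z hΦ.hasMFDerivAt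
    (MDifferentiableAt.prodMk (I := K) (I' := J) (I'' := K) (mdifferentiableAt_const (c := y))
      mdifferentiableAt_id).hasMFDerivAt).mfderiv
  have e1 : (mfderiv J I (fun y => Φ (y, z)) y).toLinearMap =
    (mfderiv (J.prod K) I Φ (y, z)).toLinearMap ∘ₗ
      (mfderiv J (J.prod K) (fun y => (y, z)) y).toLinearMap := congrArg (·.toLinearMap) h1
  have e2 : (mfderiv K I (fun z => Φ (y, z)) z).toLinearMap =
    (mfderiv (J.prod K) I Φ (y, z)).toLinearMap ∘ₗ
      (mfderiv K (J.prod K) (fun z => (y, z)) z).toLinearMap := congrArg (·.toLinearMap) h2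
  rw [prodTensorField, map_add, e1, e2, ← tensor_map_map, ← tensor_map_map]

end TensorFieldMaps

/-! ### Compatibility of multiplication and action with the tensor fields. -/

section LieGroups

open Filter Topology Set

variable {𝕜 : Type*} [RCLike 𝕜] {E : Type*} [NormedAddCommGroup E]
  [NormedSpace 𝕜 E] {H : Type*} [TopologicalSpace H] {I : ModelWithCorners 𝕜 E H}
  {G : Type*} [Group G] [TopologicalSpace G] [ChartedSpace H G] [LieGroup I ∞ G]

/-- The multiplication of a Lie group is compatible with `Λ^L - Λ^R`. -/
theorem isPoissonMap_mul (L : GroupLieAlgebra I G ⊗[𝕜] GroupLieAlgebra I G) :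
    IsPoissonMap (I.prod I) I (prodTensorField I I (groupTensorField I L) (groupTensorField I L))
      (groupTensorField I L) (fun p : G × G => p.1 * p.2) where
  contMDiff := contMDiff_mul I ∞
  map_eq := by
    rintro ⟨g, h⟩
    have hl : ∀ g : G, MDifferentiable I I (fun b => g * b) := fun g =>
      (contMDiff_mul_left (I := I) (n := ∞)).mdifferentiable (by simp)
    have hr : ∀ g : G, MDifferentiable I I (fun b => b * g) := fun g =>
      (contMDiff_mul_right (I := I) (n := ∞)).mdifferentiable (by simp)
    rw [map_prodTensorField ((contMDiff_mul I ∞).mdifferentiable (by simp) _)]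
    have hll := map_mfderiv_map_velocity (f := fun b => g * b) (hl h 1) (mul_one h) (hl g h) L
    have hlr := map_mfderiv_map_velocity (f := fun b => g * b) (hr h 1) (one_mul h) (hl g h) L
    have hrl := map_mfderiv_map_velocity (f := fun b => b * h) (hl g 1) (mul_one g) (hr h g) L
    have hrr := map_mfderiv_map_velocity (f := fun b => b * h) (hr g 1) (one_mul g) (hr h g) L
    simp only [groupTensorField_eq_velocity, map_sub]
    -- The curve `b ↦ g * b * h` occurs twice, with opposite signs; `g * h * b` and `b * g * h`
    -- remain.
    refine (congrArg₂ (· + ·) (congrArg₂ (· - ·) hrl hrr) (congrArg₂ (· - ·) hll hlr)).trans ?_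
    simp only [mul_assoc]
    abel

/-- A smooth action is compatible with `Λ^L - Λ^R` and `-σ(Λ)`. -/
theorem isPoissonMap_smul {F : Type*} [NormedAddCommGroup F] [NormedSpace 𝕜 F]
    {H' : Type*} [TopologicalSpace H'] {J : ModelWithCorners 𝕜 F H'}
    {Y : Type*} [TopologicalSpace Y] [ChartedSpace H' Y] [MulAction G Y]
    (hact : ContMDiff (I.prod J) J ∞ (fun p : G × Y => p.1 • p.2))
    (L : GroupLieAlgebra I G ⊗[𝕜] GroupLieAlgebra I G) :
    IsPoissonMap (I.prod J) J (prodTensorField I J (groupTensorField I L)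
      (actionTensorField I J Y L)) (actionTensorField I J Y L) (fun p : G × Y => p.1 • p.2) where
  contMDiff := hact
  map_eq := by
    rintro ⟨g, y⟩
    have hl : ∀ g : G, MDifferentiable I I (fun b => g * b) := fun g =>
      (contMDiff_mul_left (I := I) (n := ∞)).mdifferentiable (by simp)
    have hr : ∀ g : G, MDifferentiable I I (fun b => b * g) := fun g =>
      (contMDiff_mul_right (I := I) (n := ∞)).mdifferentiable (by simp)
    have ho : ∀ y : Y, MDifferentiable I J (fun b : G => b • y) := fun y =>
      ContMDiff.mdifferentiable
        (hact.comp (contMDiff_id.prodMk contMDiff_const)) (by simp)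
    have ha : ∀ g : G, MDifferentiable J J (fun y : Y => g • y) := fun g =>
      ContMDiff.mdifferentiable
        (hact.comp (contMDiff_const.prodMk contMDiff_id)) (by simp)
    rw [map_prodTensorField (hact.mdifferentiable (by simp) _)]
    have hol := map_mfderiv_map_velocity (f := fun b : G => b • y) (hl g 1) (mul_one g) (ho y g) L
    have hor := map_mfderiv_map_velocity (f := fun b : G => b • y) (hr g 1) (one_mul g) (ho y g) L
    have hao := map_mfderiv_map_velocity (f := fun y : Y => g • y) (ho y 1) (one_smul G y)
      (ha g y) L
    simp only [groupTensorField_eq_velocity, actionTensorField_eq_velocity, map_sub, map_neg]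
    -- The terms of `b ↦ (g * b) • y` cancel; the curve `b ↦ b • (g • y)` remains, with a minus
    -- sign.
    refine (congrArg₂ (· + ·) (congrArg₂ (· - ·) hol hor) (congrArg (- ·) hao)).trans ?_
    simp only [mul_smul]
    abel

end LieGroups

/-! ### Poisson Lie groups and Poisson homogeneous spaces. -/

section PoissonStructures

open Filter Topology Set

variable {𝕜 : Type*} [RCLike 𝕜] {E : Type*} [NormedAddCommGroup E] [NormedSpace 𝕜 E]
  [FiniteDimensional 𝕜 E]
  {H : Type*} [TopologicalSpace H] {I : ModelWithCorners 𝕜 E H}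
  {G : Type*} [Group G] [TopologicalSpace G] [ChartedSpace H G]
  [I.Boundaryless] [LieGroup I ∞ G]

theorem biBracket_congr {κ : 𝕜} {B : (E →L[𝕜] 𝕜) →L[𝕜] (E →L[𝕜] 𝕜) →L[𝕜] 𝕜} {f g g' : G → 𝕜}
    {a : G} (h : g =ᶠ[𝓝 a] g') : biBracket I κ B f g a = biBracket I κ B f g' a := by
  rw [biBracket, biBracket, lgrad_congr h, rgrad_congr h]

/-- Agreement of germs is needed because the inner bracket is differentiated again in the Jacobi
identity. -/
theorem eventually_poissonBracket_groupTensorField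
    (L : GroupLieAlgebra I G ⊗[𝕜] GroupLieAlgebra I G) {f g : G → 𝕜} {a : G}
    (hf : ContMDiffAt I 𝓘(𝕜, 𝕜) ∞ f a) (hg : ContMDiffAt I 𝓘(𝕜, 𝕜) ∞ g a) :
    poissonBracket I (groupTensorField I L) f g =ᶠ[𝓝 a] biBracket I 1 (tensorForm L) f g := by
  filter_upwards [eventually_mdifferentiableAt hf, eventually_mdifferentiableAt hg] with b hb hb'
  exact poissonBracket_groupTensorField L hb hb'

theorem contMDiffAt_poissonBracket_groupTensorField
    (L : GroupLieAlgebra I G ⊗[𝕜] GroupLieAlgebra I G) {f g : G → 𝕜} {a : G}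
    (hf : ContMDiffAt I 𝓘(𝕜, 𝕜) ∞ f a) (hg : ContMDiffAt I 𝓘(𝕜, 𝕜) ∞ g a) :
    ContMDiffAt I 𝓘(𝕜, 𝕜) ∞ (poissonBracket I (groupTensorField I L) f g) a :=
  (hf.biBracket hg).congr_of_eventuallyEq (eventually_poissonBracket_groupTensorField L hf hg)

theorem poissonBracket_poissonBracket_groupTensorField
    (L : GroupLieAlgebra I G ⊗[𝕜] GroupLieAlgebra I G) {f g h : G → 𝕜} {a : G}
    (hf : ContMDiffAt I 𝓘(𝕜, 𝕜) ∞ f a) (hg : ContMDiffAt I 𝓘(𝕜, 𝕜) ∞ g a)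
    (hh : ContMDiffAt I 𝓘(𝕜, 𝕜) ∞ h a) :
    poissonBracket I (groupTensorField I L) f (poissonBracket I (groupTensorField I L) g h) a =
      biBracket I 1 (tensorForm L) f (biBracket I 1 (tensorForm L) g h) a := by
  rw [poissonBracket_groupTensorField L (hf.mdifferentiableAt (by simp))
    ((contMDiffAt_poissonBracket_groupTensorField L hg hh).mdifferentiableAt (by simp)),
    biBracket_congr (eventually_poissonBracket_groupTensorField L hg hh)]

theorem comm_groupTensorField {L : GroupLieAlgebra I G ⊗[𝕜] GroupLieAlgebra I G}
    (hL : TensorProduct.comm 𝕜 _ _ L = - L) (a : G) :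
    TensorProduct.comm 𝕜 _ _ (groupTensorField I L a) = - groupTensorField I L a := by
  rw [groupTensorField, map_sub, tensor_comm_map, tensor_comm_map, hL, map_neg, map_neg]
  abel

theorem comm_actionTensorField {F : Type*} [NormedAddCommGroup F] [NormedSpace 𝕜 F]
    {H' : Type*} [TopologicalSpace H'] {J : ModelWithCorners 𝕜 F H'}
    {Y : Type*} [TopologicalSpace Y] [ChartedSpace H' Y] [MulAction G Y]
    {L : GroupLieAlgebra I G ⊗[𝕜] GroupLieAlgebra I G}
    (hL : TensorProduct.comm 𝕜 _ _ L = - L) (y : Y) :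
    TensorProduct.comm 𝕜 _ _ (actionTensorField I J Y L y) = - actionTensorField I J Y L y := by
  rw [actionTensorField, map_neg, tensor_comm_map, hL, map_neg]

variable [CompleteSpace E]

/-- Here `κ = 1`, so the factor `1 - κ²` of the Jacobiator vanishes. -/
theorem isPoissonStructure_groupTensorField [PreconnectedSpace G]
    (M : ManinTriple 𝕜 (GroupLieAlgebra I G)) :
    IsPoissonStructure I (groupTensorField I M.Lam) where
  skew := comm_groupTensorField M.comm_Lam
  smooth U f g hU hf hg x hx :=
    (contMDiffAt_poissonBracket_groupTensorField M.Lam (hf.contMDiffAt (hU.mem_nhds hx))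
      (hg.contMDiffAt (hU.mem_nhds hx))).contMDiffWithinAt
  jacobi U f g h hU hf hg hh x hx := by
    have hf := hf.contMDiffAt (hU.mem_nhds hx)
    have hg := hg.contMDiffAt (hU.mem_nhds hx)
    have hh := hh.contMDiffAt (hU.mem_nhds hx)
    obtain ⟨a, ha⟩ := M.exists_coordForm_eq (lgrad I f x)
    obtain ⟨b, hb⟩ := M.exists_coordForm_eq (lgrad I g x)
    obtain ⟨c, hc⟩ := M.exists_coordForm_eq (lgrad I h x)
    rw [poissonBracket_poissonBracket_groupTensorField _ hf hg hh,
      poissonBracket_poissonBracket_groupTensorField _ hg hh hf,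
      poissonBracket_poissonBracket_groupTensorField _ hh hf hg,
      M.biBracket_jacobi 1 hf hg hh ha hb hc]
    ring

theorem isPoissonLieGroup_groupTensorField [PreconnectedSpace G]
    (M : ManinTriple 𝕜 (GroupLieAlgebra I G)) :
    IsPoissonLieGroup I (groupTensorField I M.Lam) where
  poisson := isPoissonStructure_groupTensorField M
  mul := isPoissonMap_mul M.Lam

/-! ### Homogeneous spaces -/

/-- The derivative of a function along a one-parameter subgroup on which it is constant. -/
theorem lgrad_eq_zero_of_mem_lieAlgebraOfSubgroup {Q : Subgroup G} {f : G → 𝕜} {a : G}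
    (hf : MDifferentiableAt I 𝓘(𝕜, 𝕜) f a) (hQ : ∀ q ∈ Q, f (a * q) = f a)
    {v : GroupLieAlgebra I G} (hv : v ∈ lieAlgebraOfSubgroup I Q) : lgrad I f a v = 0 := by
  obtain ⟨γ, hγ, hadd, hmem, rfl⟩ := hv
  have h0 : γ 0 = 1 := by
    have := hadd 0 0
    simpa using this
  have h1 : MDifferentiableAt I 𝓘(𝕜, 𝕜) (fun b => f (a * b)) 1 :=
    MDifferentiableAt.comp_of_eq (g := f) (hy := mul_one a) (hg := hf)
      (hf := (contMDiff_mul_left (I := I) (n := ∞)).mdifferentiable (by simp) 1)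
  have h2 : HasMFDerivAt 𝓘(𝕜, E) 𝓘(𝕜, 𝕜) (fun x => f (a * idChart I G x)) (idPt I G)
      ((mfderiv I 𝓘(𝕜, 𝕜) (fun b => f (a * b)) 1 : E →L[𝕜] 𝕜).comp
        (ContinuousLinearMap.id 𝕜 E)) := by
    refine HasMFDerivAt.comp (g := fun b => f (a * b)) (I' := I) _ ?_ (mfderiv_idChart I)
    rw [idChart_idPt]
    exact h1.hasMFDerivAt
  have h3 := hasMFDerivAt_unique h2
    ((h2.mdifferentiableAt.differentiableAt).hasFDerivAt.hasMFDerivAt)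
  have h4 : HasMFDerivAt 𝓘(𝕜, 𝕜) 𝓘(𝕜, 𝕜) (fun t => f (a * γ t)) 0
      ((mfderiv I 𝓘(𝕜, 𝕜) (fun b => f (a * b)) 1 : E →L[𝕜] 𝕜).comp
        (mfderiv 𝓘(𝕜, 𝕜) I γ 0 : 𝕜 →L[𝕜] E)) := by
    refine HasMFDerivAt.comp (g := fun b => f (a * b)) (I' := I) _ ?_
      (hγ.mdifferentiable (by simp) 0).hasMFDerivAt
    rw [h0]
    exact h1.hasMFDerivAt
  have h5 : HasMFDerivAt 𝓘(𝕜, 𝕜) 𝓘(𝕜, 𝕜) (fun t => f (a * γ t)) 0 (0 : 𝕜 →L[𝕜] 𝕜) := by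
    have e : (fun t => f (a * γ t)) = fun _ => f a := funext fun t => hQ _ (hmem t)
    rw [e]
    exact hasMFDerivAt_const _ _
  refine (congrArg (fun A : E →L[𝕜] 𝕜 => A (mfderiv 𝓘(𝕜, 𝕜) I γ 0
    ((NormedSpace.fromTangentSpace (𝕜 := 𝕜) (0 : 𝕜)).symm 1))) h3).symm.trans ?_
  exact congrArg (fun A : 𝕜 →L[𝕜] 𝕜 => A ((NormedSpace.fromTangentSpace (𝕜 := 𝕜) (0 : 𝕜)).symm 1))
    (hasMFDerivAt_unique h4 h5)

variable {F : Type*} [NormedAddCommGroup F] [NormedSpace 𝕜 F]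
  {H' : Type*} [TopologicalSpace H'] {J : ModelWithCorners 𝕜 F H'}
  {Y : Type*} [TopologicalSpace Y] [ChartedSpace H' Y] [IsManifold J ∞ Y] [MulAction G Y]
  {p : G → Y}

theorem contMDiff_orbit (hp : ∀ a b, p (a * b) = a • p b) (hsub : Manifold.IsSubmersion I J ∞ p)
    (a : G) : ContMDiff I J ∞ (fun b : G => b • p a) := by
  simp only [← hp]
  exact hsub.contMDiff.comp contMDiff_mul_right

/-- The action on a homogeneous space is smooth. -/
theorem contMDiff_smul_of_isSubmersion (hp : ∀ a b, p (a * b) = a • p b)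
    (hsurj : Function.Surjective p) (hsub : Manifold.IsSubmersion I J ∞ p) :
    ContMDiff (I.prod J) J ∞ (fun q : G × Y => q.1 • q.2) := by
  rintro ⟨a, y⟩
  obtain ⟨b, rfl⟩ := hsurj y
  have : IsManifold I ∞ G := inferInstance
  -- With a local section `s`, the action is locally `(g, y) ↦ p (g * s y)`.
  obtain ⟨s, hsb, hs, hps⟩ := (hsub.isSubmersionAt b).exists_section
  have h1 : ContMDiffAt (I.prod J) J ∞ (fun q : G × Y => p (q.1 * s q.2)) (a, p b) :=
    hsub.contMDiff.contMDiffAt.comp (a, p b)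
      (contMDiffAt_fst.mul (hs.comp (a, p b) contMDiffAt_snd))
  refine h1.congr_of_eventuallyEq ?_
  have : Tendsto (fun q : G × Y => q.2) (𝓝 (a, p b)) (𝓝 (p b)) := continuous_snd.tendsto _
  filter_upwards [this.eventually hps] with q hq
  rw [hp, hq]

/-- Equivariance of `p` makes the generating field of the action the image of the right-invariant
field. -/
theorem differential_comp_infinitesimalAction (hp : ∀ a b, p (a * b) = a • p b)
    (hsub : Manifold.IsSubmersion I J ∞ p) {f : Y → 𝕜} {a : G}
    (hf : MDifferentiableAt J 𝓘(𝕜, 𝕜) f (p a)) :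
    differential J f (p a) ∘ₗ infinitesimalAction I J (p a) =
      covec I G (rgrad I (fun b => f (p b)) a) := by
  refine LinearMap.ext fun v => ?_
  have h := differential_comp_mfderiv (c := fun b : G => b • p a)
    ((contMDiff_orbit hp hsub a).mdifferentiable (by simp) 1) (by simpa using hf) v
  rw [one_smul] at h
  refine h.trans ?_
  change fderiv 𝕜 (fun x => f (idChart I G x • p a)) (idPt I G) v =
    fderiv 𝕜 (fun x => f (p (idChart I G x * a))) (idPt I G) v
  simp only [hp]

/-- On lifted functions `-σ(Λ)` acts as `-Λ^R`, the case `κ = 0`. -/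
theorem poissonBracket_actionTensorField (hp : ∀ a b, p (a * b) = a • p b)
    (hsub : Manifold.IsSubmersion I J ∞ p)
    (L : GroupLieAlgebra I G ⊗[𝕜] GroupLieAlgebra I G) {f g : Y → 𝕜} {a : G}
    (hf : MDifferentiableAt J 𝓘(𝕜, 𝕜) f (p a)) (hg : MDifferentiableAt J 𝓘(𝕜, 𝕜) g (p a)) :
    poissonBracket J (actionTensorField I J Y L) f g (p a) =
      biBracket I 0 (tensorForm L) (fun b => f (p b)) (fun b => g (p b)) a := by
  have h : ∀ t : GroupLieAlgebra I G →ₗ[𝕜] TangentSpace J (p a),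
      tensorEval (TensorProduct.map t t L) (differential J f (p a)) (differential J g (p a)) =
      tensorEval L (differential J f (p a) ∘ₗ t) (differential J g (p a) ∘ₗ t) := fun t => by
    simp only [tensorEval, TensorProduct.map_comp, LinearMap.comp_apply]
  have e : poissonBracket J (actionTensorField I J Y L) f g (p a) =
    tensorEval (actionTensorField I J Y L (p a)) (differential J f (p a))
      (differential J g (p a)) := rfl
  rw [e, actionTensorField, tensorEval_neg, h,
    differential_comp_infinitesimalAction hp hsub hf,
    differential_comp_infinitesimalAction hp hsub hg, biBracket, zero_mul, zero_sub,
    tensorForm_apply]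

theorem eventually_mdifferentiableAt_comp (hsub : Manifold.IsSubmersion I J ∞ p) {f : Y → 𝕜}
    {a : G} (hf : ContMDiffAt J 𝓘(𝕜, 𝕜) ∞ f (p a)) :
    ∀ᶠ b in 𝓝 a, MDifferentiableAt J 𝓘(𝕜, 𝕜) f (p b) := by
  have : IsManifold J 1 Y := IsManifold.of_le (n := ∞) (by simp)
  have h : ∀ᶠ y in 𝓝 (p a), MDifferentiableAt J 𝓘(𝕜, 𝕜) f y :=
    ((contMDiffAt_iff_contMDiffAt_nhds (by simp)).1 (hf.of_le (m := 1) (by simp))).mono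
      fun a ha => ha.mdifferentiableAt one_ne_zero
  exact hsub.contMDiff.continuous.continuousAt.eventually h

theorem eventually_poissonBracket_actionTensorField (hp : ∀ a b, p (a * b) = a • p b)
    (hsub : Manifold.IsSubmersion I J ∞ p)
    (L : GroupLieAlgebra I G ⊗[𝕜] GroupLieAlgebra I G) {f g : Y → 𝕜} {a : G}
    (hf : ContMDiffAt J 𝓘(𝕜, 𝕜) ∞ f (p a)) (hg : ContMDiffAt J 𝓘(𝕜, 𝕜) ∞ g (p a)) :
    (fun b => poissonBracket J (actionTensorField I J Y L) f g (p b)) =ᶠ[𝓝 a]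
      biBracket I 0 (tensorForm L) (fun b => f (p b)) (fun b => g (p b)) := by
  filter_upwards [eventually_mdifferentiableAt_comp hsub hf,
    eventually_mdifferentiableAt_comp hsub hg] with b hb hb'
  exact poissonBracket_actionTensorField hp hsub L hb hb'

theorem contMDiffAt_comp_isSubmersion (hsub : Manifold.IsSubmersion I J ∞ p) {f : Y → 𝕜} {a : G}
    (hf : ContMDiffAt J 𝓘(𝕜, 𝕜) ∞ f (p a)) : ContMDiffAt I 𝓘(𝕜, 𝕜) ∞ (fun b => f (p b)) a :=
  hf.comp a hsub.contMDiff.contMDiffAt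

theorem contMDiffAt_poissonBracket_actionTensorField (hp : ∀ a b, p (a * b) = a • p b)
    (hsub : Manifold.IsSubmersion I J ∞ p)
    (L : GroupLieAlgebra I G ⊗[𝕜] GroupLieAlgebra I G) {f g : Y → 𝕜} {a : G}
    (hf : ContMDiffAt J 𝓘(𝕜, 𝕜) ∞ f (p a)) (hg : ContMDiffAt J 𝓘(𝕜, 𝕜) ∞ g (p a)) :
    ContMDiffAt J 𝓘(𝕜, 𝕜) ∞ (poissonBracket J (actionTensorField I J Y L) f g) (p a) := by
  have : IsManifold I ∞ G := inferInstance
  refine (hsub.isSubmersionAt a).contMDiffAt_of_comp ?_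
  exact ((contMDiffAt_comp_isSubmersion hsub hf).biBracket
    (contMDiffAt_comp_isSubmersion hsub hg)).congr_of_eventuallyEq
      (eventually_poissonBracket_actionTensorField hp hsub L hf hg)

theorem poissonBracket_poissonBracket_actionTensorField (hp : ∀ a b, p (a * b) = a • p b)
    (hsub : Manifold.IsSubmersion I J ∞ p)
    (L : GroupLieAlgebra I G ⊗[𝕜] GroupLieAlgebra I G) {f g h : Y → 𝕜} {a : G}
    (hf : ContMDiffAt J 𝓘(𝕜, 𝕜) ∞ f (p a)) (hg : ContMDiffAt J 𝓘(𝕜, 𝕜) ∞ g (p a))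
    (hh : ContMDiffAt J 𝓘(𝕜, 𝕜) ∞ h (p a)) :
    poissonBracket J (actionTensorField I J Y L) f
        (poissonBracket J (actionTensorField I J Y L) g h) (p a) =
      biBracket I 0 (tensorForm L) (fun b => f (p b))
        (biBracket I 0 (tensorForm L) (fun b => g (p b)) (fun b => h (p b))) a := by
  rw [poissonBracket_actionTensorField hp hsub L (hf.mdifferentiableAt (by simp))
    ((contMDiffAt_poissonBracket_actionTensorField hp hsub L hg hh).mdifferentiableAt (by simp)),
    biBracket_congr (eventually_poissonBracket_actionTensorField hp hsub L hg hh)]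

/-- The bivector field `-σ(Λ)` on a homogeneous space whose stabilizer satisfies
`[𝔮^⊥, 𝔮^⊥] ⊂ 𝔮` is Poisson. -/
theorem isPoissonStructure_actionTensorField [PreconnectedSpace G]
    {M : ManinTriple 𝕜 (GroupLieAlgebra I G)} {Q : Subgroup G}
    (hQ : M.IsAdmissible (lieAlgebraOfSubgroup I Q)) (hp : ∀ a b, p (a * b) = a • p b)
    (hpQ : ∀ a, ∀ q ∈ Q, p (a * q) = p a)
    (hsurj : Function.Surjective p) (hsub : Manifold.IsSubmersion I J ∞ p) :
    IsPoissonStructure J (actionTensorField I J Y M.Lam) where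
  skew := comm_actionTensorField M.comm_Lam
  smooth U f g hU hf hg y hy := by
    obtain ⟨x, rfl⟩ := hsurj y
    exact (contMDiffAt_poissonBracket_actionTensorField hp hsub M.Lam
      (hf.contMDiffAt (hU.mem_nhds hy)) (hg.contMDiffAt (hU.mem_nhds hy))).contMDiffWithinAt
  jacobi U f g h hU hf hg hh y hy := by
    obtain ⟨x, rfl⟩ := hsurj y
    have hf := hf.contMDiffAt (hU.mem_nhds hy)
    have hg := hg.contMDiffAt (hU.mem_nhds hy)
    have hh := hh.contMDiffAt (hU.mem_nhds hy)
    have hf' := contMDiffAt_comp_isSubmersion hsub hf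
    have hg' := contMDiffAt_comp_isSubmersion hsub hg
    have hh' := contMDiffAt_comp_isSubmersion hsub hh
    obtain ⟨a, ha⟩ := M.exists_coordForm_eq (lgrad I (fun b => f (p b)) x)
    obtain ⟨b, hb⟩ := M.exists_coordForm_eq (lgrad I (fun b => g (p b)) x)
    obtain ⟨c, hc⟩ := M.exists_coordForm_eq (lgrad I (fun b => h (p b)) x)
    have horth : ∀ (f : Y → 𝕜) (a : E), ContMDiffAt I 𝓘(𝕜, 𝕜) ∞ (fun b => f (p b)) x →
        M.coordForm a = lgrad I (fun b => f (p b)) x →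
        ∀ v ∈ lieAlgebraOfSubgroup I Q, M.coordForm a v = 0 := by
      intro f a hf ha v hv
      rw [ha]
      exact lgrad_eq_zero_of_mem_lieAlgebraOfSubgroup (hf.mdifferentiableAt (by simp))
        (fun q hq => by simp only [hpQ x q hq]) hv
    -- All three representing vectors lie in `𝔮^⊥`, as lifted functions are constant along `Q`.
    -- Admissibility puts `[a, b]` into `𝔮`, to which `c` is orthogonal.
    have hab := hQ a b (horth f a hf' ha) (horth g b hg' hb)
    have h0 : M.coordForm c (coordBracket I G a b) = 0 := horth h c hh' hc _ hab
    rw [poissonBracket_poissonBracket_actionTensorField hp hsub _ hf hg hh,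
      poissonBracket_poissonBracket_actionTensorField hp hsub _ hg hh hf,
      poissonBracket_poissonBracket_actionTensorField hp hsub _ hh hf hg,
      M.biBracket_jacobi 0 hf' hg' hh' ha hb hc, h0]
    ring

theorem isPoissonHomogeneousSpace_actionTensorField [PreconnectedSpace G]
    {M : ManinTriple 𝕜 (GroupLieAlgebra I G)} {Q : Subgroup G}
    (hQ : M.IsAdmissible (lieAlgebraOfSubgroup I Q)) (hp : ∀ a b, p (a * b) = a • p b)
    (hpQ : ∀ a, ∀ q ∈ Q, p (a * q) = p a)
    (hsurj : Function.Surjective p) (hsub : Manifold.IsSubmersion I J ∞ p) :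
    IsPoissonHomogeneousSpace I J (groupTensorField I M.Lam) (actionTensorField I J Y M.Lam) where
  poissonLieGroup := isPoissonLieGroup_groupTensorField M
  poisson := isPoissonStructure_actionTensorField hQ hp hpQ hsurj hsub
  transitive := ⟨fun y z => by
    obtain ⟨a, rfl⟩ := hsurj y
    obtain ⟨b, rfl⟩ := hsurj z
    exact ⟨b * a⁻¹, by rw [← hp, inv_mul_cancel_right]⟩⟩
  action := isPoissonMap_smul (contMDiff_smul_of_isSubmersion hp hsurj hsub) M.Lam

end PoissonStructures

/-! ### Poisson isomorphisms induced by group isomorphisms. -/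

section PoissonIsomorphisms

open Filter Topology Set

variable {𝕜 : Type*} [NontriviallyNormedField 𝕜]
  {E : Type*} [NormedAddCommGroup E] [NormedSpace 𝕜 E] {H : Type*} [TopologicalSpace H]
  {I : ModelWithCorners 𝕜 E H}
  {E' : Type*} [NormedAddCommGroup E'] [NormedSpace 𝕜 E'] {H' : Type*} [TopologicalSpace H']
  {J : ModelWithCorners 𝕜 E' H'}
  {X : Type*} [TopologicalSpace X] [ChartedSpace H X]
  {Y : Type*} [TopologicalSpace Y] [ChartedSpace H' Y]

/-- A diffeomorphism that is a Poisson map is a Poisson isomorphism. -/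
theorem IsPoissonMap.isPoissonIso {π : TwoTensorField I X} {π' : TwoTensorField J Y} {φ : X ≃ Y}
    (h : IsPoissonMap I J π π' φ) (hφ : ContMDiff J I ∞ φ.symm) : IsPoissonIso I J π π' φ where
  toFun := h
  invFun :=
    { contMDiff := hφ
      map_eq := fun y => by
        obtain ⟨x, rfl⟩ := φ.surjective y
        have h1 := HasMFDerivAt.comp (g := φ.symm) (I' := J) x
          (hφ.mdifferentiable (by simp) (φ x)).hasMFDerivAt
          (h.contMDiff.mdifferentiable (by simp) x).hasMFDerivAt
        have e : φ.symm ∘ φ = id := funext φ.symm_apply_apply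
        rw [e] at h1
        have h2 := hasMFDerivAt_unique h1 (hasMFDerivAt_id x)
        rw [← h.map_eq, tensor_map_map]
        -- The points `x` and `φ.symm (φ x)` are equal but not definitionally, so their tangent
        -- spaces are compared through a general `z`.
        have key : ∀ z : X, x = z → ∀ t : TangentSpace I x →ₗ[𝕜] TangentSpace I z,
            (∀ v : E, (t v : E) = v) → TensorProduct.map t t (π x) = π z := by
          rintro _ rfl t ht
          have : t = LinearMap.id := LinearMap.ext ht
          rw [this, TensorProduct.map_id, LinearMap.id_apply]
        exact key _ (φ.symm_apply_apply x).symm _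
          fun v => congrArg (fun A : E →L[𝕜] E => A v) h2 }

variable {G : Type*} [Group G] [TopologicalSpace G] [ChartedSpace H G]
  {G' : Type*} [Group G'] [TopologicalSpace G'] [ChartedSpace H' G']
  {F : Type*} [NormedAddCommGroup F] [NormedSpace 𝕜 F] {H₁ : Type*} [TopologicalSpace H₁]
  {I₁ : ModelWithCorners 𝕜 F H₁}
  {F' : Type*} [NormedAddCommGroup F'] [NormedSpace 𝕜 F'] {H₂ : Type*} [TopologicalSpace H₂]
  {I₂ : ModelWithCorners 𝕜 F' H₂}
  {S : Type*} [TopologicalSpace S] [ChartedSpace H₁ S]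
  {S' : Type*} [TopologicalSpace S'] [ChartedSpace H₂ S']

theorem velocity_comp_hom {K : G → G'} (hK : MDifferentiableAt I J K 1) (hK1 : K 1 = 1)
    {k : GroupLieAlgebra I G →ₗ[𝕜] GroupLieAlgebra J G'} (hk : ∀ v, mfderiv I J K 1 v = k v)
    {c : G' → S'} (hc : MDifferentiableAt J I₂ c 1) (s : S') :
    velocity I I₂ (fun b => c (K b)) s = velocity J I₂ c s ∘ₗ k := by
  refine LinearMap.ext fun v => ?_
  have h := HasMFDerivAt.comp (g := c) (I' := J) (g' := (mfderiv J I₂ c 1 : E' →L[𝕜] F')) 1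
    (by rw [hK1]; exact hc.hasMFDerivAt) hK.hasMFDerivAt
  refine (congrArg (fun A : E →L[𝕜] F' => A v) h.mfderiv).trans ?_
  exact congrArg (mfderiv J I₂ c 1 : E' →L[𝕜] F') (hk v)

variable {K : G →* G'} {k : GroupLieAlgebra I G →ₗ[𝕜] GroupLieAlgebra J G'}
  {L : GroupLieAlgebra I G ⊗[𝕜] GroupLieAlgebra I G}
  {L' : GroupLieAlgebra J G' ⊗[𝕜] GroupLieAlgebra J G'}

/-- A homomorphism intertwines the translations by `g` with those by `K g`, so it maps `Λ^L` and
`Λ^R` as soon as its derivative at `1` maps `L` to `L'`. -/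
theorem isPoissonMap_groupTensorField [ContMDiffMul I ∞ G] [ContMDiffMul J ∞ G']
    (hK : ContMDiff I J ∞ K) (hk : ∀ v, mfderiv I J K 1 v = k v)
    (hL : TensorProduct.map k k L = L') :
    IsPoissonMap I J (groupTensorField I L) (groupTensorField J L') K where
  contMDiff := hK
  map_eq g := by
    have hK' := hK.mdifferentiable (by simp)
    have hl : ∀ g : G, MDifferentiable I I (fun b => g * b) := fun g =>
      (contMDiff_mul_left (I := I) (n := ∞)).mdifferentiable (by simp)
    have hr : ∀ g : G, MDifferentiable I I (fun b => b * g) := fun g =>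
      (contMDiff_mul_right (I := I) (n := ∞)).mdifferentiable (by simp)
    have hl' : ∀ g : G', MDifferentiable J J (fun b => g * b) := fun g =>
      (contMDiff_mul_left (I := J) (n := ∞)).mdifferentiable (by simp)
    have hr' : ∀ g : G', MDifferentiable J J (fun b => b * g) := fun g =>
      (contMDiff_mul_right (I := J) (n := ∞)).mdifferentiable (by simp)
    rw [groupTensorField_eq_velocity, groupTensorField_eq_velocity, map_sub,
      map_mfderiv_map_velocity (hl g 1) (mul_one g) (hK' g),
      map_mfderiv_map_velocity (hr g 1) (one_mul g) (hK' g)]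
    simp only [map_mul]
    rw [velocity_comp_hom (hK' 1) (map_one K) hk (hl' (K g) 1),
      velocity_comp_hom (hK' 1) (map_one K) hk (hr' (K g) 1), ← tensor_map_map, ← tensor_map_map,
      hL]

/-- Equivariance turns the image of the orbit map of `s` into the orbit map of `φ s` composed with
`K`. -/
theorem isPoissonMap_actionTensorField [MulAction G S] [MulAction G' S']
    (hK : MDifferentiableAt I J K 1) (hk : ∀ v, mfderiv I J K 1 v = k v)
    (hL : TensorProduct.map k k L = L') {φ : S → S'} (hφ : ContMDiff I₁ I₂ ∞ φ)
    (hequiv : ∀ (g : G) (s : S), φ (g • s) = K g • φ s)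
    (ho : ∀ s : S, MDifferentiableAt I I₁ (fun b : G => b • s) 1)
    (ho' : ∀ s : S', MDifferentiableAt J I₂ (fun b : G' => b • s) 1) :
    IsPoissonMap I₁ I₂ (actionTensorField I I₁ S L) (actionTensorField J I₂ S' L') φ where
  contMDiff := hφ
  map_eq s := by
    rw [actionTensorField_eq_velocity, actionTensorField_eq_velocity, map_neg,
      map_mfderiv_map_velocity (ho s) (one_smul G s) (hφ.mdifferentiable (by simp) s)]
    simp only [hequiv]
    rw [velocity_comp_hom hK (map_one K) hk (ho' (φ s)), ← tensor_map_map, hL]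

end PoissonIsomorphisms

/-! ### Admissibility under isomorphisms of Manin triples. -/

section AdmissibleTransport

theorem ManinTriple.IsIso.isAdmissible {𝕜 𝔡 𝔡' : Type*} [Field 𝕜] [LieRing 𝔡] [LieAlgebra 𝕜 𝔡]
    [LieRing 𝔡'] [LieAlgebra 𝕜 𝔡'] {M : ManinTriple 𝕜 𝔡} {M' : ManinTriple 𝕜 𝔡'}
    {f : 𝔡 ≃ₗ⁅𝕜⁆ 𝔡'} (hf : M.IsIso M' f) {q : Set 𝔡'} (h : M.IsAdmissible (f ⁻¹' q)) :
    M'.IsAdmissible q := by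
  intro a b ha hb
  have key : ∀ a, (∀ x ∈ q, M'.form a x = 0) → ∀ x ∈ f ⁻¹' q, M.form (f.symm a) x = 0 :=
    fun a ha x hx => by simpa [← hf.form_eq] using ha (f x) hx
  have e : f ⁅f.symm a, f.symm b⁆ = ⁅a, b⁆ :=
    (f.toLieHom.map_lie _ _).trans (by simp)
  rw [← e]
  exact h _ _ (key a ha) (key b hb)

end AdmissibleTransport

/-! ### Lie algebras of powers and of subgroups. -/

section PowerLieAlgebras

open Filter Topology Set

variable {𝕜 : Type*} [RCLike 𝕜] {E : Type*} [NormedAddCommGroup E] [NormedSpace 𝕜 E]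
  {H : Type*} [TopologicalSpace H] {I : ModelWithCorners 𝕜 E H}
  {G : Type*} [Group G] [TopologicalSpace G] [ChartedSpace H G]
  [I.Boundaryless] [LieGroup I ∞ G]
  {E' : Type*} [NormedAddCommGroup E'] [NormedSpace 𝕜 E'] {H' : Type*} [TopologicalSpace H']
  {J : ModelWithCorners 𝕜 E' H'} {G' : Type*} [Group G'] [TopologicalSpace G']
  [ChartedSpace H' G'] [J.Boundaryless] [LieGroup J ∞ G']

/-- The charts at the two identities have identity derivative there, so coordinates change nothing.
-/
theorem homDeriv_eq_mfderiv {K : G →* G'} (hK : MDifferentiableAt I J K 1)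
    (v : GroupLieAlgebra I G) : homDeriv I J K v = mfderiv I J K 1 v := by
  have : IsManifold J 1 G' := IsManifold.of_le (n := ∞) (by simp)
  have h1 : HasMFDerivAt J 𝓘(𝕜, E') (extChartAt J (1 : G')) (1 : G')
      (ContinuousLinearMap.id 𝕜 E') := by
    have h := (mdifferentiableAt_extChartAt (I := J) (mem_chart_source H' (1 : G'))).hasMFDerivAt
    rwa [mfderiv_extChartAt_self] at h
  have h2 : HasMFDerivAt 𝓘(𝕜, E) 𝓘(𝕜, E') (fun x => extChartAt J (1 : G') (K (idChart I G x)))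
      (idPt I G) ((ContinuousLinearMap.id 𝕜 E').comp
        ((mfderiv I J K 1 : E →L[𝕜] E').comp (ContinuousLinearMap.id 𝕜 E))) := by
    refine HasMFDerivAt.comp (g := extChartAt J (1 : G')) (I' := J) _ ?_
      (HasMFDerivAt.comp (g := K) (I' := I) _ ?_ (mfderiv_idChart I))
    · rw [idChart_idPt, map_one]
      exact h1
    · rw [idChart_idPt]
      exact hK.hasMFDerivAt
  have h3 := hasMFDerivAt_unique h2
    ((h2.mdifferentiableAt.differentiableAt).hasFDerivAt.hasMFDerivAt)
  exact congrArg (fun A : E →L[𝕜] E' => A v) h3.symm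

/-- The bracket of the Lie algebra of a power of a Lie group. -/
theorem powTangent_lie [CompleteSpace E] (n : ℕ) (v w : Fin n → GroupLieAlgebra I G) :
    powTangent I G n ⁅v, w⁆ = ⁅powTangent I G n v, powTangent I G n w⁆ := by
  have : IsManifold I 1 G := IsManifold.of_le (n := ∞) (by simp)
  funext i
  -- The coordinate projections are homomorphisms whose derivatives are the coordinates of `E ^ n`;
  -- as these respect brackets, the bracket is componentwise.
  have hev : ContMDiff (powModel I n) I ∞ (Pi.evalMonoidHom (fun _ : Fin n => G) i) :=
    contMDiff_apply i
  have hd : ∀ u : Fin n → E, homDeriv (powModel I n) I (Pi.evalMonoidHom (fun _ : Fin n => G) i) u =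
      u i := fun u =>
    (homDeriv_eq_mfderiv (hev.mdifferentiable (by simp) 1) u).trans (mfderiv_apply i 1 u)
  have h := homDeriv_coordBracket hev.contMDiffAt (show Fin n → E from v) (show Fin n → E from w)
  exact ((hd _).symm.trans (h.trans (congrArg₂ (coordBracket I G) (hd v) (hd w)))).symm

variable (I G) in
/-- The identification of `𝔡 ^ n` with the Lie algebra of `D ^ n` as an isomorphism of Lie
algebras. -/
def powTangentLie [CompleteSpace E] (n : ℕ) :
    (Fin n → GroupLieAlgebra I G) ≃ₗ⁅𝕜⁆ GroupLieAlgebra (powModel I n) (Fin n → G) :=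
  { powTangent I G n with map_lie' := fun {v w} => powTangent_lie n v w }

variable (I G) in
/-- The identification of `(𝔡 ^ m) ^ n` with the Lie algebra of `(D ^ m) ^ n` as an isomorphism of
Lie algebras. -/
def powPowTangentLie [CompleteSpace E] (m n : ℕ) :
    (Fin n → Fin m → GroupLieAlgebra I G) ≃ₗ⁅𝕜⁆
      GroupLieAlgebra (powModel (powModel I m) n) (Fin n → Fin m → G) :=
  { powPowTangent I G m n with
    map_lie' := fun {v w} => by
      have h := powTangent_lie (I := powModel I m) (G := Fin m → G) n
        (fun i => powTangent I G m (v i)) (fun i => powTangent I G m (w i))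
      refine Eq.trans ?_ h
      refine congrArg (powTangent (powModel I m) (Fin m → G) n) (funext fun i => ?_)
      exact powTangent_lie m (v i) (w i) }

/-- A smooth homomorphism maps the Lie algebra of a subgroup to the Lie algebra of any subgroup
that contains its image. -/
theorem mfderiv_mem_lieAlgebraOfSubgroup {K : G →* G'} (hK : ContMDiff I J ∞ K) {Q : Subgroup G}
    {Q' : Subgroup G'} (hQ : ∀ q ∈ Q, K q ∈ Q') {v : GroupLieAlgebra I G}
    (hv : v ∈ lieAlgebraOfSubgroup I Q) : mfderiv I J K 1 v ∈ lieAlgebraOfSubgroup J Q' := by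
  obtain ⟨γ, hγ, hadd, hmem, rfl⟩ := hv
  have h0 : γ 0 = 1 := by
    have := hadd 0 0
    simpa using this
  refine ⟨fun t => K (γ t), hK.comp hγ, fun s t => by
      change K (γ (s + t)) = K (γ s) * K (γ t)
      rw [hadd, map_mul],
    fun t => hQ _ (hmem t), ?_⟩
  have h := HasMFDerivAt.comp (g := K) (I' := I) (g' := (mfderiv I J K 1 : E →L[𝕜] E')) 0
    (by rw [h0]; exact (hK.mdifferentiable (by simp) 1).hasMFDerivAt)
    (hγ.mdifferentiable (by simp) 0).hasMFDerivAt
  exact congrArg (fun A : 𝕜 →L[𝕜] E' => A ((NormedSpace.fromTangentSpace (𝕜 := 𝕜) (0 : 𝕜)).symm 1))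
    h.mfderiv

theorem mfderiv_mem_lieAlgebraOfSubgroup_map {K : G ≃* G'} (hK : ContMDiff I J ∞ K)
    (hK' : ContMDiff J I ∞ K.symm) {Q : Subgroup G} {v : GroupLieAlgebra I G} :
    mfderiv I J K 1 v ∈ lieAlgebraOfSubgroup J (Q.map K.toMonoidHom) ↔
      v ∈ lieAlgebraOfSubgroup I Q := by
  refine ⟨fun hv => ?_, fun hv => mfderiv_mem_lieAlgebraOfSubgroup (K := K.toMonoidHom) hK
    (fun q hq => Subgroup.mem_map_of_mem _ hq) hv⟩
  have h := mfderiv_mem_lieAlgebraOfSubgroup (K := K.symm.toMonoidHom) (Q' := Q) hK'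
    (by rintro _ ⟨q, hq, rfl⟩; simpa using hq) hv
  have h1 := HasMFDerivAt.comp (g := K.symm) (I' := J) (g' := (mfderiv J I K.symm 1 : E' →L[𝕜] E)) 1
    (by rw [map_one]; exact (hK'.mdifferentiable (by simp) 1).hasMFDerivAt)
    (hK.mdifferentiable (by simp) 1).hasMFDerivAt
  have e : (K.symm ∘ K : G → G) = id := funext K.symm_apply_apply
  rw [e] at h1
  have h2 := congrArg (fun A : E →L[𝕜] E => A v) (hasMFDerivAt_unique h1 (hasMFDerivAt_id 1))
  have h3 : mfderiv J I K.symm 1 (mfderiv I J K 1 v) = v := h2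
  rw [← h3]
  exact h

end PowerLieAlgebras

/-! ### Smoothness and derivative of the snake isomorphism. -/

section SnakeSmooth

variable {𝕜 : Type*} [RCLike 𝕜] {E : Type*} [NormedAddCommGroup E] [NormedSpace 𝕜 E]
  {H : Type*} [TopologicalSpace H] {I : ModelWithCorners 𝕜 E H}
  {G : Type*} [Group G] [TopologicalSpace G] [ChartedSpace H G]

theorem contMDiff_snakeGroup {k : ℕ∞ω} (m n : ℕ) :
    ContMDiff (powModel I (m * n)) (powModel (powModel I m) n) k (snakeGroup G m n) :=
  contMDiff_pi.2 fun i => contMDiff_pi.2 fun j => contMDiff_apply (snake m n (i, j))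

theorem contMDiff_snakeGroup_symm {k : ℕ∞ω} (m n : ℕ) :
    ContMDiff (powModel (powModel I m) n) (powModel I (m * n)) k (snakeGroup G m n).symm :=
  contMDiff_pi.2 fun l => (contMDiff_apply ((snake m n).symm l).2).comp
    (contMDiff_apply ((snake m n).symm l).1)

theorem mfderiv_snakeGroup [IsManifold I 1 G] (m n : ℕ) (v : Fin (m * n) → GroupLieAlgebra I G) :
    mfderiv (powModel I (m * n)) (powModel (powModel I m) n) (snakeGroup G m n) 1
      (powTangent I G (m * n) v) = powPowTangent I G m n (fun i j => v (snake m n (i, j))) := by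
  funext i
  have hK : ContMDiff (powModel I (m * n)) (powModel (powModel I m) n) 1 (snakeGroup G m n) :=
    contMDiff_snakeGroup m n
  refine (mfderiv_pi (f := snakeGroup G m n) hK.contMDiffAt
    (show Fin (m * n) → E from v) i).trans ?_
  funext j
  refine (mfderiv_pi (f := fun g => snakeGroup G m n g i)
    (contMDiff_pi.1 hK i).contMDiffAt (show Fin (m * n) → E from v) j).trans ?_
  exact mfderiv_apply (snake m n (i, j)) 1 (show Fin (m * n) → E from v)

end SnakeSmooth

end

theorem theoremB {𝕜 : Type*} [RCLike 𝕜]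
    {E : Type*} [NormedAddCommGroup E] [NormedSpace 𝕜 E] [FiniteDimensional 𝕜 E] [CompleteSpace E]
    -- `D` is a simply connected Lie group, with Lie algebra `𝔡 = GroupLieAlgebra 𝓘(𝕜, E) D`
    {D : Type*} [Group D] [TopologicalSpace D] [ChartedSpace E D] [LieGroup 𝓘(𝕜, E) ∞ D]
    [SimplyConnectedSpace D]
    (M : ManinTriple 𝕜 (GroupLieAlgebra 𝓘(𝕜, E) D))
    (m n : ℕ) (hm : 1 ≤ m) (hn : 1 ≤ n)
    (Q : Subgroup (Fin (m * n) → D)) (hQ : IsClosed (Q : Set (Fin (m * n) → D)))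
    -- the manifold structure of `D ^ (m n) / Q`, for which the projection is a submersion
    {F : Type*} [NormedAddCommGroup F] [NormedSpace 𝕜 F]
    [ChartedSpace F ((Fin (m * n) → D) ⧸ Q)]
    [IsManifold 𝓘(𝕜, F) ∞ ((Fin (m * n) → D) ⧸ Q)]
    (hF : Manifold.IsSubmersion (powModel 𝓘(𝕜, E) (m * n)) 𝓘(𝕜, F) ∞
      (fun g : Fin (m * n) → D => (g : (Fin (m * n) → D) ⧸ Q)))
    -- the manifold structure of `(D ^ m) ^ n / I(Q)`, for which the projection is a submersion
    {F' : Type*} [NormedAddCommGroup F'] [NormedSpace 𝕜 F']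
    [ChartedSpace F' ((Fin n → Fin m → D) ⧸ Q.map (snakeGroup D m n).toMonoidHom)]
    [IsManifold 𝓘(𝕜, F') ∞ ((Fin n → Fin m → D) ⧸ Q.map (snakeGroup D m n).toMonoidHom)]
    (hF' : Manifold.IsSubmersion (powModel (powModel 𝓘(𝕜, E) m) n) 𝓘(𝕜, F') ∞
      (fun g : Fin n → Fin m → D =>
        (g : (Fin n → Fin m → D) ⧸ Q.map (snakeGroup D m n).toMonoidHom)))
    -- the Lie algebra `𝔮` of `Q`, as a subset of `𝔡 ^ (m n)`, satisfies `[𝔮^⊥, 𝔮^⊥] ⊂ 𝔮`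
    (hq : (M.polyuble (m * n)).IsAdmissible
      (powTangent 𝓘(𝕜, E) D (m * n) ⁻¹' lieAlgebraOfSubgroup (powModel 𝓘(𝕜, E) (m * n)) Q)) :
    -- the snake is an isomorphism of Manin triples, and the derivative of the group isomorphism
    ((M.polyuble (m * n)).IsIso ((M.polyuble m).polyuble n)
        (snakeLie 𝕜 (GroupLieAlgebra 𝓘(𝕜, E) D) m n) ∧
      ∀ v, mfderiv (powModel 𝓘(𝕜, E) (m * n)) (powModel (powModel 𝓘(𝕜, E) m) n)
          (snakeGroup D m n) 1 (powTangent 𝓘(𝕜, E) D (m * n) v) =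
        powPowTangent 𝓘(𝕜, E) D m n (snakeLie 𝕜 (GroupLieAlgebra 𝓘(𝕜, E) D) m n v)) ∧
    -- both quotients are Poisson homogeneous spaces
    IsPoissonHomogeneousSpace (powModel 𝓘(𝕜, E) (m * n)) 𝓘(𝕜, F)
      ((M.polyuble (m * n)).groupStructure (powTangent 𝓘(𝕜, E) D (m * n)))
      ((M.polyuble (m * n)).spaceStructure 𝓘(𝕜, F) (powTangent 𝓘(𝕜, E) D (m * n))
        ((Fin (m * n) → D) ⧸ Q)) ∧
    IsPoissonHomogeneousSpace (powModel (powModel 𝓘(𝕜, E) m) n) 𝓘(𝕜, F')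
      (((M.polyuble m).polyuble n).groupStructure (powPowTangent 𝓘(𝕜, E) D m n))
      (((M.polyuble m).polyuble n).spaceStructure 𝓘(𝕜, F') (powPowTangent 𝓘(𝕜, E) D m n)
        ((Fin n → Fin m → D) ⧸ Q.map (snakeGroup D m n).toMonoidHom)) ∧
    -- `I` is an isomorphism of Poisson Lie groups, `[g] ↦ [I g]` is equivariant along `I`
    IsPoissonIso (powModel 𝓘(𝕜, E) (m * n)) (powModel (powModel 𝓘(𝕜, E) m) n)
      ((M.polyuble (m * n)).groupStructure (powTangent 𝓘(𝕜, E) D (m * n)))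
      (((M.polyuble m).polyuble n).groupStructure (powPowTangent 𝓘(𝕜, E) D m n))
      (snakeGroup D m n).toEquiv ∧
    (∀ (g : Fin (m * n) → D) (p : (Fin (m * n) → D) ⧸ Q),
      cosetEquiv (snakeGroup D m n) Q (g • p) =
        snakeGroup D m n g • cosetEquiv (snakeGroup D m n) Q p) ∧
    -- and `[g] ↦ [I g]` is a Poisson diffeomorphism
    IsPoissonIso 𝓘(𝕜, F) 𝓘(𝕜, F')
      ((M.polyuble (m * n)).spaceStructure 𝓘(𝕜, F) (powTangent 𝓘(𝕜, E) D (m * n))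
        ((Fin (m * n) → D) ⧸ Q))
      (((M.polyuble m).polyuble n).spaceStructure 𝓘(𝕜, F') (powPowTangent 𝓘(𝕜, E) D m n)
        ((Fin n → Fin m → D) ⧸ Q.map (snakeGroup D m n).toMonoidHom))
      (cosetEquiv (snakeGroup D m n) Q) := by
  have : PreconnectedSpace D := inferInstance
  let IA := powModel 𝓘(𝕜, E) (m * n)
  let IB := powModel (powModel 𝓘(𝕜, E) m) n
  let pA := powTangentLie 𝓘(𝕜, E) D (m * n)
  -- The general results concern Manin triples on the Lie algebra of the group itself, so both
  -- polyubles are transported along the identifications of `𝔡 ^ (m n)` and `(𝔡 ^ m) ^ n`; `hLA` and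
  -- `hLB` record that `Λ` is transported with them.
  let pB := powPowTangentLie 𝓘(𝕜, E) D m n
  let MA := (M.polyuble (m * n)).map pA
  let MB := ((M.polyuble m).polyuble n).map pB
  have hLA : TensorProduct.map (powTangent 𝓘(𝕜, E) D (m * n)).toLinearMap
      (powTangent 𝓘(𝕜, E) D (m * n)).toLinearMap (M.polyuble (m * n)).Lam = MA.Lam :=
    ((M.polyuble (m * n)).isIso_map pA).map_Lam fun _ => rfl
  have hLB : TensorProduct.map (powPowTangent 𝓘(𝕜, E) D m n).toLinearMap
      (powPowTangent 𝓘(𝕜, E) D m n).toLinearMap ((M.polyuble m).polyuble n).Lam = MB.Lam :=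
    (((M.polyuble m).polyuble n).isIso_map pB).map_Lam fun _ => rfl
  have hsnake := snakeLie_isIso M m n
  have hK : ContMDiff IA IB ∞ (snakeGroup D m n) := contMDiff_snakeGroup m n
  have hK' : ContMDiff IB IA ∞ (snakeGroup D m n).symm := contMDiff_snakeGroup_symm m n
  have hman : IsManifold 𝓘(𝕜, E) 1 D := IsManifold.of_le (n := ∞) (by simp)
  have hdK : ∀ v, mfderiv IA IB (snakeGroup D m n) 1 (powTangent 𝓘(𝕜, E) D (m * n) v) =
      powPowTangent 𝓘(𝕜, E) D m n (snakeLie 𝕜 (GroupLieAlgebra 𝓘(𝕜, E) D) m n v) :=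
    fun v => mfderiv_snakeGroup m n v
  -- the derivative of the group isomorphism as a linear map
  let k : GroupLieAlgebra IA (Fin (m * n) → D) →ₗ[𝕜] GroupLieAlgebra IB (Fin n → Fin m → D) :=
    (powPowTangent 𝓘(𝕜, E) D m n).toLinearMap ∘ₗ
      (snakeLie 𝕜 (GroupLieAlgebra 𝓘(𝕜, E) D) m n).toLinearEquiv.toLinearMap ∘ₗ
        (powTangent 𝓘(𝕜, E) D (m * n)).symm.toLinearMap
  have hk : ∀ v, mfderiv IA IB (snakeGroup D m n) 1 v = k v := fun v => hdK v
  have hL : TensorProduct.map k k MA.Lam = MB.Lam := by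
    rw [← hLA, ← hLB, ← hsnake.map_Lam (g :=
      (snakeLie 𝕜 (GroupLieAlgebra 𝓘(𝕜, E) D) m n).toLinearEquiv.toLinearMap) fun _ => rfl,
      tensor_map_map, tensor_map_map]
    rfl
  have hqA : MA.IsAdmissible (lieAlgebraOfSubgroup IA Q) :=
    ((M.polyuble (m * n)).isIso_map pA).isAdmissible hq
  have hqB : MB.IsAdmissible (lieAlgebraOfSubgroup IB (Q.map (snakeGroup D m n).toMonoidHom)) := by
    -- Pulled back to `𝔡 ^ (m n)`, the Lie algebra of the image of `Q` is `𝔮`, because the snake is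
    -- the derivative of the group isomorphism.
    refine (((M.polyuble m).polyuble n).isIso_map pB).isAdmissible (hsnake.isAdmissible ?_)
    convert hq using 1
    ext v
    refine Iff.trans ?_ (mfderiv_mem_lieAlgebraOfSubgroup_map hK hK' (Q := Q)
      (v := powTangent 𝓘(𝕜, E) D (m * n) v))
    rw [hdK]
    rfl
  have hequiv : ∀ (g : Fin (m * n) → D) (p : (Fin (m * n) → D) ⧸ Q),
      cosetEquiv (snakeGroup D m n) Q (g • p) =
        snakeGroup D m n g • cosetEquiv (snakeGroup D m n) Q p := by
    intro g p
    obtain ⟨a, rfl⟩ := QuotientGroup.mk_surjective p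
    change cosetEquiv (snakeGroup D m n) Q ((g * a : Fin (m * n) → D) : (Fin (m * n) → D) ⧸ Q) = _
    rw [cosetEquiv_mk, map_mul]
    rfl
  simp only [ManinTriple.groupStructure, ManinTriple.spaceStructure, hLA, hLB]
  refine ⟨⟨hsnake, hdK⟩, ?_, ?_, ?_, ?_, ?_⟩
  · exact isPoissonHomogeneousSpace_actionTensorField (Q := Q) hqA (fun _ _ => rfl)
      (fun a q hq => QuotientGroup.mk_mul_of_mem a hq) QuotientGroup.mk_surjective hF
  · exact isPoissonHomogeneousSpace_actionTensorField (Q := Q.map (snakeGroup D m n).toMonoidHom) hqB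
      (fun _ _ => rfl) (fun a q hq => QuotientGroup.mk_mul_of_mem a hq)
      QuotientGroup.mk_surjective hF'
  · exact (isPoissonMap_groupTensorField (K := (snakeGroup D m n).toMonoidHom) hK hk hL).isPoissonIso hK'
  · exact hequiv
  · refine (isPoissonMap_actionTensorField (K := (snakeGroup D m n).toMonoidHom)
      (hK.mdifferentiable (by simp) 1) hk hL ?_ hequiv (fun s => ?_) (fun s => ?_)).isPoissonIso ?_
    -- The map of quotients is smooth because its lift to the groups is and the projection is a
    -- submersion; the inverse is treated in the same way below.
    · intro s
      obtain ⟨a, rfl⟩ := QuotientGroup.mk_surjective s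
      refine (hF.isSubmersionAt a).contMDiffAt_of_comp ?_
      exact (hF'.contMDiff.comp hK).contMDiffAt
    · obtain ⟨a, rfl⟩ := QuotientGroup.mk_surjective s
      exact (contMDiff_orbit (fun _ _ => rfl) hF a).mdifferentiable (by simp) 1
    · obtain ⟨a, rfl⟩ := QuotientGroup.mk_surjective s
      exact (contMDiff_orbit (fun _ _ => rfl) hF' a).mdifferentiable (by simp) 1
    · intro s
      obtain ⟨a, rfl⟩ := QuotientGroup.mk_surjective s
      refine (hF'.isSubmersionAt a).contMDiffAt_of_comp ?_
      have e : (fun b : Fin n → Fin m → D => (cosetEquiv (snakeGroup D m n) Q).symm b) =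
          fun b => (((snakeGroup D m n).symm b : Fin (m * n) → D) : (Fin (m * n) → D) ⧸ Q) :=
        funext fun b => by
          rw [Equiv.symm_apply_eq, cosetEquiv_mk, MulEquiv.apply_symm_apply]
      rw [e]
      exact (hF.contMDiff.comp hK').contMDiffAt
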